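/- Let $k$ be an algebraically closed field of characteristic $0$ or of characteristic $p>4$. Let $S=k[[\alpha,\beta,\gamma]]$ act by contraction on the divided power ring $P=k_{dp}[x,y,z]$: on the basis $x^{[a]}y^{[b]}z^{[c]}$ of $P$, multiplication by $\alpha$, $\beta$, $\gamma$ lowers the exponent $a$, $b$, $c$ respectively by one (giving $0$ if that exponent is $0$). For $f\in P$ put $\operatorname{Ann}(f)=\{\sigma\in S : \sigma\lrcorner f=0\}$ and $\operatorname{Apolar}(f)=S/\operatorname{Ann}(f)$. The Hilbert function of a local $k$-algebra $(A,\mathfrak m)$ is $H_A(i)=\dim_k \mathfrak m^i/\mathfrak m^{i+1}$; a local Artinian ring is Gorenstein if its socle $(0:\mathfrak m)$ is a simple module. Consider the following eleven elements of $P$ (powers and products are taken in the ring $P$, so that e.g. $x^4=24\,x^{[4]}$), with leading forms $x^4+y^4+z^4$, $x^3y+z^4$ and $x^2(xy+z^2)$ respectively: 1. $x^4+y^4+z^4$, $\;x^4+y^4+z^4+xyz$; 2. $x^3y+z^4$, $\;x^3y+z^4+y^3$, $\;x^3y+z^4+y^2z$, $\;x^3y+z^4+y^3+y^2z$; 3.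 $x^3y+x^2z^2+y^3$, $\;x^3y+x^2z^2+y^3+yz^2$, $\;x^3y+x^2z^2+y^2z$, $\;x^3y+x^2z^2+yz^2$, $\;x^3y+x^2z^2$. The apolar algebras of these eleven elements are local Artinian Gorenstein $k$-algebras with Hilbert function $(1,3,3,3,1)$, and they are pairwise non-isomorphic as $k$-algebras. If moreover $\operatorname{char} k\neq 13$, then every local Artinian Gorenstein $k$-algebra with Hilbert function $(1,3,3,3,1)$ is isomorphic as a $k$-algebra to exactly one of them; so there are exactly eleven isomorphism types. -/

import Mathlib

noncomputable section

/-! ### The divided power ring and the contraction action -/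

/-- The divided power ring `P = k_dp[x₁, …, xₙ]`: its elements are the finite linear combinations
of the basis elements `x^[a]`, where `a` runs over the multi-indices (`x^[a]` is
`Finsupp.single a 1`). -/
def DPRing (n : ℕ) (k : Type*) [Field k] : Type _ := (Fin n →₀ ℕ) →₀ k

namespace DPRing

variable {n : ℕ} {k : Type*} [Field k]

instance : AddCommGroup (DPRing n k) := inferInstanceAs (AddCommGroup ((Fin n →₀ ℕ) →₀ k))

instance : Module k (DPRing n k) := inferInstanceAs (Module k ((Fin n →₀ ℕ) →₀ k))

/-- The basis element `x^[a]`. -/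
def basis (a : Fin n →₀ ℕ) : DPRing n k := Finsupp.single a (1 : k)

/-- The coefficient of `x^[a]` in `f`. -/
def coeff (a : Fin n →₀ ℕ) (f : DPRing n k) : k := (show (Fin n →₀ ℕ) →₀ k from f) a

/-- The linear map out of `P` that takes prescribed values on the basis `x^[a]`. -/
def lift {M : Type*} [AddCommGroup M] [Module k M] (v : (Fin n →₀ ℕ) → M) :
    DPRing n k →ₗ[k] M :=
  Finsupp.linearCombination k v

theorem lift_basis {M : Type*} [AddCommGroup M] [Module k M] (v : (Fin n →₀ ℕ) → M)
    (a : Fin n →₀ ℕ) : lift v (basis a : DPRing n k) = v a := by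
  unfold lift basis
  erw [Finsupp.linearCombination_single]
  simp

theorem hom_ext {M : Type*} [AddCommGroup M] [Module k M] {φ ψ : DPRing n k →ₗ[k] M}
    (h : ∀ a, φ (basis a) = ψ (basis a)) : φ = ψ :=
  Finsupp.lhom_ext' fun a => LinearMap.ext_ring (h a)

/-- The multi-index binomial coefficient `∏ᵢ (aᵢ + bᵢ choose aᵢ)`. -/
def binom (a b : Fin n →₀ ℕ) : ℕ := ∏ i, (a i + b i).choose (a i)

/-- The multiplication `x^[a] * x^[b] = binom(a + b, a) x^[a + b]`, extended bilinearly. -/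
def mulHom : DPRing n k →ₗ[k] DPRing n k →ₗ[k] DPRing n k :=
  lift fun a => lift fun b => (binom a b : k) • basis (a + b)

theorem mulHom_basis (a b : Fin n →₀ ℕ) :
    mulHom (basis a : DPRing n k) (basis b) = (binom a b : k) • basis (a + b) := by
  simp only [mulHom, lift_basis]

theorem binom_comm (a b : Fin n →₀ ℕ) : binom a b = binom b a := by
  unfold binom
  refine Finset.prod_congr rfl fun i _ => ?_
  rw [add_comm (b i) (a i)]
  exact Nat.choose_symm_add

theorem binom_assoc (a b c : Fin n →₀ ℕ) :
    binom a b * binom (a + b) c = binom b c * binom a (b + c) := by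
  unfold binom
  rw [← Finset.prod_mul_distrib, ← Finset.prod_mul_distrib]
  refine Finset.prod_congr rfl fun i _ => ?_
  simp only [Finsupp.add_apply]
  have h1 := Nat.add_choose_mul_factorial_mul_factorial (a i) (b i)
  have h2 := Nat.add_choose_mul_factorial_mul_factorial (a i + b i) (c i)
  have h3 := Nat.add_choose_mul_factorial_mul_factorial (b i) (c i)
  have h4 := Nat.add_choose_mul_factorial_mul_factorial (a i) (b i + c i)
  have hpos : 0 < (a i).factorial * (b i).factorial * (c i).factorial := by positivity
  refine Nat.eq_of_mul_eq_mul_right hpos ?_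
  rw [← Nat.choose_symm_add] at h1 h2 h3 h4
  rw [← h1] at h2
  rw [← h3, ← add_assoc] at h4
  calc _ = (a i + b i + c i).choose (a i + b i) *
        ((a i + b i).choose (a i) * (a i).factorial * (b i).factorial) * (c i).factorial := by ring
    _ = (a i + b i + c i).choose (a i) * (a i).factorial *
        ((b i + c i).choose (b i) * (b i).factorial * (c i).factorial) := by rw [h2, h4]
    _ = _ := by rw [← add_assoc]; ring

theorem binom_zero (a : Fin n →₀ ℕ) : binom 0 a = 1 := by simp [binom]

instance : Mul (DPRing n k) := ⟨fun f g => mulHom f g⟩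

instance : One (DPRing n k) := ⟨basis 0⟩

theorem mul_def (f g : DPRing n k) : f * g = mulHom f g := rfl

theorem one_def : (1 : DPRing n k) = basis 0 := rfl

protected theorem mul_comm' (f g : DPRing n k) : f * g = g * f := by
  have h : (mulHom : DPRing n k →ₗ[k] _ →ₗ[k] _) = mulHom.flip := by
    refine hom_ext fun a => hom_ext fun b => ?_
    rw [LinearMap.flip_apply, mulHom_basis, mulHom_basis, binom_comm, add_comm]
  exact congrArg (fun φ => φ f g) h

protected theorem one_mul' (f : DPRing n k) : 1 * f = f := by
  have h : mulHom (basis 0 : DPRing n k) = LinearMap.id := by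
    refine hom_ext fun a => ?_
    rw [mulHom_basis, binom_zero]
    simp
  exact congrArg (fun φ => φ f) h

protected theorem mul_assoc' (f g h : DPRing n k) : f * g * h = f * (g * h) := by
  have e : (mulHom : DPRing n k →ₗ[k] _ →ₗ[k] _).compr₂ mulHom =
      ((LinearMap.llcomp k (DPRing n k) (DPRing n k) (DPRing n k)).flip.comp mulHom).flip.comp
        mulHom := by
    refine hom_ext fun a => hom_ext fun b => hom_ext fun c => ?_
    simp only [LinearMap.compr₂_apply, LinearMap.comp_apply, LinearMap.flip_apply,
      LinearMap.llcomp_apply, mulHom_basis, map_smul, LinearMap.smul_apply, smul_smul]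
    rw [← Nat.cast_mul, ← Nat.cast_mul, binom_assoc, add_assoc]
  exact congrArg (fun φ => φ f g h) e

instance : CommRing (DPRing n k) :=
  { (inferInstance : AddCommGroup (DPRing n k)) with
    mul := (· * ·)
    one := 1
    mul_assoc := DPRing.mul_assoc'
    mul_comm := DPRing.mul_comm'
    one_mul := DPRing.one_mul'
    mul_one := fun f => by rw [DPRing.mul_comm', DPRing.one_mul']
    left_distrib := fun f g h => by simp only [mul_def, map_add]
    right_distrib := fun f g h => by simp only [mul_def, map_add, LinearMap.add_apply]
    zero_mul := fun f => by simp only [mul_def, map_zero, LinearMap.zero_apply]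
    mul_zero := fun f => by simp only [mul_def, map_zero] }

/-- The variable `xᵢ` of the divided power ring. -/
def X (i : Fin n) : DPRing n k := basis (Finsupp.single i 1)

/-- The pairing `⟨σ, f⟩` between `S = k[[α₁, …, αₙ]]` and `P`, for which the monomials `α^a` and
the elements `x^[a]` are dual to each other. -/
def pairing (σ : MvPowerSeries (Fin n) k) : DPRing n k →ₗ[k] k :=
  lift fun b => MvPowerSeries.coeff b σ

/-- The contraction action of `S` on `P`: `α^a ⌟ x^[b] = x^[b - a]` if `a ≤ b` and `0` otherwise,
so that `σ ⌟ x^[b]` is the sum of `σ_a x^[c]` over all `a + c = b`. -/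
def contract (σ : MvPowerSeries (Fin n) k) : DPRing n k →ₗ[k] DPRing n k :=
  lift fun b => ∑ q ∈ Finset.HasAntidiagonal.antidiagonal b, MvPowerSeries.coeff q.1 σ • basis q.2

/-- The defining property of the contraction. -/
theorem pairing_contract (τ σ : MvPowerSeries (Fin n) k) (f : DPRing n k) :
    pairing τ (contract σ f) = pairing (τ * σ) f := by
  have h : (pairing τ).comp (contract σ) = pairing (τ * σ) := by
    refine hom_ext fun b => ?_
    rw [LinearMap.comp_apply]
    simp only [contract, pairing, lift_basis, map_sum, map_smul, smul_eq_mul]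
    rw [mul_comm τ σ, MvPowerSeries.coeff_mul]
  exact congrArg (fun φ => φ f) h

theorem pairing_monomial (a : Fin n →₀ ℕ) (f : DPRing n k) :
    pairing (MvPowerSeries.monomial a 1) f = coeff a f := by
  have h : pairing (MvPowerSeries.monomial a (1 : k)) = Finsupp.lapply a := by
    refine hom_ext fun b => ?_
    classical
    simp only [pairing, lift_basis, MvPowerSeries.coeff_monomial]
    unfold basis
    erw [Finsupp.lapply_apply, Finsupp.single_apply]
  exact congrArg (fun φ => φ f) h

theorem eq_of_pairing {f g : DPRing n k} (h : ∀ σ, pairing σ f = pairing σ g) : f = g :=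
  Finsupp.ext fun a => by
    have := h (MvPowerSeries.monomial a 1)
    rwa [pairing_monomial, pairing_monomial] at this

theorem pairing_add (σ τ : MvPowerSeries (Fin n) k) (f : DPRing n k) :
    pairing (σ + τ) f = pairing σ f + pairing τ f := by
  have h : pairing (σ + τ) = pairing σ + (pairing τ : DPRing n k →ₗ[k] k) := by
    refine hom_ext fun b => ?_
    simp only [pairing, lift_basis, LinearMap.add_apply, map_add]
  exact congrArg (fun φ => φ f) h

/-- The apolar ideal `Ann(f) = {σ ∈ S | σ ⌟ f = 0}`. -/
def ann (f : DPRing n k) : Ideal (MvPowerSeries (Fin n) k) where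
  carrier := {σ | contract σ f = 0}
  zero_mem' := eq_of_pairing fun τ => by
    rw [pairing_contract, mul_zero]
    have := pairing_add (0 : MvPowerSeries (Fin n) k) 0 f
    rw [add_zero] at this
    rw [map_zero]
    exact left_eq_add.mp this
  add_mem' := fun {σ σ'} h h' => eq_of_pairing fun τ => by
    rw [pairing_contract, mul_add, pairing_add, ← pairing_contract, ← pairing_contract]
    rw [Set.mem_ofPred_eq] at h h'
    rw [h, h', map_zero, add_zero]
  smul_mem' := fun ρ {σ} h => eq_of_pairing fun τ => by
    rw [pairing_contract, smul_eq_mul, ← mul_assoc, ← pairing_contract]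
    rw [Set.mem_ofPred_eq] at h
    rw [h, map_zero, map_zero]

end DPRing

/-- The apolar algebra `Apolar(f) = S / Ann(f)` of `f ∈ P`. -/
abbrev Apolar {n : ℕ} {k : Type*} [Field k] (f : DPRing n k) : Type _ :=
  MvPowerSeries (Fin n) k ⧸ DPRing.ann f

/-! ### Local Artinian Gorenstein algebras and their Hilbert functions -/

/-- The Hilbert function `H_A(i) = dim_k 𝔪^i / 𝔪^(i+1)` of a local `k`-algebra `(A, 𝔪)`. -/
def localHilbert (k A : Type*) [Field k] [CommRing A] [Algebra k A] [IsLocalRing A] (i : ℕ) : ℕ :=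
  Module.finrank k
    (↥(IsLocalRing.maximalIdeal A ^ i) ⧸
      (IsLocalRing.maximalIdeal A ^ (i + 1)).submoduleOf (IsLocalRing.maximalIdeal A ^ i))

/-- The socle `(0 : 𝔪)` of a local ring `(A, 𝔪)`. -/
def localSocle (A : Type*) [CommRing A] [IsLocalRing A] : Ideal A :=
  Submodule.annihilator (IsLocalRing.maximalIdeal A)

/-- A local Artinian ring is Gorenstein if its socle is a simple module. -/
structure IsArtinianGorenstein (A : Type*) [CommRing A] [IsLocalRing A] : Prop where
  artinian : IsArtinianRing A
  socle_simple : IsSimpleModule A (localSocle A)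

/-- `A` is a local Artinian Gorenstein `k`-algebra with Hilbert function `(1, 3, 3, 3, 1)`. -/
def IsGorenstein13331 (k A : Type*) [Field k] [CommRing A] [Algebra k A] : Prop :=
  ∃ _ : IsLocalRing A, IsArtinianGorenstein A ∧
    ∀ i, localHilbert k A i = [1, 3, 3, 3, 1].getD i 0

/-! ### The eleven dual socle generators -/

section Generators

open DPRing

variable (k : Type*) [Field k]

/-- The leading form `x⁴ + y⁴ + z⁴` (powers and products are those of the divided power ring, so
that for example `x⁴ = 24 x^[4]`). -/
def leadingForm₁ : DPRing 3 k := X 0 ^ 4 + X 1 ^ 4 + X 2 ^ 4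

/-- The leading form `x³y + z⁴`. -/
def leadingForm₂ : DPRing 3 k := X 0 ^ 3 * X 1 + X 2 ^ 4

/-- The leading form `x²(xy + z²)`. -/
def leadingForm₃ : DPRing 3 k := X 0 ^ 2 * (X 0 * X 1 + X 2 ^ 2)

/-- The eleven polynomials, sorted by their leading forms; `X 0`, `X 1`, `X 2` are the variables
`x`, `y`, `z`. -/
def generators13331 : Fin 11 → DPRing 3 k :=
  ![leadingForm₁ k,
    leadingForm₁ k + X 0 * X 1 * X 2,
    leadingForm₂ k,
    leadingForm₂ k + X 1 ^ 3,
    leadingForm₂ k + X 1 ^ 2 * X 2,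
    leadingForm₂ k + X 1 ^ 3 + X 1 ^ 2 * X 2,
    leadingForm₃ k + X 1 ^ 3,
    leadingForm₃ k + X 1 ^ 3 + X 1 * X 2 ^ 2,
    leadingForm₃ k + X 1 ^ 2 * X 2,
    leadingForm₃ k + X 1 * X 2 ^ 2,
    leadingForm₃ k]

end Generators

end

/-! ### Frames -/

section Frames

variable {k A A' : Type*} [Field k] [CommRing A] [Algebra k A] [CommRing A'] [Algebra k A']

/-! Let `m` be the maximal ideal of a Gorenstein algebra of the given shape and `φ` a functional
that does not vanish on the socle. The form `φ(xy)` is nondegenerate, so for generators `a, b, c` of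
`m` the kernel of `k[x,y,z] → A` consists of the `p` with `φ(pq) = 0` for every `q`. Hence the
moments `φ(aⁱbʲcˡ)` determine the algebra (`algEquiv_of_moments`). For the apolar algebra of `f`,
with the classes of the variables as generators, the moments are the coefficients of `f`. The
classification is thus a normal form problem for moments under changes of `a, b, c` and `φ`.

Degree four. The Hilbert function is symmetric, so `m²` and `m³` are each other's orthogonal
complement (`exists_isDualized13331`). Since `m⁵ = 0`, the fourth moments only see `a, b, c` modulo
`m²`; they form a ternary quartic. The form `φ` pairs `m²/m³` with itself and this space has
dimension three, so the quartic has three independent apolar quadrics, namely the quadrics in `a, b,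
c` with value in `m³`. Over an algebraically closed field some direction `e` of `m/m²` has
multiplication `m/m² → m²/m³` of rank one (`exists_isRankOne`). Whether `e²` lies in `m³`, and how
the remaining quadratic relation factors, leads to the quartics `x⁴+y⁴+z⁴`, `x³y+z⁴` and `x³y+x²z²`
(`exists_quartic`).

Lower degrees. Moving `a, b, c` by elements of `m²` keeps the fourth moments and clears all third
moments except `abc` for the first quartic, `b³, b²c` for the second, and `b³, b²c, ab²-3bc²` for
the third (`algEquiv_normalForm₁`, `algEquiv_normalForm₂`, `algEquiv_normalForm₃`). Moving them by
`m³` and multiplying `φ` by a unit clears degrees at most two (`exists_algEquiv_apolar`). Scalings,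
and for the third quartic a shear preserving it, make the surviving moments 0 or 1, leaving 2 + 4 +
5 cases. If `b³` has moment 0, the shear with parameter `τ` changes the last invariant by
`13τφ(b²c)`; this is the only place where characteristic 13 matters.

Non-isomorphism. Which products of elements of `m` fall into `m³` is intrinsic. This tells the three
quartics apart and pins the coordinates down so far that the vanishing of the surviving cubic
expressions, which are elements of `m⁴`, can be compared between two frames of one algebra
(`HasType.unique`). -/

theorem mul_mem_pow_add {m : Ideal A} {i j : ℕ} {x y : A} (hx : x ∈ m ^ i) (hy : y ∈ m ^ j) :
    x * y ∈ m ^ (i + j) := by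
  rw [pow_add]; exact Ideal.mul_mem_mul hx hy

theorem mul_mem_pow_succ {m : Ideal A} {i : ℕ} {x y : A} (hx : x ∈ m ^ i) (hy : y ∈ m) :
    x * y ∈ m ^ (i + 1) := by
  rw [pow_succ]; exact Ideal.mul_mem_mul hx hy

theorem mul_mem_sq {m : Ideal A} {x y : A} (hx : x ∈ m) (hy : y ∈ m) : x * y ∈ m ^ 2 := by
  rw [pow_two]; exact Ideal.mul_mem_mul hx hy

theorem smul_mem_ideal {I : Ideal A} (s : k) {x : A} (hx : x ∈ I) : s • x ∈ I := by
  rw [Algebra.smul_def]; exact I.mul_mem_left _ hx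

theorem lin_mem {I : Ideal A} {a b c : A} (ha : a ∈ I) (hb : b ∈ I) (hc : c ∈ I) (x y z : k) :
    x • a + y • b + z • c ∈ I :=
  I.add_mem (I.add_mem (smul_mem_ideal _ ha) (smul_mem_ideal _ hb)) (smul_mem_ideal _ hc)

/-- Elements `a`, `b`, `c` generating the ideal `m` modulo `m²`, where `A = k + m` and `m⁵ = 0`. -/
structure IsFrame (k : Type*) {A : Type*} [Field k] [CommRing A] [Algebra k A]
    (m : Ideal A) (a b c : A) : Prop where
  mem_a : a ∈ m
  mem_b : b ∈ m
  mem_c : c ∈ m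
  residue : ∀ x : A, ∃ s : k, x - algebraMap k A s ∈ m
  span : ∀ x ∈ m, ∃ s t r : k, x - (s • a + t • b + r • c) ∈ m ^ 2
  pow_five : m ^ 5 = ⊥

/-- A frame together with a dualizing functional `φ`. -/
structure IsDualFrame (m : Ideal A) (a b c : A) (φ : A →ₗ[k] k) : Prop extends
    IsFrame k m a b c where
  nondeg : ∀ x, (∀ y, φ (x * y) = 0) → x = 0

/-- Modulo higher powers an element of `mⁿ` is a form of degree `n` in `a, b, c`. The induction
replaces both factors of a product in `mⁿ · m` by approximations; the two errors gain one power of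
`m` each. -/
theorem adjoin_approx {m : Ideal A} {a b c : A} (R : Subalgebra k A) (ha : a ∈ R) (hb : b ∈ R)
    (hc : c ∈ R) (hma : a ∈ m) (hmb : b ∈ m) (hmc : c ∈ m)
    (residue : ∀ x : A, ∃ s : k, x - algebraMap k A s ∈ m)
    (span : ∀ x ∈ m, ∃ s t r : k, x - (s • a + t • b + r • c) ∈ m ^ 2) (n : ℕ) :
    ∀ x ∈ m ^ n, ∃ y ∈ R, y ∈ m ^ n ∧ x - y ∈ m ^ (n + 1) := by
  induction n with
  | zero =>
    intro x _
    obtain ⟨s, hs⟩ := residue x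
    exact ⟨algebraMap k A s, R.algebraMap_mem s, by simp, by simpa using hs⟩
  | succ n ih =>
    intro x hx
    rw [pow_succ] at hx
    refine Submodule.mul_induction_on hx ?_ ?_
    · intro u hu v hv
      obtain ⟨y, hyR, hy, hxy⟩ := ih u hu
      obtain ⟨s, t, r, h⟩ := span v hv
      have hl := lin_mem (k := k) hma hmb hmc s t r
      refine ⟨y * (s • a + t • b + r • c), R.mul_mem hyR (R.add_mem (R.add_mem
        (R.smul_mem ha s) (R.smul_mem hb t)) (R.smul_mem hc r)), mul_mem_pow_succ hy hl, ?_⟩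
      have e : u * v - y * (s • a + t • b + r • c) =
          u * (v - (s • a + t • b + r • c)) + (u - y) * (s • a + t • b + r • c) := by ring
      rw [e]
      exact Ideal.add_mem _ (by simpa only [add_assoc] using mul_mem_pow_add hu h)
        (mul_mem_pow_succ hxy hl)
    · rintro u v ⟨y, hyR, hy, hxy⟩ ⟨z, hzR, hz, hxz⟩
      refine ⟨y + z, R.add_mem hyR hzR, Ideal.add_mem _ hy hz, ?_⟩
      rw [add_sub_add_comm]
      exact Ideal.add_mem _ hxy hxz

/-- Successive approximation by elements of `R`, the error moving up until it lies in `m ^ N = 0`. A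
general exponent is allowed because the lemma is also needed where only the nilpotency of `m` is
known. -/
theorem mem_of_nilpotent {m : Ideal A} {a b c : A} (R : Subalgebra k A) (ha : a ∈ R) (hb : b ∈ R)
    (hc : c ∈ R) (hma : a ∈ m) (hmb : b ∈ m) (hmc : c ∈ m)
    (residue : ∀ x : A, ∃ s : k, x - algebraMap k A s ∈ m)
    (span : ∀ x ∈ m, ∃ s t r : k, x - (s • a + t • b + r • c) ∈ m ^ 2) {N : ℕ}
    (hN : m ^ N = ⊥) (x : A) : x ∈ R := by
  -- Descending induction on `i`, run as an induction on `j = N - i`.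
  have key : ∀ j, ∀ i, i + j = N → ∀ x ∈ m ^ i, x ∈ R := by
    intro j
    induction j with
    | zero =>
      intro i hi x hx
      rw [add_zero] at hi
      rw [hi, hN, Ideal.mem_bot] at hx
      rw [hx]; exact R.zero_mem
    | succ j ih =>
      intro i hi x hx
      obtain ⟨y, hyR, hy, hxy⟩ := adjoin_approx R ha hb hc hma hmb hmc residue span i x hx
      have := R.add_mem (ih (i + 1) (by omega) _ hxy) hyR
      simpa using this
  exact key N 0 (zero_add _) x (by simp)

namespace IsFrame

variable {m : Ideal A} {a b c : A}

theorem mem_subalgebra (h : IsFrame k m a b c) (R : Subalgebra k A) (ha : a ∈ R) (hb : b ∈ R)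
    (hc : c ∈ R) (x : A) : x ∈ R :=
  mem_of_nilpotent R ha hb hc h.mem_a h.mem_b h.mem_c h.residue h.span h.pow_five x

theorem aeval_surjective (h : IsFrame k m a b c) :
    Function.Surjective (MvPolynomial.aeval (R := k) ![a, b, c]) := fun x => by
  have := h.mem_subalgebra (MvPolynomial.aeval (R := k) ![a, b, c]).range
    ⟨MvPolynomial.X 0, by simp⟩ ⟨MvPolynomial.X 1, by simp⟩ ⟨MvPolynomial.X 2, by simp⟩ x
  exact this

theorem eq_zero_of_mem (h : IsFrame k m a b c) {i : ℕ} (hi : 5 ≤ i) {x : A} (hx : x ∈ m ^ i) :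
    x = 0 := by
  have := Ideal.pow_le_pow_right hi hx
  rwa [h.pow_five, Ideal.mem_bot] at this

theorem mul_eq_zero (h : IsFrame k m a b c) {i j : ℕ} (hi : 5 ≤ i + j) {x y : A}
    (hx : x ∈ m ^ i) (hy : y ∈ m ^ j) : x * y = 0 :=
  h.eq_zero_of_mem hi (mul_mem_pow_add hx hy)

end IsFrame

/-- Two algebras carrying dual frames with the same moments are isomorphic. -/
theorem algEquiv_of_moments {m : Ideal A} {a b c : A} {φ : A →ₗ[k] k} {m' : Ideal A'}
    {a' b' c' : A'} {φ' : A' →ₗ[k] k} (h : IsDualFrame m a b c φ) (h' : IsDualFrame m' a' b' c' φ')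
    (H : ∀ i j l : ℕ, φ (a ^ i * b ^ j * c ^ l) = φ' (a' ^ i * b' ^ j * c' ^ l)) :
    Nonempty (A ≃ₐ[k] A') := by
  have hs := h.aeval_surjective
  have hs' := h'.aeval_surjective
  have hφ : ∀ p, φ (MvPolynomial.aeval (R := k) ![a, b, c] p) =
      φ' (MvPolynomial.aeval (R := k) ![a', b', c'] p) := by
    intro p
    have : φ ∘ₗ (MvPolynomial.aeval (R := k) ![a, b, c]).toLinearMap =
        φ' ∘ₗ (MvPolynomial.aeval (R := k) ![a', b', c']).toLinearMap := by
      refine MvPolynomial.linearMap_ext fun d => LinearMap.ext_ring ?_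
      simpa [MvPolynomial.aeval_monomial, Finsupp.prod_fintype, Fin.prod_univ_three] using
        H (d 0) (d 1) (d 2)
    exact congrArg (fun ψ => ψ p) this
  -- By nondegeneracy the kernel is the radical of the form `(p, q) ↦ φ(pq)` on polynomials, and the
  -- moments determine this form.
  have hker : RingHom.ker (MvPolynomial.aeval (R := k) ![a, b, c]) =
      RingHom.ker (MvPolynomial.aeval (R := k) ![a', b', c']) := by
    ext p
    rw [RingHom.mem_ker, RingHom.mem_ker]
    constructor
    · intro hp
      refine h'.nondeg _ fun y => ?_
      obtain ⟨q, rfl⟩ := hs' y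
      rw [← map_mul, ← hφ, map_mul, hp, zero_mul, map_zero]
    · intro hp
      refine h.nondeg _ fun y => ?_
      obtain ⟨q, rfl⟩ := hs y
      rw [← map_mul, hφ, map_mul, hp, zero_mul, map_zero]
  exact ⟨(Ideal.quotientKerAlgEquivOfSurjective hs).symm.trans
    ((Ideal.quotientEquivAlgOfEq k hker).trans (Ideal.quotientKerAlgEquivOfSurjective hs'))⟩

theorem IsDualFrame.map {m : Ideal A} {a b c : A} {φ : A →ₗ[k] k} (h : IsDualFrame m a b c φ)
    (e : A ≃ₐ[k] A') :
    IsDualFrame (m.map e) (e a) (e b) (e c) (φ ∘ₗ e.symm.toLinearMap) where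
  mem_a := Ideal.mem_map_of_mem e h.mem_a
  mem_b := Ideal.mem_map_of_mem e h.mem_b
  mem_c := Ideal.mem_map_of_mem e h.mem_c
  residue := fun x => by
    obtain ⟨s, hs⟩ := h.residue (e.symm x)
    refine ⟨s, ?_⟩
    have := Ideal.mem_map_of_mem e hs
    simpa using this
  span := fun x hx => by
    obtain ⟨y, hy, rfl⟩ := (Ideal.mem_map_of_equiv e.toRingEquiv x).1 hx
    obtain ⟨s, t, r, hs⟩ := h.span y hy
    refine ⟨s, t, r, ?_⟩
    have := Ideal.mem_map_of_mem e hs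
    rw [Ideal.map_pow] at this
    simpa using this
  pow_five := by rw [← Ideal.map_pow, h.pow_five, Ideal.map_bot]
  nondeg := fun x hx => by
    have : e.symm x = 0 := h.nondeg _ fun y => by simpa using hx (e y)
    simpa using this

end Frames

/-! ### Apolar algebras as algebras with a dual frame -/

section ApolarFrame

open DPRing

variable {n : ℕ} {k : Type*} [Field k]

theorem pairing_eq_sum (σ : MvPowerSeries (Fin n) k) (f : DPRing n k) :
    pairing σ f = Finsupp.sum (show (Fin n →₀ ℕ) →₀ k from f)
      fun d c => c * MvPowerSeries.coeff d σ := by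
  unfold pairing lift
  erw [Finsupp.linearCombination_apply]
  rfl

/-- The pairing as a linear functional on power series. -/
noncomputable def pairingLeft (f : DPRing n k) : MvPowerSeries (Fin n) k →ₗ[k] k where
  toFun σ := pairing σ f
  map_add' σ τ := pairing_add σ τ f
  map_smul' s σ := by
    simp only [pairing_eq_sum, RingHom.id_apply, smul_eq_mul, Finsupp.sum, Finset.mul_sum]
    refine Finset.sum_congr rfl fun d _ => ?_
    rw [MvPowerSeries.coeff_smul]
    ring

theorem pairing_eq_zero_of_coeff {N : ℕ} {f : DPRing n k}
    (hf : ∀ d : Fin n →₀ ℕ, N ≤ d.degree → coeff d f = 0) {σ : MvPowerSeries (Fin n) k}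
    (hσ : ∀ d : Fin n →₀ ℕ, d.degree < N → MvPowerSeries.coeff d σ = 0) : pairing σ f = 0 := by
  rw [pairing_eq_sum]
  refine Finset.sum_eq_zero fun d _ => ?_
  change coeff d f * MvPowerSeries.coeff d σ = 0
  rcases lt_or_ge d.degree N with h | h
  · rw [hσ d h, mul_zero]
  · rw [hf d h, zero_mul]

theorem mem_ann_iff (f : DPRing n k) (σ : MvPowerSeries (Fin n) k) :
    σ ∈ ann f ↔ ∀ τ, pairing (τ * σ) f = 0 := by
  constructor
  · intro h τ
    have h' : contract σ f = 0 := h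
    rw [← pairing_contract, h', map_zero]
  · intro h
    show contract σ f = 0
    refine eq_of_pairing fun τ => ?_
    rw [pairing_contract, h, map_zero]

/-- Multiplying by any `τ` does not lower the order of `σ`, so every multiple of `σ` still pairs to
zero with a polynomial of degree less than `N`. -/
theorem mem_ann_of_coeff {N : ℕ} {f : DPRing n k}
    (hf : ∀ d : Fin n →₀ ℕ, N ≤ d.degree → coeff d f = 0) {σ : MvPowerSeries (Fin n) k}
    (hσ : ∀ d : Fin n →₀ ℕ, d.degree < N → MvPowerSeries.coeff d σ = 0) : σ ∈ ann f := by
  rw [mem_ann_iff]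
  intro τ
  refine pairing_eq_zero_of_coeff hf fun d hd => MvPowerSeries.coeff_of_lt_order ?_
  calc (d.degree : ℕ∞) < N := by exact_mod_cast hd
    _ ≤ σ.order := MvPowerSeries.nat_le_order hσ
    _ ≤ τ.order + σ.order := le_add_self
    _ ≤ _ := MvPowerSeries.le_order_mul

/-- The functional on the apolar algebra of `f` induced by the pairing with `f`. -/
noncomputable def apolarFunctional (f : DPRing n k) : Apolar f →ₗ[k] k :=
  (Submodule.liftQ ((ann f).restrictScalars k) (pairingLeft f) fun σ hσ => by
    have := (mem_ann_iff f σ).1 hσ 1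
    rw [one_mul] at this
    exact this) ∘ₗ (Submodule.Quotient.restrictScalarsEquiv k (ann f)).symm.toLinearMap

theorem apolarFunctional_mk (f : DPRing n k) (σ : MvPowerSeries (Fin n) k) :
    apolarFunctional f (Ideal.Quotient.mk (ann f) σ) = pairing σ f := rfl

/-- The radical of `(σ, τ) ↦ ⟨τσ, f⟩` is exactly `Ann(f)`, because contraction is adjoint to
multiplication. -/
theorem apolarFunctional_nondeg (f : DPRing n k) (x : Apolar f)
    (h : ∀ y, apolarFunctional f (x * y) = 0) : x = 0 := by
  obtain ⟨σ, rfl⟩ := Ideal.Quotient.mk_surjective x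
  rw [Ideal.Quotient.eq_zero_iff_mem, mem_ann_iff]
  intro τ
  have := h (Ideal.Quotient.mk _ τ)
  rwa [← map_mul, apolarFunctional_mk, mul_comm] at this

theorem apolar_nontrivial {f : DPRing n k} (hf : f ≠ 0) : Nontrivial (Apolar f) := by
  refine Ideal.Quotient.nontrivial_iff.2 fun h => hf ?_
  have h1 : (1 : MvPowerSeries (Fin n) k) ∈ ann f := by rw [h]; trivial
  rw [mem_ann_iff] at h1
  refine eq_of_pairing fun τ => ?_
  rw [map_zero, ← h1 τ, mul_one]

theorem apolar_isLocalRing {f : DPRing n k} (hf : f ≠ 0) : IsLocalRing (Apolar f) :=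
  have := apolar_nontrivial hf
  IsLocalRing.of_surjective' (Ideal.Quotient.mk (ann f)) Ideal.Quotient.mk_surjective

theorem mem_maximalIdeal_mvPowerSeries_iff (σ : MvPowerSeries (Fin n) k) :
    σ ∈ IsLocalRing.maximalIdeal (MvPowerSeries (Fin n) k) ↔ MvPowerSeries.constantCoeff σ = 0 := by
  rw [IsLocalRing.mem_maximalIdeal, mem_nonunits_iff, MvPowerSeries.isUnit_iff_constantCoeff,
    isUnit_iff_ne_zero, not_not]

theorem mk_mem_maximalIdeal_iff {f : DPRing n k} [IsLocalRing (Apolar f)]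
    (σ : MvPowerSeries (Fin n) k) :
    Ideal.Quotient.mk (ann f) σ ∈ IsLocalRing.maximalIdeal (Apolar f) ↔
      MvPowerSeries.constantCoeff σ = 0 := by
  have hl := IsLocalHom.of_surjective (Ideal.Quotient.mk (ann f)) Ideal.Quotient.mk_surjective
  rw [← mem_maximalIdeal_mvPowerSeries_iff, IsLocalRing.mem_maximalIdeal,
    IsLocalRing.mem_maximalIdeal, mem_nonunits_iff, mem_nonunits_iff, isUnit_map_iff]

theorem coeff_eq_zero_of_mem_pow {N : ℕ} {σ : MvPowerSeries (Fin n) k}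
    (h : σ ∈ IsLocalRing.maximalIdeal (MvPowerSeries (Fin n) k) ^ N) (d : Fin n →₀ ℕ)
    (hd : d.degree < N) : MvPowerSeries.coeff d σ = 0 := by
  refine MvPowerSeries.coeff_of_lt_order
    (lt_of_lt_of_le (b := (N : ℕ∞)) (by exact_mod_cast hd) ?_)
  clear hd d
  induction N generalizing σ with
  | zero => simp
  | succ N ih =>
    rw [pow_succ] at h
    refine Submodule.mul_induction_on h (fun u hu v hv => ?_) (fun u v hu hv => ?_)
    · rw [mem_maximalIdeal_mvPowerSeries_iff] at hv
      push_cast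
      exact (add_le_add (ih hu) (MvPowerSeries.one_le_order_iff_constCoeff_eq_zero.2 hv)).trans
        MvPowerSeries.le_order_mul
    · exact (le_min hu hv).trans MvPowerSeries.min_order_le_add

/-- Modulo `Ann(f)` a series may be truncated at degree `N`, which exceeds the degree of `f`. For
the resulting polynomial, membership in a power of the ideal of the variables can be read off
coefficients. -/
theorem mk_mem_pow_of_coeff {N M : ℕ} {f : DPRing n k} [IsLocalRing (Apolar f)]
    (hf : ∀ d : Fin n →₀ ℕ, N ≤ d.degree → coeff d f = 0) {σ : MvPowerSeries (Fin n) k}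
    (hσ : ∀ d : Fin n →₀ ℕ, d.degree < M → MvPowerSeries.coeff d σ = 0) :
    Ideal.Quotient.mk (ann f) σ ∈ IsLocalRing.maximalIdeal (Apolar f) ^ M := by
  set p := MvPowerSeries.truncTotal N σ
  have e : Ideal.Quotient.mk (ann f) σ =
      Ideal.Quotient.mk (ann f) (p : MvPowerSeries (Fin n) k) := by
    rw [Ideal.Quotient.eq]
    refine mem_ann_of_coeff hf fun d hd => ?_
    rw [map_sub, MvPolynomial.coeff_coe, MvPowerSeries.coeff_truncTotal _ hd, sub_self]
  rw [e]
  have hp : p ∈ MvPolynomial.idealOfVars (Fin n) k ^ M := by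
    rw [MvPolynomial.mem_pow_idealOfVars_iff']
    intro d hd
    rcases lt_or_ge d.degree N with h | h
    · rw [MvPowerSeries.coeff_truncTotal _ h, hσ d hd]
    · rw [MvPowerSeries.coeff_truncTotal_eq_zero _ h]
  have hle : (MvPolynomial.idealOfVars (Fin n) k).map
      ((Ideal.Quotient.mk (ann f)).comp MvPolynomial.coeToMvPowerSeries.ringHom) ≤
      IsLocalRing.maximalIdeal (Apolar f) := by
    rw [MvPolynomial.idealOfVars, Ideal.map_span, Ideal.span_le]
    rintro _ ⟨_, ⟨i, rfl⟩, rfl⟩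
    rw [RingHom.comp_apply, SetLike.mem_coe, mk_mem_maximalIdeal_iff]
    simp
  have := Ideal.mem_map_of_mem
    ((Ideal.Quotient.mk (ann f)).comp MvPolynomial.coeToMvPowerSeries.ringHom) hp
  rw [Ideal.map_pow] at this
  exact Ideal.pow_right_mono hle M this

theorem apolar_pow_eq_bot {N : ℕ} {f : DPRing n k} [IsLocalRing (Apolar f)]
    (hf : ∀ d : Fin n →₀ ℕ, N ≤ d.degree → coeff d f = 0) :
    IsLocalRing.maximalIdeal (Apolar f) ^ N = ⊥ := by
  have hle : IsLocalRing.maximalIdeal (Apolar f) ≤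
      (IsLocalRing.maximalIdeal (MvPowerSeries (Fin n) k)).map (Ideal.Quotient.mk (ann f)) := by
    intro x hx
    obtain ⟨σ, rfl⟩ := Ideal.Quotient.mk_surjective x
    rw [mk_mem_maximalIdeal_iff] at hx
    exact Ideal.mem_map_of_mem _ ((mem_maximalIdeal_mvPowerSeries_iff σ).2 hx)
  refine le_bot_iff.1 ((Ideal.pow_right_mono hle N).trans ?_)
  rw [← Ideal.map_pow, Ideal.map_le_iff_le_comap]
  intro σ hσ
  rw [Ideal.mem_comap, Ideal.mem_bot, Ideal.Quotient.eq_zero_iff_mem]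
  exact mem_ann_of_coeff hf (coeff_eq_zero_of_mem_pow hσ)

/-- The multi-index `(i, j, l)`. -/
noncomputable def index (i j l : ℕ) : Fin 3 →₀ ℕ := Finsupp.equivFunOnFinite.symm ![i, j, l]

theorem index_eq (d : Fin 3 →₀ ℕ) : index (d 0) (d 1) (d 2) = d := by
  ext i; fin_cases i <;> rfl

theorem index_inj {i j l i' j' l' : ℕ} :
    index i j l = index i' j' l' ↔ i = i' ∧ j = j' ∧ l = l' := by
  constructor
  · intro h
    exact ⟨congrArg (fun d => d 0) h, congrArg (fun d => d 1) h, congrArg (fun d => d 2) h⟩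
  · rintro ⟨rfl, rfl, rfl⟩; rfl

theorem degree_index (i j l : ℕ) : (index i j l).degree = i + j + l := by
  rw [Finsupp.degree_eq_sum, Fin.sum_univ_three]; rfl

theorem monomial_index (i j l : ℕ) : (MvPowerSeries.monomial (index i j l) (1 : k)) =
    MvPowerSeries.X 0 ^ i * MvPowerSeries.X 1 ^ j * MvPowerSeries.X 2 ^ l := by
  rw [MvPowerSeries.X_pow_eq, MvPowerSeries.X_pow_eq, MvPowerSeries.X_pow_eq,
    MvPowerSeries.monomial_mul_monomial, MvPowerSeries.monomial_mul_monomial, one_mul, one_mul]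
  congr 2
  refine Finsupp.ext fun t => ?_
  fin_cases t <;> simp [index]

/-- The apolar algebra of a nonzero polynomial of degree at most four carries a dual frame
whose moments are the coefficients of the polynomial. -/
theorem apolar_isDualFrame {f : DPRing 3 k} [IsLocalRing (Apolar f)]
    (hf : ∀ d : Fin 3 →₀ ℕ, 5 ≤ d.degree → coeff d f = 0) :
    IsDualFrame (IsLocalRing.maximalIdeal (Apolar f))
      (Ideal.Quotient.mk (ann f) (MvPowerSeries.X 0)) (Ideal.Quotient.mk (ann f) (MvPowerSeries.X 1))
      (Ideal.Quotient.mk (ann f) (MvPowerSeries.X 2)) (apolarFunctional f) where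
  mem_a := by rw [mk_mem_maximalIdeal_iff]; simp
  mem_b := by rw [mk_mem_maximalIdeal_iff]; simp
  mem_c := by rw [mk_mem_maximalIdeal_iff]; simp
  residue := fun x => by
    obtain ⟨σ, rfl⟩ := Ideal.Quotient.mk_surjective x
    refine ⟨MvPowerSeries.constantCoeff σ, ?_⟩
    have e : algebraMap k (Apolar f) (MvPowerSeries.constantCoeff σ) =
      Ideal.Quotient.mk (ann f) (MvPowerSeries.C (MvPowerSeries.constantCoeff σ)) := rfl
    rw [e, ← map_sub, mk_mem_maximalIdeal_iff]
    simp
  span := fun x hx => by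
    obtain ⟨σ, rfl⟩ := Ideal.Quotient.mk_surjective x
    rw [mk_mem_maximalIdeal_iff] at hx
    refine ⟨MvPowerSeries.coeff (index 1 0 0) σ, MvPowerSeries.coeff (index 0 1 0) σ,
      MvPowerSeries.coeff (index 0 0 1) σ, ?_⟩
    have e : ∀ (s : k) (τ : MvPowerSeries (Fin 3) k), s • Ideal.Quotient.mk (ann f) τ =
      Ideal.Quotient.mk (ann f) (s • τ) := fun _ _ => rfl
    rw [e, e, e, ← map_add, ← map_add, ← map_sub]
    refine mk_mem_pow_of_coeff hf fun d hd => ?_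
    have h0 : (MvPowerSeries.X 0 : MvPowerSeries (Fin 3) k) =
      MvPowerSeries.monomial (index 1 0 0) 1 := by simp [monomial_index]
    have h1 : (MvPowerSeries.X 1 : MvPowerSeries (Fin 3) k) =
      MvPowerSeries.monomial (index 0 1 0) 1 := by simp [monomial_index]
    have h2 : (MvPowerSeries.X 2 : MvPowerSeries (Fin 3) k) =
      MvPowerSeries.monomial (index 0 0 1) 1 := by simp [monomial_index]
    classical
    rw [h0, h1, h2]
    simp only [map_sub, map_add, MvPowerSeries.coeff_smul, MvPowerSeries.coeff_monomial]
    rw [← index_eq d] at hd ⊢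
    rw [degree_index] at hd
    generalize d 0 = i at *
    generalize d 1 = j at *
    generalize d 2 = l at *
    simp only [index_inj]
    obtain ⟨rfl, rfl, rfl⟩ | ⟨rfl, rfl, rfl⟩ | ⟨rfl, rfl, rfl⟩ | ⟨rfl, rfl, rfl⟩ :
      (i = 0 ∧ j = 0 ∧ l = 0) ∨ (i = 1 ∧ j = 0 ∧ l = 0) ∨ (i = 0 ∧ j = 1 ∧ l = 0) ∨
        (i = 0 ∧ j = 0 ∧ l = 1) := by omega
    · have : index 0 0 0 = 0 := by ext t; fin_cases t <;> rfl
      simpa [this] using hx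
    all_goals simp
  pow_five := apolar_pow_eq_bot hf
  nondeg := apolarFunctional_nondeg f

theorem apolarFunctional_moment (f : DPRing 3 k) (i j l : ℕ) :
    apolarFunctional f (Ideal.Quotient.mk (ann f) (MvPowerSeries.X 0) ^ i *
      Ideal.Quotient.mk (ann f) (MvPowerSeries.X 1) ^ j *
      Ideal.Quotient.mk (ann f) (MvPowerSeries.X 2) ^ l) = coeff (index i j l) f := by
  rw [← map_pow, ← map_pow, ← map_pow, ← map_mul, ← map_mul, ← monomial_index,
    apolarFunctional_mk, pairing_monomial]

end ApolarFrame

/-! ### Coefficients of the normal forms in the divided power ring -/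

section NormalForms

open DPRing

variable {k : Type*} [Field k]

theorem binom_single {n : ℕ} (t : Fin n) (d : Fin n →₀ ℕ) :
    binom (Finsupp.single t 1) d = d t + 1 := by
  classical
  unfold binom
  rw [Finset.prod_eq_single t]
  · simp [add_comm]
  · intro i _ hi
    simp [hi.symm]
  · simp

theorem X_mul_basis {n : ℕ} (t : Fin n) (d : Fin n →₀ ℕ) :
    (X t * basis d : DPRing n k) = ((d t + 1 : ℕ) : k) • basis (Finsupp.single t 1 + d) := by
  rw [X, mul_def, mulHom_basis, binom_single]

theorem dp_mul_smul {n : ℕ} (f g : DPRing n k) (s : k) : f * (s • g) = s • (f * g) := by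
  simp only [mul_def, map_smul]

/-- Multiplying `x^[d]` by `x` gives the factor `d + 1`; iterating yields the factorials. They are
the source of the values 24, 6, 4 and 2 among the moments below. -/
theorem X_pow_mul_X_pow (i j l : ℕ) : (X 0 ^ i * (X 1 ^ j * X 2 ^ l) : DPRing 3 k) =
    ((i.factorial * (j.factorial * l.factorial) : ℕ) : k) • basis (index i j l) := by
  have h2 : (X 2 ^ l : DPRing 3 k) = (l.factorial : k) • basis (index 0 0 l) := by
    induction l with
    | zero =>
      have : index 0 0 0 = 0 := by ext t; fin_cases t <;> rfl
      simp [this, one_def]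
    | succ l ih =>
      have e : Finsupp.single 2 1 + index 0 0 l = index 0 0 (l + 1) := by
        ext t; fin_cases t <;> simp [index, add_comm]
      rw [pow_succ', ih, dp_mul_smul, X_mul_basis, e, smul_smul, Nat.factorial_succ]
      push_cast
      rw [mul_comm]
      simp [index]
  have h1 : (X 1 ^ j * X 2 ^ l : DPRing 3 k) =
      ((j.factorial * l.factorial : ℕ) : k) • basis (index 0 j l) := by
    induction j with
    | zero => simp [h2]
    | succ j ih =>
      have e : Finsupp.single 1 1 + index 0 j l = index 0 (j + 1) l := by
        ext t; fin_cases t <;> simp [index, add_comm]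
      rw [pow_succ', mul_assoc, ih, dp_mul_smul, X_mul_basis, e, smul_smul, Nat.factorial_succ]
      congr 1
      simp [index]
      ring
  induction i with
  | zero => simp [h1]
  | succ i ih =>
    have e : Finsupp.single 0 1 + index i j l = index (i + 1) j l := by
      ext t; fin_cases t <;> simp [index, add_comm]
    rw [pow_succ', mul_assoc, ih, dp_mul_smul, X_mul_basis, e, smul_smul, Nat.factorial_succ]
    congr 1
    simp [index]
    ring

theorem coeff_add {n : ℕ} (d : Fin n →₀ ℕ) (f g : DPRing n k) :
    coeff d (f + g) = coeff d f + coeff d g := rfl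

theorem coeff_smul {n : ℕ} (d : Fin n →₀ ℕ) (s : k) (f : DPRing n k) :
    coeff d (s • f) = s * coeff d f := rfl

theorem coeff_monomial_index (i j l i' j' l' : ℕ) :
    coeff (index i j l) (X 0 ^ i' * (X 1 ^ j' * X 2 ^ l') : DPRing 3 k) =
      if i = i' ∧ j = j' ∧ l = l' then
        ((i'.factorial * (j'.factorial * l'.factorial) : ℕ) : k) else 0 := by
  classical
  have h : coeff (index i j l) (basis (index i' j' l') : DPRing 3 k) =
      if index i' j' l' = index i j l then 1 else 0 := by
    unfold coeff basis
    exact Finsupp.single_apply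
  rw [X_pow_mul_X_pow, coeff_smul, h]
  simp only [index_inj, eq_comm (a := i'), eq_comm (a := j'), eq_comm (a := l'), mul_ite, mul_one,
    mul_zero]

variable (k) in
/-- The polynomial `x⁴ + y⁴ + z⁴ + e xyz`. -/
noncomputable def normalForm₁ (e : k) : DPRing 3 k := leadingForm₁ k + e • (X 0 * X 1 * X 2)

variable (k) in
/-- The polynomial `x³y + z⁴ + p y³ + q y²z`. -/
noncomputable def normalForm₂ (p q : k) : DPRing 3 k :=
  leadingForm₂ k + p • X 1 ^ 3 + q • (X 1 ^ 2 * X 2)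

variable (k) in
/-- The polynomial `x³y + x²z² + p y³ + q y²z + r yz²`. -/
noncomputable def normalForm₃ (p q r : k) : DPRing 3 k :=
  leadingForm₃ k + p • X 1 ^ 3 + q • (X 1 ^ 2 * X 2) + r • (X 1 * X 2 ^ 2)

theorem coeff_normalForm₁ (e : k) (i j l : ℕ) : coeff (index i j l) (normalForm₁ k e) =
    (if i = 4 ∧ j = 0 ∧ l = 0 then 24 else 0) + (if i = 0 ∧ j = 4 ∧ l = 0 then 24 else 0) +
    (if i = 0 ∧ j = 0 ∧ l = 4 then 24 else 0) + (if i = 1 ∧ j = 1 ∧ l = 1 then e else 0) := by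
  have h : normalForm₁ k e = X 0 ^ 4 * (X 1 ^ 0 * X 2 ^ 0) + X 0 ^ 0 * (X 1 ^ 4 * X 2 ^ 0) +
      X 0 ^ 0 * (X 1 ^ 0 * X 2 ^ 4) + e • (X 0 ^ 1 * (X 1 ^ 1 * X 2 ^ 1)) := by
    simp only [normalForm₁, leadingForm₁, pow_zero, pow_one, mul_one, one_mul, mul_assoc]
  rw [h]
  simp only [coeff_add, coeff_smul, coeff_monomial_index]
  simp [Nat.factorial]

theorem coeff_normalForm₂ (p q : k) (i j l : ℕ) : coeff (index i j l) (normalForm₂ k p q) =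
    (if i = 3 ∧ j = 1 ∧ l = 0 then 6 else 0) + (if i = 0 ∧ j = 0 ∧ l = 4 then 24 else 0) +
    (if i = 0 ∧ j = 3 ∧ l = 0 then p * 6 else 0) +
    (if i = 0 ∧ j = 2 ∧ l = 1 then q * 2 else 0) := by
  have h : normalForm₂ k p q = X 0 ^ 3 * (X 1 ^ 1 * X 2 ^ 0) + X 0 ^ 0 * (X 1 ^ 0 * X 2 ^ 4) +
      p • (X 0 ^ 0 * (X 1 ^ 3 * X 2 ^ 0)) + q • (X 0 ^ 0 * (X 1 ^ 2 * X 2 ^ 1)) := by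
    simp only [normalForm₂, leadingForm₂, pow_zero, pow_one, mul_one, one_mul]
  rw [h]
  simp only [coeff_add, coeff_smul, coeff_monomial_index]
  simp [Nat.factorial]

theorem coeff_normalForm₃ (p q r : k) (i j l : ℕ) : coeff (index i j l) (normalForm₃ k p q r) =
    (if i = 3 ∧ j = 1 ∧ l = 0 then 6 else 0) + (if i = 2 ∧ j = 0 ∧ l = 2 then 4 else 0) +
    (if i = 0 ∧ j = 3 ∧ l = 0 then p * 6 else 0) +
    (if i = 0 ∧ j = 2 ∧ l = 1 then q * 2 else 0) +
    (if i = 0 ∧ j = 1 ∧ l = 2 then r * 2 else 0) := by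
  have h : normalForm₃ k p q r = X 0 ^ 3 * (X 1 ^ 1 * X 2 ^ 0) + X 0 ^ 2 * (X 1 ^ 0 * X 2 ^ 2) +
      p • (X 0 ^ 0 * (X 1 ^ 3 * X 2 ^ 0)) + q • (X 0 ^ 0 * (X 1 ^ 2 * X 2 ^ 1)) +
      r • (X 0 ^ 0 * (X 1 ^ 1 * X 2 ^ 2)) := by
    simp only [normalForm₃, leadingForm₃, pow_zero, pow_one, mul_one, one_mul]
    ring
  rw [h]
  simp only [coeff_add, coeff_smul, coeff_monomial_index]
  norm_num [Nat.factorial]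

end NormalForms

/-! ### Fourth moments as a quartic form; dual frames and the socle -/

section Quartics

variable {k A : Type*} [Field k] [CommRing A] [Algebra k A]

/-- The fully polarized quartic form, in terms of its fifteen coefficients. With four independent
arguments, single moments, pairings with a fixed quadric and linear changes of coordinates are all
obtained by substituting scalars. -/
theorem map_lin_mul_lin (φ : A →ₗ[k] k) (a b c : A) (x₁ y₁ z₁ x₂ y₂ z₂ x₃ y₃ z₃ x₄ y₄ z₄ : k) :
    φ ((x₁ • a + y₁ • b + z₁ • c) * (x₂ • a + y₂ • b + z₂ • c) *
        (x₃ • a + y₃ • b + z₃ • c) * (x₄ • a + y₄ • b + z₄ • c)) =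
      (x₁ * x₂ * x₃ * x₄) * φ (a ^ 4) +
      (x₁ * x₂ * x₃ * y₄ + x₁ * x₂ * y₃ * x₄ + x₁ * y₂ * x₃ * x₄ + y₁ * x₂ * x₃ * x₄) * φ (a ^ 3 * b) +
      (x₁ * x₂ * x₃ * z₄ + x₁ * x₂ * z₃ * x₄ + x₁ * z₂ * x₃ * x₄ + z₁ * x₂ * x₃ * x₄) * φ (a ^ 3 * c) +
      (x₁ * x₂ * y₃ * y₄ + x₁ * y₂ * x₃ * y₄ + x₁ * y₂ * y₃ * x₄ + y₁ * x₂ * x₃ * y₄ +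
        y₁ * x₂ * y₃ * x₄ + y₁ * y₂ * x₃ * x₄) * φ (a ^ 2 * b ^ 2) +
      (x₁ * x₂ * y₃ * z₄ + x₁ * x₂ * z₃ * y₄ + x₁ * y₂ * x₃ * z₄ + x₁ * y₂ * z₃ * x₄ +
        x₁ * z₂ * x₃ * y₄ + x₁ * z₂ * y₃ * x₄ + y₁ * x₂ * x₃ * z₄ + y₁ * x₂ * z₃ * x₄ +
        y₁ * z₂ * x₃ * x₄ + z₁ * x₂ * x₃ * y₄ + z₁ * x₂ * y₃ * x₄ + z₁ * y₂ * x₃ * x₄) * φ (a ^ 2 * b * c) +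
      (x₁ * x₂ * z₃ * z₄ + x₁ * z₂ * x₃ * z₄ + x₁ * z₂ * z₃ * x₄ + z₁ * x₂ * x₃ * z₄ +
        z₁ * x₂ * z₃ * x₄ + z₁ * z₂ * x₃ * x₄) * φ (a ^ 2 * c ^ 2) +
      (x₁ * y₂ * y₃ * y₄ + y₁ * x₂ * y₃ * y₄ + y₁ * y₂ * x₃ * y₄ + y₁ * y₂ * y₃ * x₄) * φ (a * b ^ 3) +
      (x₁ * y₂ * y₃ * z₄ + x₁ * y₂ * z₃ * y₄ + x₁ * z₂ * y₃ * y₄ + y₁ * x₂ * y₃ * z₄ +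
        y₁ * x₂ * z₃ * y₄ + y₁ * y₂ * x₃ * z₄ + y₁ * y₂ * z₃ * x₄ + y₁ * z₂ * x₃ * y₄ +
        y₁ * z₂ * y₃ * x₄ + z₁ * x₂ * y₃ * y₄ + z₁ * y₂ * x₃ * y₄ + z₁ * y₂ * y₃ * x₄) * φ (a * b ^ 2 * c) +
      (x₁ * y₂ * z₃ * z₄ + x₁ * z₂ * y₃ * z₄ + x₁ * z₂ * z₃ * y₄ + y₁ * x₂ * z₃ * z₄ +
        y₁ * z₂ * x₃ * z₄ + y₁ * z₂ * z₃ * x₄ + z₁ * x₂ * y₃ * z₄ + z₁ * x₂ * z₃ * y₄ +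
        z₁ * y₂ * x₃ * z₄ + z₁ * y₂ * z₃ * x₄ + z₁ * z₂ * x₃ * y₄ + z₁ * z₂ * y₃ * x₄) * φ (a * b * c ^ 2) +
      (x₁ * z₂ * z₃ * z₄ + z₁ * x₂ * z₃ * z₄ + z₁ * z₂ * x₃ * z₄ + z₁ * z₂ * z₃ * x₄) * φ (a * c ^ 3) +
      (y₁ * y₂ * y₃ * y₄) * φ (b ^ 4) +
      (y₁ * y₂ * y₃ * z₄ + y₁ * y₂ * z₃ * y₄ + y₁ * z₂ * y₃ * y₄ + z₁ * y₂ * y₃ * y₄) * φ (b ^ 3 * c) +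
      (y₁ * y₂ * z₃ * z₄ + y₁ * z₂ * y₃ * z₄ + y₁ * z₂ * z₃ * y₄ + z₁ * y₂ * y₃ * z₄ +
        z₁ * y₂ * z₃ * y₄ + z₁ * z₂ * y₃ * y₄) * φ (b ^ 2 * c ^ 2) +
      (y₁ * z₂ * z₃ * z₄ + z₁ * y₂ * z₃ * z₄ + z₁ * z₂ * y₃ * z₄ + z₁ * z₂ * z₃ * y₄) * φ (b * c ^ 3) +
      (z₁ * z₂ * z₃ * z₄) * φ (c ^ 4) := by
  have h : ((x₁ • a + y₁ • b + z₁ • c) * (x₂ • a + y₂ • b + z₂ • c) *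
        (x₃ • a + y₃ • b + z₃ • c) * (x₄ • a + y₄ • b + z₄ • c)) =
      (x₁ * x₂ * x₃ * x₄) • (a ^ 4) +
      (x₁ * x₂ * x₃ * y₄ + x₁ * x₂ * y₃ * x₄ + x₁ * y₂ * x₃ * x₄ + y₁ * x₂ * x₃ * x₄) • (a ^ 3 * b) +
      (x₁ * x₂ * x₃ * z₄ + x₁ * x₂ * z₃ * x₄ + x₁ * z₂ * x₃ * x₄ + z₁ * x₂ * x₃ * x₄) • (a ^ 3 * c) +
      (x₁ * x₂ * y₃ * y₄ + x₁ * y₂ * x₃ * y₄ + x₁ * y₂ * y₃ * x₄ + y₁ * x₂ * x₃ * y₄ +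
        y₁ * x₂ * y₃ * x₄ + y₁ * y₂ * x₃ * x₄) • (a ^ 2 * b ^ 2) +
      (x₁ * x₂ * y₃ * z₄ + x₁ * x₂ * z₃ * y₄ + x₁ * y₂ * x₃ * z₄ + x₁ * y₂ * z₃ * x₄ +
        x₁ * z₂ * x₃ * y₄ + x₁ * z₂ * y₃ * x₄ + y₁ * x₂ * x₃ * z₄ + y₁ * x₂ * z₃ * x₄ +
        y₁ * z₂ * x₃ * x₄ + z₁ * x₂ * x₃ * y₄ + z₁ * x₂ * y₃ * x₄ + z₁ * y₂ * x₃ * x₄) • (a ^ 2 * b * c) +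
      (x₁ * x₂ * z₃ * z₄ + x₁ * z₂ * x₃ * z₄ + x₁ * z₂ * z₃ * x₄ + z₁ * x₂ * x₃ * z₄ +
        z₁ * x₂ * z₃ * x₄ + z₁ * z₂ * x₃ * x₄) • (a ^ 2 * c ^ 2) +
      (x₁ * y₂ * y₃ * y₄ + y₁ * x₂ * y₃ * y₄ + y₁ * y₂ * x₃ * y₄ + y₁ * y₂ * y₃ * x₄) • (a * b ^ 3) +
      (x₁ * y₂ * y₃ * z₄ + x₁ * y₂ * z₃ * y₄ + x₁ * z₂ * y₃ * y₄ + y₁ * x₂ * y₃ * z₄ +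
        y₁ * x₂ * z₃ * y₄ + y₁ * y₂ * x₃ * z₄ + y₁ * y₂ * z₃ * x₄ + y₁ * z₂ * x₃ * y₄ +
        y₁ * z₂ * y₃ * x₄ + z₁ * x₂ * y₃ * y₄ + z₁ * y₂ * x₃ * y₄ + z₁ * y₂ * y₃ * x₄) • (a * b ^ 2 * c) +
      (x₁ * y₂ * z₃ * z₄ + x₁ * z₂ * y₃ * z₄ + x₁ * z₂ * z₃ * y₄ + y₁ * x₂ * z₃ * z₄ +
        y₁ * z₂ * x₃ * z₄ + y₁ * z₂ * z₃ * x₄ + z₁ * x₂ * y₃ * z₄ + z₁ * x₂ * z₃ * y₄ +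
        z₁ * y₂ * x₃ * z₄ + z₁ * y₂ * z₃ * x₄ + z₁ * z₂ * x₃ * y₄ + z₁ * z₂ * y₃ * x₄) • (a * b * c ^ 2) +
      (x₁ * z₂ * z₃ * z₄ + z₁ * x₂ * z₃ * z₄ + z₁ * z₂ * x₃ * z₄ + z₁ * z₂ * z₃ * x₄) • (a * c ^ 3) +
      (y₁ * y₂ * y₃ * y₄) • (b ^ 4) +
      (y₁ * y₂ * y₃ * z₄ + y₁ * y₂ * z₃ * y₄ + y₁ * z₂ * y₃ * y₄ + z₁ * y₂ * y₃ * y₄) • (b ^ 3 * c) +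
      (y₁ * y₂ * z₃ * z₄ + y₁ * z₂ * y₃ * z₄ + y₁ * z₂ * z₃ * y₄ + z₁ * y₂ * y₃ * z₄ +
        z₁ * y₂ * z₃ * y₄ + z₁ * z₂ * y₃ * y₄) • (b ^ 2 * c ^ 2) +
      (y₁ * z₂ * z₃ * z₄ + z₁ * y₂ * z₃ * z₄ + z₁ * z₂ * y₃ * z₄ + z₁ * z₂ * z₃ * y₄) • (b * c ^ 3) +
      (z₁ * z₂ * z₃ * z₄) • (c ^ 4) := by
    simp only [Algebra.smul_def, map_add, map_mul]
    ring
  rw [h]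
  simp only [map_add, map_smul, smul_eq_mul]

/-- The fourth moments of `φ` along `a`, `b`, `c` are those of `x⁴ + y⁴ + z⁴`. -/
def IsQuartic₁ (φ : A →ₗ[k] k) (a b c : A) : Prop :=
  ∀ x₁ y₁ z₁ x₂ y₂ z₂ x₃ y₃ z₃ x₄ y₄ z₄ : k,
    φ ((x₁ • a + y₁ • b + z₁ • c) * (x₂ • a + y₂ • b + z₂ • c) *
        (x₃ • a + y₃ • b + z₃ • c) * (x₄ • a + y₄ • b + z₄ • c)) =
      24 * (x₁ * x₂ * x₃ * x₄ + y₁ * y₂ * y₃ * y₄ + z₁ * z₂ * z₃ * z₄)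

theorem IsQuartic₁.of_moments {φ : A →ₗ[k] k} {a b c : A}
    (h400 : φ (a ^ 4) = 24) (h310 : φ (a ^ 3 * b) = 0) (h301 : φ (a ^ 3 * c) = 0)
    (h220 : φ (a ^ 2 * b ^ 2) = 0) (h211 : φ (a ^ 2 * b * c) = 0) (h202 : φ (a ^ 2 * c ^ 2) = 0)
    (h130 : φ (a * b ^ 3) = 0) (h121 : φ (a * b ^ 2 * c) = 0) (h112 : φ (a * b * c ^ 2) = 0)
    (h103 : φ (a * c ^ 3) = 0) (h040 : φ (b ^ 4) = 24) (h031 : φ (b ^ 3 * c) = 0)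
    (h022 : φ (b ^ 2 * c ^ 2) = 0) (h013 : φ (b * c ^ 3) = 0) (h004 : φ (c ^ 4) = 24) :
    IsQuartic₁ φ a b c := by
  intro x₁ y₁ z₁ x₂ y₂ z₂ x₃ y₃ z₃ x₄ y₄ z₄
  rw [map_lin_mul_lin, h400, h310, h301, h220, h211, h202, h130, h121, h112, h103, h040, h031,
    h022, h013, h004]
  ring

/-- The fourth moments of `φ` along `a`, `b`, `c` are those of `x³y + z⁴`. -/
def IsQuartic₂ (φ : A →ₗ[k] k) (a b c : A) : Prop :=
  ∀ x₁ y₁ z₁ x₂ y₂ z₂ x₃ y₃ z₃ x₄ y₄ z₄ : k,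
    φ ((x₁ • a + y₁ • b + z₁ • c) * (x₂ • a + y₂ • b + z₂ • c) *
        (x₃ • a + y₃ • b + z₃ • c) * (x₄ • a + y₄ • b + z₄ • c)) =
      6 * (x₁ * x₂ * x₃ * y₄ + x₁ * x₂ * y₃ * x₄ + x₁ * y₂ * x₃ * x₄ + y₁ * x₂ * x₃ * x₄) +
      24 * (z₁ * z₂ * z₃ * z₄)

theorem IsQuartic₂.of_moments {φ : A →ₗ[k] k} {a b c : A}
    (h400 : φ (a ^ 4) = 0) (h310 : φ (a ^ 3 * b) = 6) (h301 : φ (a ^ 3 * c) = 0)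
    (h220 : φ (a ^ 2 * b ^ 2) = 0) (h211 : φ (a ^ 2 * b * c) = 0) (h202 : φ (a ^ 2 * c ^ 2) = 0)
    (h130 : φ (a * b ^ 3) = 0) (h121 : φ (a * b ^ 2 * c) = 0) (h112 : φ (a * b * c ^ 2) = 0)
    (h103 : φ (a * c ^ 3) = 0) (h040 : φ (b ^ 4) = 0) (h031 : φ (b ^ 3 * c) = 0)
    (h022 : φ (b ^ 2 * c ^ 2) = 0) (h013 : φ (b * c ^ 3) = 0) (h004 : φ (c ^ 4) = 24) :
    IsQuartic₂ φ a b c := by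
  intro x₁ y₁ z₁ x₂ y₂ z₂ x₃ y₃ z₃ x₄ y₄ z₄
  rw [map_lin_mul_lin, h400, h310, h301, h220, h211, h202, h130, h121, h112, h103, h040, h031,
    h022, h013, h004]
  ring

/-- The fourth moments of `φ` along `a`, `b`, `c` are those of `x³y + x²z²`. -/
def IsQuartic₃ (φ : A →ₗ[k] k) (a b c : A) : Prop :=
  ∀ x₁ y₁ z₁ x₂ y₂ z₂ x₃ y₃ z₃ x₄ y₄ z₄ : k,
    φ ((x₁ • a + y₁ • b + z₁ • c) * (x₂ • a + y₂ • b + z₂ • c) *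
        (x₃ • a + y₃ • b + z₃ • c) * (x₄ • a + y₄ • b + z₄ • c)) =
      6 * (x₁ * x₂ * x₃ * y₄ + x₁ * x₂ * y₃ * x₄ + x₁ * y₂ * x₃ * x₄ + y₁ * x₂ * x₃ * x₄) +
      4 * (x₁ * x₂ * z₃ * z₄ + x₁ * z₂ * x₃ * z₄ + x₁ * z₂ * z₃ * x₄ + z₁ * x₂ * x₃ * z₄ +
        z₁ * x₂ * z₃ * x₄ + z₁ * z₂ * x₃ * x₄)

theorem IsQuartic₃.of_moments {φ : A →ₗ[k] k} {a b c : A}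
    (h400 : φ (a ^ 4) = 0) (h310 : φ (a ^ 3 * b) = 6) (h301 : φ (a ^ 3 * c) = 0)
    (h220 : φ (a ^ 2 * b ^ 2) = 0) (h211 : φ (a ^ 2 * b * c) = 0) (h202 : φ (a ^ 2 * c ^ 2) = 4)
    (h130 : φ (a * b ^ 3) = 0) (h121 : φ (a * b ^ 2 * c) = 0) (h112 : φ (a * b * c ^ 2) = 0)
    (h103 : φ (a * c ^ 3) = 0) (h040 : φ (b ^ 4) = 0) (h031 : φ (b ^ 3 * c) = 0)
    (h022 : φ (b ^ 2 * c ^ 2) = 0) (h013 : φ (b * c ^ 3) = 0) (h004 : φ (c ^ 4) = 0) :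
    IsQuartic₃ φ a b c := by
  intro x₁ y₁ z₁ x₂ y₂ z₂ x₃ y₃ z₃ x₄ y₄ z₄
  rw [map_lin_mul_lin, h400, h310, h301, h220, h211, h202, h130, h121, h112, h103, h040, h031,
    h022, h013, h004]
  ring

/-- Elements of `m³` dual to `a`, `b`, `c` with respect to `φ`. -/
structure IsDualCubics (m : Ideal A) (a b c : A) (φ : A →ₗ[k] k) (α β γ : A) : Prop where
  mem_α : α ∈ m ^ 3
  mem_β : β ∈ m ^ 3
  mem_γ : γ ∈ m ^ 3
  aα : φ (a * α) = 1
  aβ : φ (a * β) = 0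
  aγ : φ (a * γ) = 0
  bα : φ (b * α) = 0
  bβ : φ (b * β) = 1
  bγ : φ (b * γ) = 0
  cα : φ (c * α) = 0
  cβ : φ (c * β) = 0
  cγ : φ (c * γ) = 1

/-- Every functional on `m / m²` is represented by an element of `m³`. -/
theorem IsDualCubics.exists_cubic {m : Ideal A} {a b c α β γ : A} {φ : A →ₗ[k] k}
    (hd : IsDualCubics m a b c φ α β γ) (s t u : k) : ∃ r ∈ m ^ 3, φ (a * r) = s ∧ φ (b * r) = t ∧ φ (c * r) = u := by
  refine ⟨s • α + t • β + u • γ, lin_mem hd.mem_α hd.mem_β hd.mem_γ s t u, ?_, ?_, ?_⟩ <;>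
  simp [mul_add, hd.aα, hd.aβ, hd.aγ, hd.bα, hd.bβ, hd.bγ, hd.cα, hd.cβ, hd.cγ]

namespace IsFrame

variable {m : Ideal A} {a b c : A}

/-- Exchanging one factor at a time costs an element of `m² · m · m · m = m⁵ = 0`. This is why the
fourth moments depend only on classes modulo `m²`. -/
theorem mul_four_congr (h : IsFrame k m a b c) {x₁ x₂ x₃ x₄ y₁ y₂ y₃ y₄ : A} (hx₁ : x₁ ∈ m)
    (hx₂ : x₂ ∈ m) (hx₃ : x₃ ∈ m) (hy₂ : y₂ ∈ m) (hy₃ : y₃ ∈ m) (hy₄ : y₄ ∈ m)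
    (h₁ : x₁ - y₁ ∈ m ^ 2) (h₂ : x₂ - y₂ ∈ m ^ 2) (h₃ : x₃ - y₃ ∈ m ^ 2) (h₄ : x₄ - y₄ ∈ m ^ 2) :
    x₁ * x₂ * x₃ * x₄ = y₁ * y₂ * y₃ * y₄ := by
  have e₁ : (x₁ - y₁) * y₂ * y₃ * y₄ = 0 := h.eq_zero_of_mem le_rfl
    (mul_mem_pow_succ (mul_mem_pow_succ (mul_mem_pow_succ h₁ hy₂) hy₃) hy₄)
  have e₂ : (x₂ - y₂) * x₁ * y₃ * y₄ = 0 := h.eq_zero_of_mem le_rfl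
    (mul_mem_pow_succ (mul_mem_pow_succ (mul_mem_pow_succ h₂ hx₁) hy₃) hy₄)
  have e₃ : (x₃ - y₃) * x₁ * x₂ * y₄ = 0 := h.eq_zero_of_mem le_rfl
    (mul_mem_pow_succ (mul_mem_pow_succ (mul_mem_pow_succ h₃ hx₁) hx₂) hy₄)
  have e₄ : (x₄ - y₄) * x₁ * x₂ * x₃ = 0 := h.eq_zero_of_mem le_rfl
    (mul_mem_pow_succ (mul_mem_pow_succ (mul_mem_pow_succ h₄ hx₁) hx₂) hx₃)
  linear_combination e₁ + e₂ + e₃ + e₄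

theorem functional_eq_zero_of_sq (h : IsFrame k m a b c) {ψ : A →ₗ[k] k}
    (h3 : ∀ w ∈ m ^ 3, ψ w = 0) (haa : ψ (a * a) = 0) (hab : ψ (a * b) = 0) (hac : ψ (a * c) = 0)
    (hbb : ψ (b * b) = 0) (hbc : ψ (b * c) = 0) (hcc : ψ (c * c) = 0) :
    ∀ w ∈ m ^ 2, ψ w = 0 := by
  intro w hw
  rw [pow_two] at hw
  refine Submodule.mul_induction_on hw (fun u hu v hv => ?_) (fun u v hu hv => ?_)
  · obtain ⟨x₁, y₁, z₁, h₁⟩ := h.span u hu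
    obtain ⟨x₂, y₂, z₂, h₂⟩ := h.span v hv
    have hl := lin_mem (k := k) h.mem_a h.mem_b h.mem_c x₁ y₁ z₁
    have e₁ := h3 _ (mul_mem_pow_succ h₁ hv)
    have e₂ := h3 _ (mul_mem_pow_succ h₂ hl)
    have e : u * v = (u - (x₁ • a + y₁ • b + z₁ • c)) * v +
        (v - (x₂ • a + y₂ • b + z₂ • c)) * (x₁ • a + y₁ • b + z₁ • c) +
        ((x₁ * x₂) • (a * a) + (x₁ * y₂ + y₁ * x₂) • (a * b) + (x₁ * z₂ + z₁ * x₂) • (a * c) +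
        (y₁ * y₂) • (b * b) + (y₁ * z₂ + z₁ * y₂) • (b * c) + (z₁ * z₂) • (c * c)) := by
      simp only [Algebra.smul_def, map_add, map_mul]
      ring
    rw [e, map_add, map_add, e₁, e₂]
    simp [haa, hab, hac, hbb, hbc, hcc]
  · rw [map_add, hu, hv, add_zero]

end IsFrame

namespace IsDualFrame

variable {m : Ideal A} {a b c α β γ : A} {φ : A →ₗ[k] k}

theorem map_mul_eq_zero (h : IsDualFrame m a b c φ) {i j : ℕ} (hi : 5 ≤ i + j) {x y : A}
    (hx : x ∈ m ^ i) (hy : y ∈ m ^ j) : φ (x * y) = 0 := by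
  rw [h.mul_eq_zero hi hx hy, map_zero]

theorem eq_zero_of_mul_maximal (h : IsDualFrame m a b c φ) {x : A} (hx : ∀ y ∈ m, x * y = 0)
    (h0 : φ x = 0) : x = 0 := by
  refine h.nondeg x fun y => ?_
  obtain ⟨s, hs⟩ := h.residue y
  have e : x * y = x * (y - algebraMap k A s) + s • x := by
    rw [Algebra.smul_def]; ring
  rw [e, hx _ hs, zero_add, map_smul, h0, smul_zero]

theorem mul_eq_zero_of_functional (h : IsDualFrame m a b c φ) {x : A}
    (hx : ∀ y ∈ m, φ (x * y) = 0) : ∀ y ∈ m, x * y = 0 := fun y hy =>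
  h.nondeg _ fun w => by rw [mul_assoc]; exact hx _ (m.mul_mem_right _ hy)

/-- The element `aα` lies in `m⁴`, hence in the socle, and `φ(aα) = 1`. As `A = k + m`, a socle
element killed by `φ` is orthogonal to everything, so `φ` is injective on the socle. -/
theorem eq_smul_of_socle (h : IsDualFrame m a b c φ) (hd : IsDualCubics m a b c φ α β γ) {x : A}
    (hx : ∀ y ∈ m, x * y = 0) : x = φ x • (a * α) := by
  have h4 : a * α ∈ m ^ 4 := by
    rw [mul_comm]; exact mul_mem_pow_succ hd.mem_α h.mem_a
  refine sub_eq_zero.1 (h.eq_zero_of_mul_maximal (fun y hy => ?_) ?_)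
  · rw [sub_mul, hx y hy, smul_mul_assoc, h.eq_zero_of_mem le_rfl (mul_mem_pow_succ h4 hy),
      smul_zero, sub_zero]
  · rw [map_sub, map_smul, hd.aα, smul_eq_mul, mul_one, sub_self]

theorem mem_pow_four_of_socle (h : IsDualFrame m a b c φ) (hd : IsDualCubics m a b c φ α β γ)
    {x : A} (hx : ∀ y ∈ m, x * y = 0) : x ∈ m ^ 4 := by
  rw [h.eq_smul_of_socle hd hx, mul_comm]
  exact smul_mem_ideal _ (mul_mem_pow_succ hd.mem_α h.mem_a)

theorem map_mul_mem (h : IsDualFrame m a b c φ) {x : A} (h2 : ∀ w ∈ m ^ 2, φ (x * w) = 0)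
    (ha : φ (x * a) = 0) (hb : φ (x * b) = 0) (hc : φ (x * c) = 0) :
    ∀ y ∈ m, φ (x * y) = 0 := by
  intro y hy
  obtain ⟨s, t, u, hs⟩ := h.span y hy
  have e : x * y = x * (y - (s • a + t • b + u • c)) + (s • (x * a) + t • (x * b) +
      u • (x * c)) := by
    simp only [Algebra.smul_def]; ring
  rw [e, map_add, h2 _ hs]
  simp [ha, hb, hc]

/-- Subtract the `r ∈ m³` having the same pairings with `a, b, c` as `q`. The difference is
orthogonal to all of `m`, so it is a socle element and lies in `m⁴`. -/
theorem mem_cube (h : IsDualFrame m a b c φ) (hd : IsDualCubics m a b c φ α β γ) {q : A}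
    (hq : ∀ w ∈ m ^ 2, φ (q * w) = 0) : q ∈ m ^ 3 := by
  obtain ⟨r, hr, ha, hb, hc⟩ := hd.exists_cubic (φ (q * a)) (φ (q * b)) (φ (q * c))
  have h4 : q - r ∈ m ^ 4 := by
    refine h.mem_pow_four_of_socle hd (h.mul_eq_zero_of_functional (h.map_mul_mem ?_ ?_ ?_ ?_))
    · intro w hw
      rw [sub_mul, map_sub, hq w hw, h.map_mul_eq_zero (i := 3) (j := 2) le_rfl hr hw, sub_zero]
    · rw [sub_mul, map_sub, mul_comm r, ha, sub_self]
    · rw [sub_mul, map_sub, mul_comm r, hb, sub_self]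
    · rw [sub_mul, map_sub, mul_comm r, hc, sub_self]
  have := Ideal.add_mem _ (Ideal.pow_le_pow_right (by norm_num : 3 ≤ 4) h4) hr
  rwa [sub_add_cancel] at this

/-- An element of `m²` that is orthogonal to all products of two linear combinations of
`a`, `b`, `c` lies in `m³`. -/
theorem mem_cube_of_lin (h : IsDualFrame m a b c φ) (hd : IsDualCubics m a b c φ α β γ)
    {q : A} (hq : q ∈ m ^ 2) (H : ∀ x₁ y₁ z₁ x₂ y₂ z₂ : k,
      φ (q * (x₁ • a + y₁ • b + z₁ • c) * (x₂ • a + y₂ • b + z₂ • c)) = 0) : q ∈ m ^ 3 := by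
  refine h.mem_cube hd (h.functional_eq_zero_of_sq (ψ := φ ∘ₗ LinearMap.mulLeft k q)
    (fun _ hw => h.map_mul_eq_zero (i := 2) (j := 3) le_rfl hq hw) ?_ ?_ ?_ ?_ ?_ ?_)
  · simpa [mul_assoc] using H 1 0 0 1 0 0
  · simpa [mul_assoc] using H 1 0 0 0 1 0
  · simpa [mul_assoc] using H 1 0 0 0 0 1
  · simpa [mul_assoc] using H 0 1 0 0 1 0
  · simpa [mul_assoc] using H 0 1 0 0 0 1
  · simpa [mul_assoc] using H 0 0 1 0 0 1

end IsDualFrame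

end Quartics

/-! ### Dual cubics and apolar quadrics of the three quartics -/

section QuarticFrames

variable {k A : Type*} [Field k] [CommRing A] [Algebra k A]

theorem mul_mem_cube {m : Ideal A} {x y z : A} (hx : x ∈ m) (hy : y ∈ m) (hz : z ∈ m) :
    x * y * z ∈ m ^ 3 :=
  mul_mem_pow_succ (mul_mem_sq hx hy) hz

theorem six_ne_zero_of {k : Type*} [Field k] (h2 : (2 : k) ≠ 0) (h3 : (3 : k) ≠ 0) :
    (6 : k) ≠ 0 := by
  rw [show (6 : k) = 2 * 3 by norm_num]; exact mul_ne_zero h2 h3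

theorem four_ne_zero_of {k : Type*} [Field k] (h2 : (2 : k) ≠ 0) : (4 : k) ≠ 0 := by
  rw [show (4 : k) = 2 * 2 by norm_num]; exact mul_ne_zero h2 h2

theorem twentyFour_ne_zero_of {k : Type*} [Field k] (h2 : (2 : k) ≠ 0) (h3 : (3 : k) ≠ 0) :
    (24 : k) ≠ 0 := by
  rw [show (24 : k) = 4 * 6 by norm_num]
  exact mul_ne_zero (four_ne_zero_of h2) (six_ne_zero_of h2 h3)

namespace IsDualFrame

variable {m : Ideal A} {a b c : A} {φ : A →ₗ[k] k}

theorem dualCubics₁ (h : IsDualFrame m a b c φ) (H : IsQuartic₁ φ a b c) (h2 : (2 : k) ≠ 0)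
    (h3 : (3 : k) ≠ 0) : IsDualCubics m a b c φ ((24 : k)⁻¹ • (a * a * a))
      ((24 : k)⁻¹ • (b * b * b)) ((24 : k)⁻¹ • (c * c * c)) := by
  have h6 := six_ne_zero_of h2 h3
  have h4 := four_ne_zero_of h2
  have h24 := twentyFour_ne_zero_of h2 h3
  constructor
  · exact smul_mem_ideal _ (mul_mem_cube h.mem_a h.mem_a h.mem_a)
  · exact smul_mem_ideal _ (mul_mem_cube h.mem_b h.mem_b h.mem_b)
  · exact smul_mem_ideal _ (mul_mem_cube h.mem_c h.mem_c h.mem_c)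
  · simpa [mul_assoc, h6, h4, h24] using H 1 0 0 24⁻¹ 0 0 1 0 0 1 0 0
  · simpa [mul_assoc, h6, h4, h24] using H 1 0 0 0 24⁻¹ 0 0 1 0 0 1 0
  · simpa [mul_assoc, h6, h4, h24] using H 1 0 0 0 0 24⁻¹ 0 0 1 0 0 1
  · simpa [mul_assoc, h6, h4, h24] using H 0 1 0 24⁻¹ 0 0 1 0 0 1 0 0
  · simpa [mul_assoc, h6, h4, h24] using H 0 1 0 0 24⁻¹ 0 0 1 0 0 1 0
  · simpa [mul_assoc, h6, h4, h24] using H 0 1 0 0 0 24⁻¹ 0 0 1 0 0 1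
  · simpa [mul_assoc, h6, h4, h24] using H 0 0 1 24⁻¹ 0 0 1 0 0 1 0 0
  · simpa [mul_assoc, h6, h4, h24] using H 0 0 1 0 24⁻¹ 0 0 1 0 0 1 0
  · simpa [mul_assoc, h6, h4, h24] using H 0 0 1 0 0 24⁻¹ 0 0 1 0 0 1

theorem mul_ab_mem_cube₁ (h : IsDualFrame m a b c φ) (H : IsQuartic₁ φ a b c)
    (h2 : (2 : k) ≠ 0) (h3 : (3 : k) ≠ 0) : a * b ∈ m ^ 3 :=
  h.mem_cube_of_lin (h.dualCubics₁ H h2 h3) (mul_mem_sq h.mem_a h.mem_b)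
    fun x₁ y₁ z₁ x₂ y₂ z₂ => by simpa using H 1 0 0 0 1 0 x₁ y₁ z₁ x₂ y₂ z₂

theorem mul_ac_mem_cube₁ (h : IsDualFrame m a b c φ) (H : IsQuartic₁ φ a b c)
    (h2 : (2 : k) ≠ 0) (h3 : (3 : k) ≠ 0) : a * c ∈ m ^ 3 :=
  h.mem_cube_of_lin (h.dualCubics₁ H h2 h3) (mul_mem_sq h.mem_a h.mem_c)
    fun x₁ y₁ z₁ x₂ y₂ z₂ => by simpa using H 1 0 0 0 0 1 x₁ y₁ z₁ x₂ y₂ z₂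

theorem mul_bc_mem_cube₁ (h : IsDualFrame m a b c φ) (H : IsQuartic₁ φ a b c)
    (h2 : (2 : k) ≠ 0) (h3 : (3 : k) ≠ 0) : b * c ∈ m ^ 3 :=
  h.mem_cube_of_lin (h.dualCubics₁ H h2 h3) (mul_mem_sq h.mem_b h.mem_c)
    fun x₁ y₁ z₁ x₂ y₂ z₂ => by simpa using H 0 1 0 0 0 1 x₁ y₁ z₁ x₂ y₂ z₂

/-- The duals are crossed: differentiating `x³y` pairs `a` with `a²b` and `b` with `a³`, both with
value 6. The summand `z⁴` pairs `c` with `c³`, with value 24. -/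
theorem dualCubics₂ (h : IsDualFrame m a b c φ) (H : IsQuartic₂ φ a b c) (h2 : (2 : k) ≠ 0)
    (h3 : (3 : k) ≠ 0) : IsDualCubics m a b c φ ((6 : k)⁻¹ • (a * a * b))
      ((6 : k)⁻¹ • (a * a * a)) ((24 : k)⁻¹ • (c * c * c)) := by
  have h6 := six_ne_zero_of h2 h3
  have h4 := four_ne_zero_of h2
  have h24 := twentyFour_ne_zero_of h2 h3
  constructor
  · exact smul_mem_ideal _ (mul_mem_cube h.mem_a h.mem_a h.mem_b)
  · exact smul_mem_ideal _ (mul_mem_cube h.mem_a h.mem_a h.mem_a)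
  · exact smul_mem_ideal _ (mul_mem_cube h.mem_c h.mem_c h.mem_c)
  · simpa [mul_assoc, h6, h4, h24] using H 1 0 0 6⁻¹ 0 0 1 0 0 0 1 0
  · simpa [mul_assoc, h6, h4, h24] using H 1 0 0 6⁻¹ 0 0 1 0 0 1 0 0
  · simpa [mul_assoc, h6, h4, h24] using H 1 0 0 0 0 24⁻¹ 0 0 1 0 0 1
  · simpa [mul_assoc, h6, h4, h24] using H 0 1 0 6⁻¹ 0 0 1 0 0 0 1 0
  · simpa [mul_assoc, h6, h4, h24] using H 0 1 0 6⁻¹ 0 0 1 0 0 1 0 0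
  · simpa [mul_assoc, h6, h4, h24] using H 0 1 0 0 0 24⁻¹ 0 0 1 0 0 1
  · simpa [mul_assoc, h6, h4, h24] using H 0 0 1 6⁻¹ 0 0 1 0 0 0 1 0
  · simpa [mul_assoc, h6, h4, h24] using H 0 0 1 6⁻¹ 0 0 1 0 0 1 0 0
  · simpa [mul_assoc, h6, h4, h24] using H 0 0 1 0 0 24⁻¹ 0 0 1 0 0 1

theorem mul_bb_mem_cube₂ (h : IsDualFrame m a b c φ) (H : IsQuartic₂ φ a b c)
    (h2 : (2 : k) ≠ 0) (h3 : (3 : k) ≠ 0) : b * b ∈ m ^ 3 :=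
  h.mem_cube_of_lin (h.dualCubics₂ H h2 h3) (mul_mem_sq h.mem_b h.mem_b)
    fun x₁ y₁ z₁ x₂ y₂ z₂ => by simpa using H 0 1 0 0 1 0 x₁ y₁ z₁ x₂ y₂ z₂

theorem mul_ac_mem_cube₂ (h : IsDualFrame m a b c φ) (H : IsQuartic₂ φ a b c)
    (h2 : (2 : k) ≠ 0) (h3 : (3 : k) ≠ 0) : a * c ∈ m ^ 3 :=
  h.mem_cube_of_lin (h.dualCubics₂ H h2 h3) (mul_mem_sq h.mem_a h.mem_c)
    fun x₁ y₁ z₁ x₂ y₂ z₂ => by simpa using H 1 0 0 0 0 1 x₁ y₁ z₁ x₂ y₂ z₂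

theorem mul_bc_mem_cube₂ (h : IsDualFrame m a b c φ) (H : IsQuartic₂ φ a b c)
    (h2 : (2 : k) ≠ 0) (h3 : (3 : k) ≠ 0) : b * c ∈ m ^ 3 :=
  h.mem_cube_of_lin (h.dualCubics₂ H h2 h3) (mul_mem_sq h.mem_b h.mem_c)
    fun x₁ y₁ z₁ x₂ y₂ z₂ => by simpa using H 0 1 0 0 0 1 x₁ y₁ z₁ x₂ y₂ z₂

theorem dualCubics₃ (h : IsDualFrame m a b c φ) (H : IsQuartic₃ φ a b c) (h2 : (2 : k) ≠ 0)
    (h3 : (3 : k) ≠ 0) : IsDualCubics m a b c φ ((6 : k)⁻¹ • (a * a * b))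
      ((6 : k)⁻¹ • (a * a * a)) ((4 : k)⁻¹ • (a * a * c)) := by
  have h6 := six_ne_zero_of h2 h3
  have h4 := four_ne_zero_of h2
  have h24 := twentyFour_ne_zero_of h2 h3
  constructor
  · exact smul_mem_ideal _ (mul_mem_cube h.mem_a h.mem_a h.mem_b)
  · exact smul_mem_ideal _ (mul_mem_cube h.mem_a h.mem_a h.mem_a)
  · exact smul_mem_ideal _ (mul_mem_cube h.mem_a h.mem_a h.mem_c)
  · simpa [mul_assoc, h6, h4, h24] using H 1 0 0 6⁻¹ 0 0 1 0 0 0 1 0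
  · simpa [mul_assoc, h6, h4, h24] using H 1 0 0 6⁻¹ 0 0 1 0 0 1 0 0
  · simpa [mul_assoc, h6, h4, h24] using H 1 0 0 4⁻¹ 0 0 1 0 0 0 0 1
  · simpa [mul_assoc, h6, h4, h24] using H 0 1 0 6⁻¹ 0 0 1 0 0 0 1 0
  · simpa [mul_assoc, h6, h4, h24] using H 0 1 0 6⁻¹ 0 0 1 0 0 1 0 0
  · simpa [mul_assoc, h6, h4, h24] using H 0 1 0 4⁻¹ 0 0 1 0 0 0 0 1
  · simpa [mul_assoc, h6, h4, h24] using H 0 0 1 6⁻¹ 0 0 1 0 0 0 1 0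
  · simpa [mul_assoc, h6, h4, h24] using H 0 0 1 6⁻¹ 0 0 1 0 0 1 0 0
  · simpa [mul_assoc, h6, h4, h24] using H 0 0 1 4⁻¹ 0 0 1 0 0 0 0 1

theorem mul_bb_mem_cube₃ (h : IsDualFrame m a b c φ) (H : IsQuartic₃ φ a b c)
    (h2 : (2 : k) ≠ 0) (h3 : (3 : k) ≠ 0) : b * b ∈ m ^ 3 :=
  h.mem_cube_of_lin (h.dualCubics₃ H h2 h3) (mul_mem_sq h.mem_b h.mem_b)
    fun x₁ y₁ z₁ x₂ y₂ z₂ => by simpa using H 0 1 0 0 1 0 x₁ y₁ z₁ x₂ y₂ z₂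

theorem mul_bc_mem_cube₃ (h : IsDualFrame m a b c φ) (H : IsQuartic₃ φ a b c)
    (h2 : (2 : k) ≠ 0) (h3 : (3 : k) ≠ 0) : b * c ∈ m ^ 3 :=
  h.mem_cube_of_lin (h.dualCubics₃ H h2 h3) (mul_mem_sq h.mem_b h.mem_c)
    fun x₁ y₁ z₁ x₂ y₂ z₂ => by simpa using H 0 1 0 0 0 1 x₁ y₁ z₁ x₂ y₂ z₂

/-- Paired with `a²`, the quadric `c²` gives 4 through `x²z²` and `ab` gives 6 through `x³y`; the
weights 3 and 2 balance them. This is the third apolar quadric, besides `y²` and `yz`. -/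
theorem sub_mem_cube₃ (h : IsDualFrame m a b c φ) (H : IsQuartic₃ φ a b c)
    (h2 : (2 : k) ≠ 0) (h3 : (3 : k) ≠ 0) : (3 : k) • (c * c) - (2 : k) • (a * b) ∈ m ^ 3 := by
  refine h.mem_cube_of_lin (h.dualCubics₃ H h2 h3) (Ideal.sub_mem _
    (smul_mem_ideal _ (mul_mem_sq h.mem_c h.mem_c)) (smul_mem_ideal _ (mul_mem_sq h.mem_a h.mem_b)))
    fun x₁ y₁ z₁ x₂ y₂ z₂ => ?_
  have e₁ := H 0 0 1 0 0 1 x₁ y₁ z₁ x₂ y₂ z₂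
  have e₂ := H 1 0 0 0 1 0 x₁ y₁ z₁ x₂ y₂ z₂
  simp only [zero_smul, one_smul, zero_add, add_zero] at e₁ e₂
  rw [sub_mul, sub_mul, map_sub]
  simp only [smul_mul_assoc]
  rw [map_smul, map_smul, e₁, e₂]
  simp only [smul_eq_mul]
  ring

end IsDualFrame

end QuarticFrames

/-! ### Gorenstein property and Hilbert function from a dual frame -/

section Hilbert

open IsLocalRing

variable {k A : Type*} [Field k] [CommRing A] [Algebra k A]

/-- The functionals induce an isomorphism of `I / J` with `k ^ d`: the dual vectors give
surjectivity, and the common kernel on `I` is `J`. -/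
theorem finrank_submoduleOf_quotient (I J : Ideal A) {d : ℕ} (ψ : Fin d → A →ₗ[k] k)
    (hs : ∀ i, ∃ x ∈ I, ∀ j, ψ j x = if i = j then 1 else 0)
    (hk : ∀ x ∈ I, x ∈ J ↔ ∀ j, ψ j x = 0) :
    Module.finrank k (↥I ⧸ J.submoduleOf I) = d := by
  let g : ↥I →ₗ[k] (Fin d → k) :=
    LinearMap.pi fun j => ψ j ∘ₗ (Submodule.subtype I).restrictScalars k
  have hg : Function.Surjective g := by
    choose x hx hxj using hs
    intro w
    refine ⟨∑ i, w i • ⟨x i, hx i⟩, ?_⟩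
    ext j
    rw [map_sum, Finset.sum_apply]
    simp only [map_smul, Pi.smul_apply, smul_eq_mul]
    have : ∀ i, g ⟨x i, hx i⟩ j = if i = j then 1 else 0 := fun i => hxj i j
    simp [this]
  have hker : (J.submoduleOf I).restrictScalars k = LinearMap.ker g := by
    ext x
    have h1 : x ∈ (J.submoduleOf I).restrictScalars k ↔ (x : A) ∈ J := Iff.rfl
    have h2 : g x = 0 ↔ ∀ j, ψ j (x : A) = 0 := funext_iff
    rw [LinearMap.mem_ker, h1, h2, hk x x.2]
  rw [← LinearEquiv.finrank_eq (Submodule.Quotient.restrictScalarsEquiv k (J.submoduleOf I)),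
    LinearEquiv.finrank_eq ((Submodule.quotEquivOfEq _ _ hker).trans
      (g.quotKerEquivOfSurjective hg)), Module.finrank_fin_fun]

theorem localHilbert_eq_of_functionals [IsLocalRing A] {n d : ℕ} (ψ : Fin d → A →ₗ[k] k)
    (hs : ∀ i, ∃ x ∈ maximalIdeal A ^ n, ∀ j, ψ j x = if i = j then 1 else 0)
    (hk : ∀ x ∈ maximalIdeal A ^ n, x ∈ maximalIdeal A ^ (n + 1) ↔ ∀ j, ψ j x = 0) :
    localHilbert k A n = d :=
  finrank_submoduleOf_quotient _ _ ψ hs hk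

namespace IsDualFrame

variable {m : Ideal A} {a b c α β γ : A} {φ : A →ₗ[k] k}

/-- Monomials with an exponent at least five vanish, so `x` is determined by its pairings with 125
monomials. -/
theorem finite (h : IsDualFrame m a b c φ) : Module.Finite k A := by
  have h5 : ∀ x ∈ m, ∀ n, 5 ≤ n → x ^ n = 0 := fun x hx n hn =>
    h.eq_zero_of_mem hn (Ideal.pow_mem_pow hx n)
  let g : A →ₗ[k] (Fin 5 × Fin 5 × Fin 5 → k) :=
    LinearMap.pi fun t => φ ∘ₗ LinearMap.mulRight k (a ^ (t.1 : ℕ) * b ^ (t.2.1 : ℕ) *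
      c ^ (t.2.2 : ℕ))
  refine Module.Finite.of_injective g (LinearMap.ker_eq_bot.1 (LinearMap.ker_eq_bot'.2 ?_))
  intro x hx
  have hx' : ∀ i j l : ℕ, φ (x * (a ^ i * b ^ j * c ^ l)) = 0 := by
    intro i j l
    by_cases hi : i < 5
    · by_cases hj : j < 5
      · by_cases hl : l < 5
        · exact congrFun hx (⟨i, hi⟩, ⟨j, hj⟩, ⟨l, hl⟩)
        · rw [h5 c h.mem_c l (not_lt.1 hl)]; simp
      · rw [h5 b h.mem_b j (not_lt.1 hj)]; simp
    · rw [h5 a h.mem_a i (not_lt.1 hi)]; simp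
  refine h.nondeg x fun y => ?_
  obtain ⟨p, rfl⟩ := h.aeval_surjective y
  have : φ ∘ₗ LinearMap.mulLeft k x ∘ₗ (MvPolynomial.aeval (R := k) ![a, b, c]).toLinearMap = 0 := by
    refine MvPolynomial.linearMap_ext fun d => LinearMap.ext_ring ?_
    simpa [MvPolynomial.aeval_monomial, Finsupp.prod_fintype, Fin.prod_univ_three] using
      hx' (d 0) (d 1) (d 2)
  exact congrArg (fun ψ => ψ p) this

theorem socle_simple [IsLocalRing A] (h : IsDualFrame (maximalIdeal A) a b c φ)
    (hd : IsDualCubics (maximalIdeal A) a b c φ α β γ) : IsSimpleModule A (localSocle A) := by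
  have hmem : ∀ x, x ∈ localSocle A ↔ ∀ y ∈ maximalIdeal A, x * y = 0 := fun x =>
    Submodule.mem_annihilator
  have hs : a * α ∈ localSocle A := by
    refine (hmem _).2 fun y hy => h.eq_zero_of_mem le_rfl (mul_mem_pow_succ (i := 4) ?_ hy)
    rw [mul_comm]; exact mul_mem_pow_succ hd.mem_α h.mem_a
  rw [isSimpleModule_iff_toSpanSingleton_surjective]
  refine ⟨⟨⟨a * α, hs⟩, 0, fun e => ?_⟩, ?_⟩
  · have := congrArg (fun x : localSocle A => φ x) e
    simp [hd.aα] at this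
  · rintro ⟨x, hx⟩ hx0 ⟨y, hy⟩
    have ex := h.eq_smul_of_socle hd ((hmem x).1 hx)
    have ey := h.eq_smul_of_socle hd ((hmem y).1 hy)
    have hφ : φ x ≠ 0 := fun h0 => hx0 (Subtype.ext (by
      change x = 0; rw [ex, h0, zero_smul]))
    refine ⟨algebraMap k A (φ y / φ x), Subtype.ext ?_⟩
    change algebraMap k A (φ y / φ x) * x = y
    rw [← Algebra.smul_def]
    calc (φ y / φ x) • x = (φ y / φ x) • φ x • (a * α) := congrArg _ ex
      _ = y := by rw [smul_smul, div_mul_cancel₀ _ hφ, ← ey]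

/-- A local algebra with a dual frame is Gorenstein with Hilbert function `(1, 3, 3, 3, 1)` as soon
as the forms induced by `φ` on `m / m² × m³ / m⁴` and `m² / m³ × m² / m³` are perfect of rank
three. -/
theorem isGorenstein13331 [IsLocalRing A] (h : IsDualFrame (maximalIdeal A) a b c φ)
    (hd : IsDualCubics (maximalIdeal A) a b c φ α β γ) (p p' : Fin 3 → A)
    (hp : ∀ i, p i ∈ maximalIdeal A ^ 2) (hp' : ∀ i, p' i ∈ maximalIdeal A ^ 2)
    (hpp : ∀ i j, φ (p i * p' j) = if i = j then 1 else 0)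
    (hQ : ∀ x ∈ maximalIdeal A ^ 2, (∀ j, φ (x * p' j) = 0) → x ∈ maximalIdeal A ^ 3) :
    IsGorenstein13331 k A := by
  have hfin := h.finite
  have h4 : a * α ∈ maximalIdeal A ^ 4 := by
    rw [mul_comm]; exact mul_mem_pow_succ hd.mem_α h.mem_a
  refine ⟨inferInstance, ⟨IsArtinianRing.of_finite k A, h.socle_simple hd⟩, fun i => ?_⟩
  -- For `i ≤ 4` the functionals on the layer `mⁱ/mⁱ⁺¹` are `φ(· y)` with `y` in `m ^ (4 - i)`: the
  -- layers of degrees `i` and `4 - i` are dual. For `i ≥ 5` the power itself is zero.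
  rcases i with _ | _ | _ | _ | _ | i
  · refine localHilbert_eq_of_functionals (d := 1)
      (fun _ => φ ∘ₗ LinearMap.mulRight k (a * α)) (fun i => ⟨1, by simp, fun j => ?_⟩)
      fun x _ => ⟨fun hx j => ?_, fun hx => ?_⟩
    · simp [Subsingleton.elim i j, hd.aα]
    · exact h.map_mul_eq_zero (i := 1) (j := 4) le_rfl hx h4
    · obtain ⟨s, hs⟩ := h.residue x
      have e : x * (a * α) = (x - algebraMap k A s) * (a * α) + s • (a * α) := by
        rw [Algebra.smul_def]; ring
      have h0 := hx 0
      simp only [LinearMap.comp_apply, LinearMap.mulRight_apply] at h0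
      rw [e, map_add, h.map_mul_eq_zero (i := 1) (j := 4) le_rfl (by simpa using hs) h4,
        map_smul, hd.aα] at h0
      have : s = 0 := by simpa using h0
      simpa [this] using hs
  · refine localHilbert_eq_of_functionals (d := 3)
      (fun j => φ ∘ₗ LinearMap.mulRight k (![α, β, γ] j)) (fun i => ⟨![a, b, c] i, ?_, fun j => ?_⟩)
      fun x hx => ⟨fun hx j => ?_, fun h0 => ?_⟩
    · fin_cases i <;> simpa using by first | exact h.mem_a | exact h.mem_b | exact h.mem_c
    · fin_cases i <;> fin_cases j <;>
        simp [hd.aα, hd.aβ, hd.aγ, hd.bα, hd.bβ, hd.bγ, hd.cα, hd.cβ, hd.cγ]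
    · refine h.map_mul_eq_zero (i := 2) (j := 3) le_rfl hx ?_
      fin_cases j
      exacts [hd.mem_α, hd.mem_β, hd.mem_γ]
    · rw [zero_add, pow_one] at hx
      obtain ⟨s, t, u, hs⟩ := h.span x hx
      have key : ∀ y ∈ maximalIdeal A ^ 3, φ (x * y) = s * φ (a * y) + t * φ (b * y) +
          u * φ (c * y) := by
        intro y hy
        have e : x * y = (x - (s • a + t • b + u • c)) * y + (s • (a * y) + t • (b * y) +
            u • (c * y)) := by
          simp only [Algebra.smul_def]; ring
        rw [e, map_add, h.map_mul_eq_zero (i := 2) (j := 3) le_rfl hs hy]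
        simp
      have k0 := key α hd.mem_α
      have k1 := key β hd.mem_β
      have k2 := key γ hd.mem_γ
      rw [show φ (x * α) = 0 from h0 0, hd.aα, hd.bα, hd.cα] at k0
      rw [show φ (x * β) = 0 from h0 1, hd.aβ, hd.bβ, hd.cβ] at k1
      rw [show φ (x * γ) = 0 from h0 2, hd.aγ, hd.bγ, hd.cγ] at k2
      have hs0 : s = 0 := by linear_combination -k0
      have ht0 : t = 0 := by linear_combination -k1
      have hu0 : u = 0 := by linear_combination -k2
      simpa [hs0, ht0, hu0] using hs
  · refine localHilbert_eq_of_functionals (d := 3)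
      (fun j => φ ∘ₗ LinearMap.mulRight k (p' j)) (fun i => ⟨p i, hp i, hpp i⟩)
      fun x hx => ⟨fun hx j => ?_, fun h0 => hQ x hx h0⟩
    exact h.map_mul_eq_zero (i := 3) (j := 2) le_rfl hx (hp' j)
  · refine localHilbert_eq_of_functionals (d := 3)
      (fun j => φ ∘ₗ LinearMap.mulRight k (![a, b, c] j)) (fun i => ⟨![α, β, γ] i, ?_, fun j => ?_⟩)
      fun x hx => ⟨fun hx j => ?_, fun h0 => ?_⟩
    · fin_cases i
      exacts [hd.mem_α, hd.mem_β, hd.mem_γ]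
    · fin_cases i <;> fin_cases j <;> simp [mul_comm α, mul_comm β, mul_comm γ,
        hd.aα, hd.aβ, hd.aγ, hd.bα, hd.bβ, hd.bγ, hd.cα, hd.cβ, hd.cγ]
    · refine h.map_mul_eq_zero (i := 4) (j := 1) le_rfl hx ?_
      rw [pow_one]
      fin_cases j
      exacts [h.mem_a, h.mem_b, h.mem_c]
    · refine h.mem_pow_four_of_socle hd (h.mul_eq_zero_of_functional (h.map_mul_mem
        (fun w hw => h.map_mul_eq_zero (i := 3) (j := 2) le_rfl hx hw) (h0 0) (h0 1) (h0 2)))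
  · refine localHilbert_eq_of_functionals (d := 1)
      (fun _ => φ) (fun i => ⟨a * α, h4, fun j => ?_⟩)
      fun x hx => ⟨fun hx j => ?_, fun h0 => ?_⟩
    · simp [Subsingleton.elim i j, hd.aα]
    · rw [h.eq_zero_of_mem le_rfl hx, map_zero]
    · have : x = 0 := h.eq_zero_of_mul_maximal
        (fun y hy => h.eq_zero_of_mem le_rfl (mul_mem_pow_succ hx hy)) (h0 0)
      rw [this]; exact Ideal.zero_mem _
  · have : localHilbert k A (i + 5) = 0 := localHilbert_eq_of_functionals (d := 0)
      (fun _ => φ) (fun i => i.elim0) fun x hx => ⟨fun _ j => j.elim0, fun _ => by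
        rw [h.eq_zero_of_mem (by omega) hx]; exact Ideal.zero_mem _⟩
    simpa using this

theorem mem_cube_of_orthogonal (h : IsDualFrame m a b c φ) (hd : IsDualCubics m a b c φ α β γ)
    {x : A} (hx : x ∈ m ^ 2) (haa : φ (x * (a * a)) = 0) (hab : φ (x * (a * b)) = 0)
    (hac : φ (x * (a * c)) = 0) (hbb : φ (x * (b * b)) = 0) (hbc : φ (x * (b * c)) = 0)
    (hcc : φ (x * (c * c)) = 0) : x ∈ m ^ 3 :=
  h.mem_cube hd (h.functional_eq_zero_of_sq (ψ := φ ∘ₗ LinearMap.mulLeft k x)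
    (fun _ hw => h.map_mul_eq_zero (i := 2) (j := 3) le_rfl hx hw) haa hab hac hbb hbc hcc)

theorem isGorenstein₁ [IsLocalRing A] (h : IsDualFrame (maximalIdeal A) a b c φ)
    (H : IsQuartic₁ φ a b c) (h2 : (2 : k) ≠ 0) (h3 : (3 : k) ≠ 0) : IsGorenstein13331 k A := by
  have hd := h.dualCubics₁ H h2 h3
  have h24 := twentyFour_ne_zero_of h2 h3
  have orth : ∀ x ∈ maximalIdeal A ^ 2, ∀ y ∈ maximalIdeal A ^ 3, φ (x * y) = 0 :=
    fun x hx y hy => h.map_mul_eq_zero (i := 2) (j := 3) le_rfl hx hy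
  refine h.isGorenstein13331 hd ![(24 : k)⁻¹ • (a * a), (24 : k)⁻¹ • (b * b), (24 : k)⁻¹ • (c * c)]
    ![a * a, b * b, c * c] ?_ ?_ ?_ ?_
  · intro i
    fin_cases i
    exacts [smul_mem_ideal _ (mul_mem_sq h.mem_a h.mem_a),
      smul_mem_ideal _ (mul_mem_sq h.mem_b h.mem_b), smul_mem_ideal _ (mul_mem_sq h.mem_c h.mem_c)]
  · intro i
    fin_cases i
    exacts [mul_mem_sq h.mem_a h.mem_a, mul_mem_sq h.mem_b h.mem_b, mul_mem_sq h.mem_c h.mem_c]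
  · intro i j
    fin_cases i <;> fin_cases j
    · simpa [mul_assoc, h24] using H 24⁻¹ 0 0 1 0 0 1 0 0 1 0 0
    · simpa [mul_assoc, h24] using H 24⁻¹ 0 0 1 0 0 0 1 0 0 1 0
    · simpa [mul_assoc, h24] using H 24⁻¹ 0 0 1 0 0 0 0 1 0 0 1
    · simpa [mul_assoc, h24] using H 0 24⁻¹ 0 0 1 0 1 0 0 1 0 0
    · simpa [mul_assoc, h24] using H 0 24⁻¹ 0 0 1 0 0 1 0 0 1 0
    · simpa [mul_assoc, h24] using H 0 24⁻¹ 0 0 1 0 0 0 1 0 0 1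
    · simpa [mul_assoc, h24] using H 0 0 24⁻¹ 0 0 1 1 0 0 1 0 0
    · simpa [mul_assoc, h24] using H 0 0 24⁻¹ 0 0 1 0 1 0 0 1 0
    · simpa [mul_assoc, h24] using H 0 0 24⁻¹ 0 0 1 0 0 1 0 0 1
  · intro x hx h0
    exact h.mem_cube_of_orthogonal hd hx (h0 0) (orth x hx _ (h.mul_ab_mem_cube₁ H h2 h3))
      (orth x hx _ (h.mul_ac_mem_cube₁ H h2 h3)) (h0 1) (orth x hx _ (h.mul_bc_mem_cube₁ H h2 h3))
      (h0 2)

/-- Three products of generators lie in `m³`, so the other three span `m²/m³`; `ab` and `a²` are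
swapped by the duality of `x³y`, and `c²` is self-dual up to 24. -/
theorem isGorenstein₂ [IsLocalRing A] (h : IsDualFrame (maximalIdeal A) a b c φ)
    (H : IsQuartic₂ φ a b c) (h2 : (2 : k) ≠ 0) (h3 : (3 : k) ≠ 0) : IsGorenstein13331 k A := by
  have hd := h.dualCubics₂ H h2 h3
  have h6 := six_ne_zero_of h2 h3
  have h24 := twentyFour_ne_zero_of h2 h3
  have orth : ∀ x ∈ maximalIdeal A ^ 2, ∀ y ∈ maximalIdeal A ^ 3, φ (x * y) = 0 :=
    fun x hx y hy => h.map_mul_eq_zero (i := 2) (j := 3) le_rfl hx hy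
  refine h.isGorenstein13331 hd ![(6 : k)⁻¹ • (a * b), (6 : k)⁻¹ • (a * a), (24 : k)⁻¹ • (c * c)]
    ![a * a, a * b, c * c] ?_ ?_ ?_ ?_
  · intro i
    fin_cases i
    exacts [smul_mem_ideal _ (mul_mem_sq h.mem_a h.mem_b),
      smul_mem_ideal _ (mul_mem_sq h.mem_a h.mem_a), smul_mem_ideal _ (mul_mem_sq h.mem_c h.mem_c)]
  · intro i
    fin_cases i
    exacts [mul_mem_sq h.mem_a h.mem_a, mul_mem_sq h.mem_a h.mem_b, mul_mem_sq h.mem_c h.mem_c]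
  · intro i j
    fin_cases i <;> fin_cases j
    · simpa [mul_assoc, h6] using H 6⁻¹ 0 0 0 1 0 1 0 0 1 0 0
    · simpa [mul_assoc, h6] using H 6⁻¹ 0 0 0 1 0 1 0 0 0 1 0
    · simpa [mul_assoc, h6] using H 6⁻¹ 0 0 0 1 0 0 0 1 0 0 1
    · simpa [mul_assoc, h6] using H 6⁻¹ 0 0 1 0 0 1 0 0 1 0 0
    · simpa [mul_assoc, h6] using H 6⁻¹ 0 0 1 0 0 1 0 0 0 1 0
    · simpa [mul_assoc, h6] using H 6⁻¹ 0 0 1 0 0 0 0 1 0 0 1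
    · simpa [mul_assoc, h24] using H 0 0 24⁻¹ 0 0 1 1 0 0 1 0 0
    · simpa [mul_assoc, h24] using H 0 0 24⁻¹ 0 0 1 1 0 0 0 1 0
    · simpa [mul_assoc, h24] using H 0 0 24⁻¹ 0 0 1 0 0 1 0 0 1
  · intro x hx h0
    exact h.mem_cube_of_orthogonal hd hx (h0 0) (h0 1) (orth x hx _ (h.mul_ac_mem_cube₂ H h2 h3))
      (orth x hx _ (h.mul_bb_mem_cube₂ H h2 h3)) (orth x hx _ (h.mul_bc_mem_cube₂ H h2 h3)) (h0 2)

theorem isGorenstein₃ [IsLocalRing A] (h : IsDualFrame (maximalIdeal A) a b c φ)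
    (H : IsQuartic₃ φ a b c) (h2 : (2 : k) ≠ 0) (h3 : (3 : k) ≠ 0) : IsGorenstein13331 k A := by
  have hd := h.dualCubics₃ H h2 h3
  have h6 := six_ne_zero_of h2 h3
  have h4 := four_ne_zero_of h2
  have orth : ∀ x ∈ maximalIdeal A ^ 2, ∀ y ∈ maximalIdeal A ^ 3, φ (x * y) = 0 :=
    fun x hx y hy => h.map_mul_eq_zero (i := 2) (j := 3) le_rfl hx hy
  refine h.isGorenstein13331 hd ![(6 : k)⁻¹ • (a * b), (6 : k)⁻¹ • (a * a), (4 : k)⁻¹ • (a * c)]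
    ![a * a, a * b, a * c] ?_ ?_ ?_ ?_
  · intro i
    fin_cases i
    exacts [smul_mem_ideal _ (mul_mem_sq h.mem_a h.mem_b),
      smul_mem_ideal _ (mul_mem_sq h.mem_a h.mem_a), smul_mem_ideal _ (mul_mem_sq h.mem_a h.mem_c)]
  · intro i
    fin_cases i
    exacts [mul_mem_sq h.mem_a h.mem_a, mul_mem_sq h.mem_a h.mem_b, mul_mem_sq h.mem_a h.mem_c]
  · intro i j
    fin_cases i <;> fin_cases j
    · simpa [mul_assoc, h6] using H 6⁻¹ 0 0 0 1 0 1 0 0 1 0 0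
    · simpa [mul_assoc, h6] using H 6⁻¹ 0 0 0 1 0 1 0 0 0 1 0
    · simpa [mul_assoc, h6] using H 6⁻¹ 0 0 0 1 0 1 0 0 0 0 1
    · simpa [mul_assoc, h6] using H 6⁻¹ 0 0 1 0 0 1 0 0 1 0 0
    · simpa [mul_assoc, h6] using H 6⁻¹ 0 0 1 0 0 1 0 0 0 1 0
    · simpa [mul_assoc, h6] using H 6⁻¹ 0 0 1 0 0 1 0 0 0 0 1
    · simpa [mul_assoc, h4] using H 4⁻¹ 0 0 0 0 1 1 0 0 1 0 0
    · simpa [mul_assoc, h4] using H 4⁻¹ 0 0 0 0 1 1 0 0 0 1 0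
    · simpa [mul_assoc, h4] using H 4⁻¹ 0 0 0 0 1 1 0 0 0 0 1
  · intro x hx h0
    -- Modulo `m³` the square `c²` equals `(2/3)ab`, so orthogonality to `ab` gives orthogonality to
    -- `c²`.
    have hcc := orth x hx _ (h.sub_mem_cube₃ H h2 h3)
    rw [mul_sub, mul_smul_comm, mul_smul_comm, map_sub, map_smul, map_smul,
      show φ (x * (a * b)) = 0 from h0 1, smul_zero, sub_zero, smul_eq_zero] at hcc
    exact h.mem_cube_of_orthogonal hd hx (h0 0) (h0 1) (h0 2)
      (orth x hx _ (h.mul_bb_mem_cube₃ H h2 h3)) (orth x hx _ (h.mul_bc_mem_cube₃ H h2 h3))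
      (hcc.resolve_left h3)

end IsDualFrame

end Hilbert

/-! ### Comparing two frames: separating the quartics, and the invariant of the first -/

section TwoFrames

variable {k A : Type*} [Field k] [CommRing A] [Algebra k A]

namespace IsDualFrame

variable {m : Ideal A} {a b c α β γ a' b' c' α' β' γ' : A} {φ φ' : A →ₗ[k] k}

theorem eq_zero_of_lin_mem_sq (h : IsDualFrame m a b c φ) (hd : IsDualCubics m a b c φ α β γ)
    {s t u : k} (hs : s • a + t • b + u • c ∈ m ^ 2) : s = 0 ∧ t = 0 ∧ u = 0 := by
  have key : ∀ y ∈ m ^ 3, s * φ (a * y) + t * φ (b * y) + u * φ (c * y) = 0 := by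
    intro y hy
    have := h.map_mul_eq_zero (i := 2) (j := 3) le_rfl hs hy
    simpa [add_mul] using this
  have k0 := key α hd.mem_α
  have k1 := key β hd.mem_β
  have k2 := key γ hd.mem_γ
  simp only [hd.aα, hd.aβ, hd.aγ, hd.bα, hd.bβ, hd.bγ, hd.cα, hd.cβ, hd.cγ] at k0 k1 k2
  exact ⟨by linear_combination k0, by linear_combination k1, by linear_combination k2⟩

theorem eq_zero_iff_of_mem_pow_four (h : IsDualFrame m a b c φ) {x : A} (hx : x ∈ m ^ 4) :
    x = 0 ↔ φ x = 0 :=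
  ⟨fun e => by rw [e, map_zero], fun e => h.eq_zero_of_mul_maximal
    (fun _ hy => h.eq_zero_of_mem le_rfl (mul_mem_pow_succ hx hy)) e⟩

theorem map_lin_eq (h : IsDualFrame m a b c φ) {u v : A} (hu : u ∈ m) (hv : v ∈ m)
    {x₁ y₁ z₁ x₂ y₂ z₂ : k} (h₁ : u - (x₁ • a + y₁ • b + z₁ • c) ∈ m ^ 2)
    (h₂ : v - (x₂ • a + y₂ • b + z₂ • c) ∈ m ^ 2) (x₃ y₃ z₃ x₄ y₄ z₄ : k) :
    φ ((x₁ • a + y₁ • b + z₁ • c) * (x₂ • a + y₂ • b + z₂ • c) *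
      (x₃ • a + y₃ • b + z₃ • c) * (x₄ • a + y₄ • b + z₄ • c)) =
    φ (u * v * ((x₃ • a + y₃ • b + z₃ • c) * (x₄ • a + y₄ • b + z₄ • c))) := by
  have L := fun x y z : k => lin_mem (k := k) h.mem_a h.mem_b h.mem_c x y z
  have Z : ∀ x : A, x - x ∈ m ^ 2 := fun x => by rw [sub_self]; exact Ideal.zero_mem _
  rw [← h.mul_four_congr hu hv (L x₃ y₃ z₃) (L x₂ y₂ z₂) (L x₃ y₃ z₃) (L x₄ y₄ z₄) h₁ h₂
    (Z _) (Z _), mul_assoc]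

/-- If `uv ∈ m³`, the product of the linear parts of `u` and `v` is apolar to the quartic.
Evaluating at chosen vectors turns this intrinsic condition into equations on coordinates, the main
tool for comparing frames. -/
theorem map_lin_eq_zero (h : IsDualFrame m a b c φ) {u v : A} (hu : u ∈ m) (hv : v ∈ m)
    {x₁ y₁ z₁ x₂ y₂ z₂ : k} (h₁ : u - (x₁ • a + y₁ • b + z₁ • c) ∈ m ^ 2)
    (h₂ : v - (x₂ • a + y₂ • b + z₂ • c) ∈ m ^ 2) (huv : u * v ∈ m ^ 3) (x₃ y₃ z₃ x₄ y₄ z₄ : k) :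
    φ ((x₁ • a + y₁ • b + z₁ • c) * (x₂ • a + y₂ • b + z₂ • c) *
      (x₃ • a + y₃ • b + z₃ • c) * (x₄ • a + y₄ • b + z₄ • c)) = 0 := by
  have L := fun x y z : k => lin_mem (k := k) h.mem_a h.mem_b h.mem_c x y z
  rw [h.map_lin_eq hu hv h₁ h₂]
  exact h.map_mul_eq_zero (i := 3) (j := 2) le_rfl huv (mul_mem_sq (L _ _ _) (L _ _ _))

/-- Otherwise `a', b', c'` would all lie in the span of `b, c` modulo `m²` and could not express
`a`. -/
theorem coord_ne_zero (h : IsDualFrame m a b c φ) (hd : IsDualCubics m a b c φ α β γ)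
    (h' : IsDualFrame m a' b' c' φ') {x₁ y₁ z₁ y₂ z₂ y₃ z₃ : k}
    (h₁ : a' - (x₁ • a + y₁ • b + z₁ • c) ∈ m ^ 2) (h₂ : b' - (y₂ • b + z₂ • c) ∈ m ^ 2)
    (h₃ : c' - (y₃ • b + z₃ • c) ∈ m ^ 2) : x₁ ≠ 0 := by
  rintro rfl
  obtain ⟨s, t, u, hs⟩ := h'.span a h.mem_a
  have hm := Ideal.add_mem _ hs (lin_mem (k := k) h₁ h₂ h₃ s t u)
  have e : a - (s • a' + t • b' + u • c') + (s • (a' - ((0 : k) • a + y₁ • b + z₁ • c)) +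
      t • (b' - (y₂ • b + z₂ • c)) + u • (c' - (y₃ • b + z₃ • c))) =
      (1 : k) • a + (-(s * y₁ + t * y₂ + u * y₃)) • b + (-(s * z₁ + t * z₂ + u * z₃)) • c := by
    simp only [Algebra.smul_def, map_add, map_mul, map_neg, map_one, map_zero]
    ring
  rw [e] at hm
  exact one_ne_zero (h.eq_zero_of_lin_mem_sq hd hm).1

/-- The square of `(x, y, z)` is apolar to the sum of fourth powers only if `x² = y² = z² = 0`. The
other two quartics have the nonzero direction `b` with `b² ∈ m³`, which separates them from this
one. -/
theorem eq_zero_of_sq_mem_cube₁ (h : IsDualFrame m a b c φ) (H : IsQuartic₁ φ a b c)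
    (h2 : (2 : k) ≠ 0) (h3 : (3 : k) ≠ 0) {u : A} (hu : u ∈ m) (huu : u * u ∈ m ^ 3) :
    u ∈ m ^ 2 := by
  have h24 := twentyFour_ne_zero_of h2 h3
  obtain ⟨x, y, z, hl⟩ := h.span u hu
  have key := h.map_lin_eq_zero hu hu hl hl huu
  have e₁ := key 1 0 0 1 0 0
  have e₂ := key 0 1 0 0 1 0
  have e₃ := key 0 0 1 0 0 1
  rw [H] at e₁ e₂ e₃
  have hx : x = 0 := by simpa [h24] using e₁
  have hy : y = 0 := by simpa [h24] using e₂
  have hz : z = 0 := by simpa [h24] using e₃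
  simpa [hx, hy, hz] using hl

theorem not_mem_sq_b (h : IsDualFrame m a b c φ) (hd : IsDualCubics m a b c φ α β γ) :
    b ∉ m ^ 2 := fun hb =>
  one_ne_zero (h.eq_zero_of_lin_mem_sq (s := 0) (t := 1) (u := 0) hd (by simpa using hb)).2.1

theorem not_quartic₁_quartic₂ (h : IsDualFrame m a b c φ) (H : IsQuartic₁ φ a b c)
    (h' : IsDualFrame m a' b' c' φ') (H' : IsQuartic₂ φ' a' b' c')
    (h2 : (2 : k) ≠ 0) (h3 : (3 : k) ≠ 0) : False :=
  h'.not_mem_sq_b (h'.dualCubics₂ H' h2 h3)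
    (h.eq_zero_of_sq_mem_cube₁ H h2 h3 h'.mem_b (h'.mul_bb_mem_cube₂ H' h2 h3))

theorem not_quartic₁_quartic₃ (h : IsDualFrame m a b c φ) (H : IsQuartic₁ φ a b c)
    (h' : IsDualFrame m a' b' c' φ') (H' : IsQuartic₃ φ' a' b' c')
    (h2 : (2 : k) ≠ 0) (h3 : (3 : k) ≠ 0) : False :=
  h'.not_mem_sq_b (h'.dualCubics₃ H' h2 h3)
    (h.eq_zero_of_sq_mem_cube₁ H h2 h3 h'.mem_b (h'.mul_bb_mem_cube₃ H' h2 h3))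

/-- The pairwise products of `a', b', c'` lie in `m³`, which forces their coordinate vectors to have
pairwise disjoint supports. In the product of the linear parts only terms proportional to `abc`
survive. -/
theorem mul_eq_zero_of_quartic₁ (h : IsDualFrame m a b c φ) (H : IsQuartic₁ φ a b c)
    (h' : IsDualFrame m a' b' c' φ') (H' : IsQuartic₁ φ' a' b' c')
    (h2 : (2 : k) ≠ 0) (h3 : (3 : k) ≠ 0) (h0 : a * b * c = 0) : a' * b' * c' = 0 := by
  have h24 := twentyFour_ne_zero_of h2 h3
  have hab := h'.mul_ab_mem_cube₁ H' h2 h3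
  have hac := h'.mul_ac_mem_cube₁ H' h2 h3
  have hbc := h'.mul_bc_mem_cube₁ H' h2 h3
  obtain ⟨x₁, y₁, z₁, h₁⟩ := h.span a' h'.mem_a
  obtain ⟨x₂, y₂, z₂, h₂⟩ := h.span b' h'.mem_b
  obtain ⟨x₃, y₃, z₃, h₃⟩ := h.span c' h'.mem_c
  have prod : ∀ {u v : A} {x y z x' y' z' : k}, u ∈ m → v ∈ m →
      u - (x • a + y • b + z • c) ∈ m ^ 2 → v - (x' • a + y' • b + z' • c) ∈ m ^ 2 →
      u * v ∈ m ^ 3 → x * x' = 0 ∧ y * y' = 0 ∧ z * z' = 0 := by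
    intro u v x y z x' y' z' hu hv hlu hlv huv
    have key := h.map_lin_eq_zero hu hv hlu hlv huv
    have e₁ := key 1 0 0 1 0 0
    have e₂ := key 0 1 0 0 1 0
    have e₃ := key 0 0 1 0 0 1
    rw [H] at e₁ e₂ e₃
    exact ⟨by simpa [h24] using e₁, by simpa [h24] using e₂, by simpa [h24] using e₃⟩
  obtain ⟨x12, y12, z12⟩ := prod h'.mem_a h'.mem_b h₁ h₂ hab
  obtain ⟨x13, y13, z13⟩ := prod h'.mem_a h'.mem_c h₁ h₃ hac
  obtain ⟨x23, y23, z23⟩ := prod h'.mem_b h'.mem_c h₂ h₃ hbc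
  obtain ⟨q₁, rfl⟩ : ∃ q, q + (x₁ • a + y₁ • b + z₁ • c) = a' := ⟨_, sub_add_cancel _ _⟩
  obtain ⟨q₂, rfl⟩ : ∃ q, q + (x₂ • a + y₂ • b + z₂ • c) = b' := ⟨_, sub_add_cancel _ _⟩
  obtain ⟨q₃, rfl⟩ : ∃ q, q + (x₃ • a + y₃ • b + z₃ • c) = c' := ⟨_, sub_add_cancel _ _⟩
  rw [add_sub_cancel_right] at h₁ h₂ h₃
  have L := fun x y z : k => lin_mem (k := k) h.mem_a h.mem_b h.mem_c x y z
  -- The corrections in `m²` do not matter: each meets a product lying in `m³`, or another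
  -- correction, and ends in `m⁵ = 0`.
  have n₁ := h.mul_eq_zero (i := 2) (j := 3) le_rfl h₁ hbc
  have n₂ := h.mul_eq_zero (i := 2) (j := 3) le_rfl h₂ hac
  have n₃ := h.mul_eq_zero (i := 2) (j := 3) le_rfl h₃ hab
  have n₁₂ := h.mul_eq_zero (i := 4) (j := 1) le_rfl (mul_mem_pow_add h₁ h₂)
    (by simpa using h'.mem_c)
  have n₁₃ := h.mul_eq_zero (i := 4) (j := 1) le_rfl (mul_mem_pow_add h₁ h₃)
    (by simpa using L x₂ y₂ z₂)
  have n₂₃ := h.mul_eq_zero (i := 4) (j := 1) le_rfl (mul_mem_pow_add h₂ h₃)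
    (by simpa using L x₁ y₁ z₁)
  have n₁₂₃ := h.mul_eq_zero (i := 4) (j := 2) (by norm_num) (mul_mem_pow_add h₁ h₂) h₃
  have e : (q₁ + (x₁ • a + y₁ • b + z₁ • c)) * (q₂ + (x₂ • a + y₂ • b + z₂ • c)) *
      (q₃ + (x₃ • a + y₃ • b + z₃ • c)) =
      (x₁ • a + y₁ • b + z₁ • c) * (x₂ • a + y₂ • b + z₂ • c) * (x₃ • a + y₃ • b + z₃ • c) := by
    linear_combination n₁ + n₂ + n₃ - n₁₂ - n₁₃ - n₂₃ - n₁₂₃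
  have C : ∀ {s t : k}, s * t = 0 → algebraMap k A s * algebraMap k A t = 0 := fun hst => by
    rw [← map_mul, hst, map_zero]
  rw [e]
  simp only [Algebra.smul_def]
  generalize algebraMap k A = f at *
  have X12 := C x12
  have X13 := C x13
  have X23 := C x23
  have Y12 := C y12
  have Y13 := C y13
  have Y23 := C y23
  have Z12 := C z12
  have Z13 := C z13
  have Z23 := C z23
  linear_combination (f x₁ * f y₂ * f z₃ + f x₁ * f z₂ * f y₃ + f y₁ * f x₂ * f z₃ +
    f y₁ * f z₂ * f x₃ + f z₁ * f x₂ * f y₃ + f z₁ * f y₂ * f x₃) * h0 +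
    a * a * (f x₃ * a + f y₃ * b + f z₃ * c) * X12 + a * a * (f y₂ * b + f z₂ * c) * X13 +
    a * a * (f y₁ * b + f z₁ * c) * X23 +
    b * b * (f x₃ * a + f y₃ * b + f z₃ * c) * Y12 + b * b * (f x₂ * a + f z₂ * c) * Y13 +
    b * b * (f x₁ * a + f z₁ * c) * Y23 +
    c * c * (f x₃ * a + f y₃ * b + f z₃ * c) * Z12 + c * c * (f x₂ * a + f y₂ * b) * Z13 +
    c * c * (f x₁ * a + f y₁ * b) * Z23

end IsDualFrame

end TwoFrames

/-! ### Comparing two frames: invariants of the second and third quartics -/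

section TwoFrames

variable {k A : Type*} [Field k] [CommRing A] [Algebra k A]

namespace IsDualFrame

variable {m : Ideal A} {a b c α β γ a' b' c' α' β' γ' : A} {φ φ' : A →ₗ[k] k}

theorem ne_zero_of_not_mem_sq {u y : A} {s : k} (hu : u ∉ m ^ 2) (h : u - s • y ∈ m ^ 2) :
    s ≠ 0 := by
  rintro rfl
  exact hu (by simpa using h)

theorem sq_mem_cube₂ (h : IsDualFrame m a b c φ) (H : IsQuartic₂ φ a b c)
    (h2 : (2 : k) ≠ 0) (h3 : (3 : k) ≠ 0) {u : A} (hu : u ∈ m) (huu : u * u ∈ m ^ 3) :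
    ∃ y : k, u - y • b ∈ m ^ 2 := by
  have h6 := six_ne_zero_of h2 h3
  have h24 := twentyFour_ne_zero_of h2 h3
  obtain ⟨x, y, z, hl⟩ := h.span u hu
  have key := h.map_lin_eq_zero hu hu hl hl huu
  have e₁ := key 1 0 0 0 1 0
  have e₃ := key 0 0 1 0 0 1
  rw [H] at e₁ e₃
  have hx : x = 0 := by simpa [h6] using e₁
  have hz : z = 0 := by simpa [h24] using e₃
  exact ⟨y, by simpa [hx, hz] using hl⟩

theorem sq_mem_cube₃ (h : IsDualFrame m a b c φ) (H : IsQuartic₃ φ a b c)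
    (h2 : (2 : k) ≠ 0) (h3 : (3 : k) ≠ 0) {u : A} (hu : u ∈ m) (huu : u * u ∈ m ^ 3) :
    ∃ y : k, u - y • b ∈ m ^ 2 := by
  have h6 := six_ne_zero_of h2 h3
  have h4 := four_ne_zero_of h2
  obtain ⟨x, y, z, hl⟩ := h.span u hu
  have key := h.map_lin_eq_zero hu hu hl hl huu
  have e₁ := key 1 0 0 0 1 0
  have e₃ := key 1 0 0 1 0 0
  rw [H] at e₁ e₃
  have hx : x = 0 := by simpa [h6] using e₁
  have hz : z = 0 := by simpa [h4, hx] using e₃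
  exact ⟨y, by simpa [hx, hz] using hl⟩

theorem mul_mem_cube₂ (h : IsDualFrame m a b c φ) (H : IsQuartic₂ φ a b c)
    (h2 : (2 : k) ≠ 0) (h3 : (3 : k) ≠ 0) {u v : A} (hu : u ∈ m) (hu' : u ∉ m ^ 2)
    (huu : u * u ∈ m ^ 3) (hv : v ∈ m) (huv : u * v ∈ m ^ 3) :
    ∃ y z : k, v - (y • b + z • c) ∈ m ^ 2 := by
  have h6 := six_ne_zero_of h2 h3
  obtain ⟨y₂, hb⟩ := h.sq_mem_cube₂ H h2 h3 hu huu
  have hy₂ := ne_zero_of_not_mem_sq hu' hb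
  obtain ⟨x, y, z, hl⟩ := h.span v hv
  have e := h.map_lin_eq_zero (x₁ := 0) (y₁ := y₂) (z₁ := 0) hu hv (by simpa using hb) hl huv
    1 0 0 1 0 0
  rw [H] at e
  have hx : x = 0 := by simpa [h6, hy₂] using e
  exact ⟨y, z, by simpa [hx] using hl⟩

theorem mul_mem_cube₃ (h : IsDualFrame m a b c φ) (H : IsQuartic₃ φ a b c)
    (h2 : (2 : k) ≠ 0) (h3 : (3 : k) ≠ 0) {u v : A} (hu : u ∈ m) (hu' : u ∉ m ^ 2)
    (huu : u * u ∈ m ^ 3) (hv : v ∈ m) (huv : u * v ∈ m ^ 3) :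
    ∃ y z : k, v - (y • b + z • c) ∈ m ^ 2 := by
  have h6 := six_ne_zero_of h2 h3
  obtain ⟨y₂, hb⟩ := h.sq_mem_cube₃ H h2 h3 hu huu
  have hy₂ := ne_zero_of_not_mem_sq hu' hb
  obtain ⟨x, y, z, hl⟩ := h.span v hv
  have e := h.map_lin_eq_zero (x₁ := 0) (y₁ := y₂) (z₁ := 0) hu hv (by simpa using hb) hl huv
    1 0 0 1 0 0
  rw [H] at e
  have hx : x = 0 := by simpa [h6, hy₂] using e
  exact ⟨y, z, by simpa [hx] using hl⟩

/-- In the frame of the second type, `b'` is a multiple of `b` and `c'` a combination of `b` and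
`c`, modulo `m²`. Pairing `3c'² - 2a'b' ∈ m³` with `c²` kills the `c`-coordinate of `c'`, since
`φ(c⁴) ≠ 0` while `b` does not meet `z⁴`. Then `b'` and `c'` are dependent modulo `m²`. -/
theorem not_quartic₂_quartic₃ (h : IsDualFrame m a b c φ) (H : IsQuartic₂ φ a b c)
    (h' : IsDualFrame m a' b' c' φ') (H' : IsQuartic₃ φ' a' b' c')
    (h2 : (2 : k) ≠ 0) (h3 : (3 : k) ≠ 0) : False := by
  have h24 := twentyFour_ne_zero_of h2 h3
  have hd' := h'.dualCubics₃ H' h2 h3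
  have hb := h'.not_mem_sq_b hd'
  have hbb := h'.mul_bb_mem_cube₃ H' h2 h3
  obtain ⟨y₂, h₂⟩ := h.sq_mem_cube₂ H h2 h3 h'.mem_b hbb
  have hy₂ := ne_zero_of_not_mem_sq hb h₂
  obtain ⟨y₃, z₃, h₃⟩ := h.mul_mem_cube₂ H h2 h3 h'.mem_b hb hbb h'.mem_c
    (h'.mul_bc_mem_cube₃ H' h2 h3)
  obtain ⟨x₁, y₁, z₁, h₁⟩ := h.span a' h'.mem_a
  have e₁ := h.map_lin_eq (x₁ := 0) (y₁ := y₃) (z₁ := z₃) (x₂ := 0) (y₂ := y₃) (z₂ := z₃)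
    h'.mem_c h'.mem_c (by simpa using h₃) (by simpa using h₃) 0 0 1 0 0 1
  have e₂ := h.map_lin_eq (x₂ := 0) (y₂ := y₂) (z₂ := 0) h'.mem_a h'.mem_b h₁ (by simpa using h₂)
    0 0 1 0 0 1
  have e := h.map_mul_eq_zero (i := 3) (j := 2) le_rfl (h'.sub_mem_cube₃ H' h2 h3)
    (mul_mem_sq h.mem_c h.mem_c)
  rw [H] at e₁ e₂
  simp only [zero_smul, one_smul, zero_add, add_zero] at e₁ e₂
  rw [sub_mul, map_sub, smul_mul_assoc, smul_mul_assoc, map_smul, map_smul, ← e₁, ← e₂] at e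
  have hz : z₃ = 0 := by simpa [h3, h24] using e
  have hm := Ideal.sub_mem _ (smul_mem_ideal y₃ h₂) (smul_mem_ideal y₂ h₃)
  have e₃ : y₃ • (b' - y₂ • b) - y₂ • (c' - (y₃ • b + z₃ • c)) =
      (0 : k) • a' + y₃ • b' + (-y₂) • c' := by
    rw [hz]
    simp only [Algebra.smul_def, map_neg, map_zero]
    ring
  rw [e₃] at hm
  exact hy₂ (neg_eq_zero.1 (h'.eq_zero_of_lin_mem_sq hd' hm).2.2)

/-- Since both `u²` and `b²` lie in `m³`, every term containing the correction `q ∈ m²` falls into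
`m⁵ = 0`. -/
theorem cube_eq_of_sub_mem (h : IsDualFrame m a b c φ) (hbb : b * b ∈ m ^ 3) {u : A}
    (huu : u * u ∈ m ^ 3) {y : k} (hy : u - y • b ∈ m ^ 2) :
    u * u * u = (y ^ 3) • (b * b * b) := by
  obtain ⟨q, rfl⟩ : ∃ q, q + y • b = u := ⟨_, sub_add_cancel _ _⟩
  rw [add_sub_cancel_right] at hy
  have n₁ := h.mul_eq_zero (i := 3) (j := 2) le_rfl huu hy
  have n₂ := h.mul_eq_zero (i := 3) (j := 2) le_rfl hbb hy
  have n₃ := h.mul_eq_zero (i := 4) (j := 1) le_rfl (mul_mem_pow_add hy hy)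
    (by simpa using h.mem_b)
  simp only [Algebra.smul_def, map_pow] at n₁ ⊢
  linear_combination n₁ + 2 * algebraMap k A y ^ 2 * n₂ + algebraMap k A y * n₃

theorem sq_mul_eq_of_sub_mem (h : IsDualFrame m a b c φ) (hbb : b * b ∈ m ^ 3)
    (hbc : b * c ∈ m ^ 3) {u v : A}
    (huu : u * u ∈ m ^ 3) {y₂ y₃ z₃ : k} (hy : u - y₂ • b ∈ m ^ 2)
    (hv : v - (y₃ • b + z₃ • c) ∈ m ^ 2) :
    u * u * v = (y₂ ^ 2 * y₃) • (b * b * b) + (y₂ ^ 2 * z₃) • (b * b * c) := by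
  obtain ⟨q, rfl⟩ : ∃ q, q + y₂ • b = u := ⟨_, sub_add_cancel _ _⟩
  obtain ⟨r, rfl⟩ : ∃ r, r + (y₃ • b + z₃ • c) = v := ⟨_, sub_add_cancel _ _⟩
  rw [add_sub_cancel_right] at hy hv
  have n₁ := h.mul_eq_zero (i := 3) (j := 2) le_rfl huu hv
  have n₂ := h.mul_eq_zero (i := 3) (j := 2) le_rfl hbb hy
  have n₃ := h.mul_eq_zero (i := 3) (j := 2) le_rfl hbc hy
  have n₄ := h.mul_eq_zero (i := 4) (j := 1) le_rfl (mul_mem_pow_add hy hy)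
    (by simpa using h.mem_b)
  have n₅ := h.mul_eq_zero (i := 4) (j := 1) le_rfl (mul_mem_pow_add hy hy)
    (by simpa using h.mem_c)
  simp only [Algebra.smul_def, map_pow, map_mul] at n₁ ⊢
  generalize algebraMap k A = f at *
  linear_combination n₁ + 2 * f y₂ * f y₃ * n₂ + 2 * f y₂ * f z₃ * n₃ + f y₃ * n₄ + f z₃ * n₅

theorem cube_eq_zero_of_quartic₂ (h : IsDualFrame m a b c φ) (H : IsQuartic₂ φ a b c)
    (h' : IsDualFrame m a' b' c' φ') (H' : IsQuartic₂ φ' a' b' c')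
    (h2 : (2 : k) ≠ 0) (h3 : (3 : k) ≠ 0) (h0 : b * b * b = 0) : b' * b' * b' = 0 := by
  have hbb := h'.mul_bb_mem_cube₂ H' h2 h3
  obtain ⟨y₂, h₂⟩ := h.sq_mem_cube₂ H h2 h3 h'.mem_b hbb
  rw [h.cube_eq_of_sub_mem (h.mul_bb_mem_cube₂ H h2 h3) hbb h₂, h0, smul_zero]

/-- Here `a'c' ∈ m³`; pairing it with `a²` shows that `c'` has no `b`-coordinate. So `b'²c'` is a
multiple of `b²c`, with no `b³` term. -/
theorem sq_mul_eq_zero_of_quartic₂ (h : IsDualFrame m a b c φ) (H : IsQuartic₂ φ a b c)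
    (h' : IsDualFrame m a' b' c' φ') (H' : IsQuartic₂ φ' a' b' c')
    (h2 : (2 : k) ≠ 0) (h3 : (3 : k) ≠ 0) (h0 : b * b * c = 0) : b' * b' * c' = 0 := by
  have h6 := six_ne_zero_of h2 h3
  have hb := h'.not_mem_sq_b (h'.dualCubics₂ H' h2 h3)
  have hbb := h'.mul_bb_mem_cube₂ H' h2 h3
  obtain ⟨y₂, h₂⟩ := h.sq_mem_cube₂ H h2 h3 h'.mem_b hbb
  obtain ⟨y₃, z₃, h₃⟩ := h.mul_mem_cube₂ H h2 h3 h'.mem_b hb hbb h'.mem_c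
    (h'.mul_bc_mem_cube₂ H' h2 h3)
  obtain ⟨x₁, y₁, z₁, h₁⟩ := h.span a' h'.mem_a
  have hx₁ := h.coord_ne_zero (z₂ := 0) (h.dualCubics₂ H h2 h3) h' h₁ (by simpa using h₂) h₃
  have e := h.map_lin_eq_zero (x₂ := 0) (y₂ := y₃) (z₂ := z₃) h'.mem_a h'.mem_c h₁
    (by simpa using h₃) (h'.mul_ac_mem_cube₂ H' h2 h3) 1 0 0 1 0 0
  rw [H] at e
  have hy₃ : y₃ = 0 := by simpa [h6, hx₁] using e
  rw [h.sq_mul_eq_of_sub_mem (h.mul_bb_mem_cube₂ H h2 h3) (h.mul_bc_mem_cube₂ H h2 h3) hbb h₂ h₃,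
    h0, hy₃]
  simp

theorem cube_eq_zero_of_quartic₃ (h : IsDualFrame m a b c φ) (H : IsQuartic₃ φ a b c)
    (h' : IsDualFrame m a' b' c' φ') (H' : IsQuartic₃ φ' a' b' c')
    (h2 : (2 : k) ≠ 0) (h3 : (3 : k) ≠ 0) (h0 : b * b * b = 0) : b' * b' * b' = 0 := by
  have hbb := h'.mul_bb_mem_cube₃ H' h2 h3
  obtain ⟨y₂, h₂⟩ := h.sq_mem_cube₃ H h2 h3 h'.mem_b hbb
  rw [h.cube_eq_of_sub_mem (h.mul_bb_mem_cube₃ H h2 h3) hbb h₂, h0, smul_zero]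

/-- A `b`-component of `c'` is possible here, as the shear preserving the quartic shows, and it
mixes `b³` into `b'²c'`. Hence the assumption `b³ = 0`. -/
theorem sq_mul_eq_zero_of_quartic₃ (h : IsDualFrame m a b c φ) (H : IsQuartic₃ φ a b c)
    (h' : IsDualFrame m a' b' c' φ') (H' : IsQuartic₃ φ' a' b' c')
    (h2 : (2 : k) ≠ 0) (h3 : (3 : k) ≠ 0) (h0 : b * b * b = 0) (h1 : b * b * c = 0) :
    b' * b' * c' = 0 := by
  have hb := h'.not_mem_sq_b (h'.dualCubics₃ H' h2 h3)
  have hbb := h'.mul_bb_mem_cube₃ H' h2 h3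
  obtain ⟨y₂, h₂⟩ := h.sq_mem_cube₃ H h2 h3 h'.mem_b hbb
  obtain ⟨y₃, z₃, h₃⟩ := h.mul_mem_cube₃ H h2 h3 h'.mem_b hb hbb h'.mem_c
    (h'.mul_bc_mem_cube₃ H' h2 h3)
  rw [h.sq_mul_eq_of_sub_mem (h.mul_bb_mem_cube₃ H h2 h3) (h.mul_bc_mem_cube₃ H h2 h3) hbb h₂ h₃,
    h0, h1]
  simp

/-- The coordinates of a second frame of the third type, together with the transformation rules
for the cubic invariants. -/
theorem exists_coords₃ (h : IsDualFrame m a b c φ) (H : IsQuartic₃ φ a b c)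
    (h' : IsDualFrame m a' b' c' φ') (H' : IsQuartic₃ φ' a' b' c')
    (h2 : (2 : k) ≠ 0) (h3 : (3 : k) ≠ 0) :
    ∃ x₁ y₁ z₁ y₂ y₃ z₃ : k, a' - (x₁ • a + y₁ • b + z₁ • c) ∈ m ^ 2 ∧
      c' - (y₃ • b + z₃ • c) ∈ m ^ 2 ∧ x₁ ≠ 0 ∧ y₂ ≠ 0 ∧ z₃ ≠ 0 ∧
      b' * b' * c' = (y₂ ^ 2 * y₃) • (b * b * b) + (y₂ ^ 2 * z₃) • (b * b * c) ∧
      a' * b' * b' - (3 : k) • (b' * c' * c') =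
        (x₁ * y₂ ^ 2) • (a * b * b - (3 : k) • (b * c * c)) +
        (y₁ * y₂ ^ 2 - 3 * y₂ * y₃ ^ 2) • (b * b * b) +
        (z₁ * y₂ ^ 2 - 6 * y₂ * y₃ * z₃) • (b * b * c) := by
  have h4 := four_ne_zero_of h2
  have hbb := h.mul_bb_mem_cube₃ H h2 h3
  have hbc := h.mul_bc_mem_cube₃ H h2 h3
  have hcc := h.sub_mem_cube₃ H h2 h3
  have hbb' := h'.mul_bb_mem_cube₃ H' h2 h3
  have hb := h'.not_mem_sq_b (h'.dualCubics₃ H' h2 h3)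
  obtain ⟨y₂, h₂⟩ := h.sq_mem_cube₃ H h2 h3 h'.mem_b hbb'
  have hy₂ := ne_zero_of_not_mem_sq hb h₂
  obtain ⟨y₃, z₃, h₃⟩ := h.mul_mem_cube₃ H h2 h3 h'.mem_b hb hbb' h'.mem_c
    (h'.mul_bc_mem_cube₃ H' h2 h3)
  obtain ⟨x₁, y₁, z₁, h₁⟩ := h.span a' h'.mem_a
  have hx₁ := h.coord_ne_zero (z₂ := 0) (h.dualCubics₃ H h2 h3) h' h₁ (by simpa using h₂) h₃
  have e₁ := h.map_lin_eq (x₁ := 0) (y₁ := y₃) (z₁ := z₃) (x₂ := 0) (y₂ := y₃) (z₂ := z₃)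
    h'.mem_c h'.mem_c (by simpa using h₃) (by simpa using h₃) 1 0 0 1 0 0
  have e₂ := h.map_lin_eq (x₂ := 0) (y₂ := y₂) (z₂ := 0) h'.mem_a h'.mem_b h₁ (by simpa using h₂)
    1 0 0 1 0 0
  have e := h.map_mul_eq_zero (i := 3) (j := 2) le_rfl (h'.sub_mem_cube₃ H' h2 h3)
    (mul_mem_sq h.mem_a h.mem_a)
  rw [H] at e₁ e₂
  simp only [zero_smul, one_smul, add_zero] at e₁ e₂
  rw [sub_mul, map_sub, smul_mul_assoc, smul_mul_assoc, map_smul, map_smul, ← e₁, ← e₂,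
    smul_eq_mul, smul_eq_mul] at e
  -- The relation `3c'² - 2a'b' ∈ m³` paired with `a²` reads `3·4·z₃² = 2·6·x₁y₂`.
  have hz : z₃ ^ 2 = x₁ * y₂ := by
    refine mul_left_cancel₀ (mul_ne_zero h3 h4) ?_
    linear_combination e
  have hz₃ : z₃ ≠ 0 := by
    rintro rfl
    exact mul_ne_zero hx₁ hy₂ (by linear_combination -hz)
  refine ⟨x₁, y₁, z₁, y₂, y₃, z₃, h₁, h₃, hx₁, hy₂, hz₃,
    h.sq_mul_eq_of_sub_mem hbb hbc hbb' h₂ h₃, ?_⟩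
  obtain ⟨q₁, rfl⟩ : ∃ q, q + (x₁ • a + y₁ • b + z₁ • c) = a' := ⟨_, sub_add_cancel _ _⟩
  obtain ⟨q, rfl⟩ : ∃ q, q + y₂ • b = b' := ⟨_, sub_add_cancel _ _⟩
  obtain ⟨r, rfl⟩ : ∃ r, r + (y₃ • b + z₃ • c) = c' := ⟨_, sub_add_cancel _ _⟩
  rw [add_sub_cancel_right] at h₁ h₂ h₃
  have ha := (pow_one m).symm ▸ h.mem_a
  have hb := (pow_one m).symm ▸ h.mem_b
  have hc := (pow_one m).symm ▸ h.mem_c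
  have n₁ := h.mul_eq_zero (i := 3) (j := 2) le_rfl hbb' h₁
  have nqa := h.mul_eq_zero (i := 4) (j := 1) le_rfl (mul_mem_pow_add h₂ h₂) ha
  have nqb := h.mul_eq_zero (i := 4) (j := 1) le_rfl (mul_mem_pow_add h₂ h₂) hb
  have nqc := h.mul_eq_zero (i := 4) (j := 1) le_rfl (mul_mem_pow_add h₂ h₂) hc
  have nbbq := h.mul_eq_zero (i := 3) (j := 2) le_rfl hbb h₂
  have nbcq := h.mul_eq_zero (i := 3) (j := 2) le_rfl hbc h₂
  have nccq := h.mul_eq_zero (i := 3) (j := 2) le_rfl hcc h₂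
  have nbbr := h.mul_eq_zero (i := 3) (j := 2) le_rfl hbb h₃
  have nbcr := h.mul_eq_zero (i := 3) (j := 2) le_rfl hbc h₃
  have nbrr := h.mul_eq_zero (i := 4) (j := 1) le_rfl (mul_mem_pow_add h₃ h₃) hb
  have nqrb := h.mul_eq_zero (i := 4) (j := 1) le_rfl (mul_mem_pow_add h₂ h₃) hb
  have nqrc := h.mul_eq_zero (i := 4) (j := 1) le_rfl (mul_mem_pow_add h₂ h₃) hc
  have nqrr := h.mul_eq_zero (i := 4) (j := 2) (by norm_num) (mul_mem_pow_add h₂ h₃) h₃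
  -- The correction `q` of `b'` contributes `2x₁y₂·abq` to `a'b'²` and `-3z₃²·c²q` to `-3b'c'²`. As
  -- `z₃² = x₁y₂`, the sum is `-z₃²(3c² - 2ab)q = 0`. This cancellation explains the weight 3 in the
  -- invariant; the remaining corrections vanish one by one.
  have hz' : algebraMap k A z₃ ^ 2 = algebraMap k A x₁ * algebraMap k A y₂ := by
    rw [← map_pow, hz, map_mul]
  simp only [Algebra.smul_def, map_pow, map_mul, map_sub, map_ofNat] at n₁ nccq ⊢
  generalize algebraMap k A = f at *
  linear_combination n₁ + f x₁ * nqa + f y₁ * nqb + f z₁ * nqc + 2 * f y₁ * f y₂ * nbbq +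
    2 * f z₁ * f y₂ * nbcq - 3 * (f y₃ ^ 2 * nbbq + 2 * f y₃ * f z₃ * nbcq +
    2 * f y₂ * f y₃ * nbbr + 2 * f y₂ * f z₃ * nbcr + f y₂ * nbrr + 2 * f y₃ * nqrb +
    2 * f z₃ * nqrc + nqrr) - f z₃ ^ 2 * nccq - (3 * f y₂ * b * c * c + 2 * a * b * q) * hz'

/-- By the transformation rule only the coefficient `y₁y₂² - 3y₂y₃²` of `b³` is an obstacle. If `b³
≠ 0`, then `b'²c' = 0` gives `y₃ = 0`, the relation `a'³c' = 0` gives `z₁ = 0`, and `a'⁴ = 0` gives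
`y₁ = 0`. -/
theorem invariant_eq_zero_of_quartic₃ (h : IsDualFrame m a b c φ) (H : IsQuartic₃ φ a b c)
    (h' : IsDualFrame m a' b' c' φ') (H' : IsQuartic₃ φ' a' b' c')
    (h2 : (2 : k) ≠ 0) (h3 : (3 : k) ≠ 0) (h0 : b * b * c = 0) (h0' : b' * b' * c' = 0)
    (h1 : a * b * b - (3 : k) • (b * c * c) = 0) : a' * b' * b' - (3 : k) • (b' * c' * c') = 0 := by
  have h4 := four_ne_zero_of h2
  have h24 := twentyFour_ne_zero_of h2 h3
  obtain ⟨x₁, y₁, z₁, y₂, y₃, z₃, h₁, h₃, hx₁, hy₂, hz₃, e₁, e₂⟩ := h.exists_coords₃ H h' H' h2 h3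
  rw [e₂, h1, h0]
  by_cases hb : b * b * b = 0
  · simp [hb]
  have hy₃ : y₃ = 0 := by
    rw [h0, h0', smul_zero, add_zero, eq_comm, smul_eq_zero] at e₁
    simpa [hy₂, hb] using e₁
  have L := fun x y z : k => lin_mem (k := k) h.mem_a h.mem_b h.mem_c x y z
  have hm := h'.mem_a
  have h₃' : c' - ((0 : k) • a + y₃ • b + z₃ • c) ∈ m ^ 2 := by simpa using h₃
  have h4m : ∀ {u : A}, u ∈ m → a' * a' * a' * u ∈ m ^ 4 := fun hu =>
    mul_mem_pow_succ (mul_mem_cube hm hm hm) hu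
  -- The functionals `φ'` and `φ` need not be proportional; passing through the vanishing of
  -- elements of `m⁴` transfers information from one to the other.
  have c₁ : a' * a' * a' * c' = 0 := (h'.eq_zero_iff_of_mem_pow_four (h4m h'.mem_c)).2
    (by simpa using H' 1 0 0 1 0 0 1 0 0 0 0 1)
  have c₂ : a' * a' * a' * a' = 0 := (h'.eq_zero_iff_of_mem_pow_four (h4m hm)).2
    (by simpa using H' 1 0 0 1 0 0 1 0 0 1 0 0)
  rw [h.mul_four_congr hm hm hm (L _ _ _) (L _ _ _) (L _ _ _) h₁ h₁ h₁ h₃'] at c₁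
  rw [h.mul_four_congr hm hm hm (L _ _ _) (L _ _ _) (L _ _ _) h₁ h₁ h₁ h₁] at c₂
  replace c₁ := congrArg φ c₁
  replace c₂ := congrArg φ c₂
  rw [H, map_zero] at c₁ c₂
  have hz₁ : z₁ = 0 := by
    have : (3 * 4) * (x₁ ^ 2 * z₃) * z₁ = 0 := by
      rw [hy₃] at c₁
      linear_combination c₁
    simpa [h3, h4, hx₁, hz₃] using this
  have hy₁ : y₁ = 0 := by
    have : 24 * x₁ ^ 3 * y₁ = 0 := by
      rw [hz₁] at c₂
      linear_combination c₂
    simpa [h24, hx₁] using this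
  simp [hy₁, hy₃]

end IsDualFrame

end TwoFrames

/-! ### From the abstract Gorenstein algebra to a dualizing functional -/

section Extraction

open IsLocalRing

variable {k A : Type*} [Field k] [CommRing A] [Algebra k A]

theorem mk_sum_eq {I J : Ideal A} {ι : Type*} [Fintype ι] (c : ι → k) (x : ι → I) :
    ∑ i, c i • (Submodule.Quotient.mk (x i) : ↥I ⧸ J.submoduleOf I) =
      Submodule.Quotient.mk (∑ i, c i • x i) := by
  rw [← Submodule.mkQ_apply, map_sum]
  rfl

theorem mk_eq_zero_iff {I J : Ideal A} (x : I) :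
    (Submodule.Quotient.mk x : ↥I ⧸ J.submoduleOf I) = 0 ↔ (x : A) ∈ J :=
  (Submodule.Quotient.mk_eq_zero _).trans Iff.rfl

theorem coe_sum_smul {I : Ideal A} {ι : Type*} [Fintype ι] (c : ι → k) (x : ι → I) :
    ((∑ i, c i • x i : I) : A) = ∑ i, c i • (x i : A) := by
  rw [AddSubmonoidClass.coe_finsetSum]
  rfl

theorem exists_span_mod {I J : Ideal A} {d : ℕ} (hd : 0 < d)
    (h : Module.finrank k (↥I ⧸ J.submoduleOf I) = d) :
    ∃ x : Fin d → A, (∀ i, x i ∈ I) ∧ ∀ y ∈ I, ∃ c : Fin d → k, y - ∑ i, c i • x i ∈ J := by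
  have : Module.Finite k (↥I ⧸ J.submoduleOf I) := Module.finite_of_finrank_pos (h ▸ hd)
  let B := Module.finBasisOfFinrankEq k (↥I ⧸ J.submoduleOf I) h
  choose x hx using fun i => Submodule.Quotient.mk_surjective _ (B i)
  refine ⟨fun i => x i, fun i => (x i).2, fun y hy => ⟨B.repr (Submodule.Quotient.mk ⟨y, hy⟩), ?_⟩⟩
  have e := B.sum_repr (Submodule.Quotient.mk ⟨y, hy⟩)
  simp only [← hx] at e
  rw [mk_sum_eq, eq_comm, ← sub_eq_zero, ← Submodule.Quotient.mk_sub, mk_eq_zero_iff] at e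
  rwa [AddSubgroupClass.coe_sub, coe_sum_smul] at e

theorem exists_relation_mod {I J : Ideal A} {d n : ℕ} (hd : 0 < d) (hn : d < n)
    (h : Module.finrank k (↥I ⧸ J.submoduleOf I) = d) (x : Fin n → A) (hx : ∀ i, x i ∈ I) :
    ∃ c : Fin n → k, (∃ i, c i ≠ 0) ∧ ∑ i, c i • x i ∈ J := by
  have : Module.Finite k (↥I ⧸ J.submoduleOf I) := Module.finite_of_finrank_pos (h ▸ hd)
  have hli : ¬ LinearIndependent k
      fun i => (Submodule.Quotient.mk ⟨x i, hx i⟩ : ↥I ⧸ J.submoduleOf I) := fun hli => by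
    have := hli.fintype_card_le_finrank
    rw [h, Fintype.card_fin] at this
    omega
  obtain ⟨c, hc, hi⟩ := Fintype.not_linearIndependent_iff.1 hli
  rw [mk_sum_eq, mk_eq_zero_iff, coe_sum_smul] at hc
  exact ⟨c, hi, hc⟩

theorem eq_zero_of_span_mod {I J : Ideal A} {d : ℕ} (hd : 0 < d)
    (h : Module.finrank k (↥I ⧸ J.submoduleOf I) = d) (x : Fin d → A) (hx : ∀ i, x i ∈ I)
    (hs : ∀ y ∈ I, ∃ c : Fin d → k, y - ∑ i, c i • x i ∈ J) (c : Fin d → k)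
    (hc : ∑ i, c i • x i ∈ J) (i : Fin d) : c i = 0 := by
  have : Module.Finite k (↥I ⧸ J.submoduleOf I) := Module.finite_of_finrank_pos (h ▸ hd)
  have hli : LinearIndependent k
      fun i => (Submodule.Quotient.mk ⟨x i, hx i⟩ : ↥I ⧸ J.submoduleOf I) := by
    refine linearIndependent_of_top_le_span_of_card_eq_finrank ?_ (by rw [h, Fintype.card_fin])
    intro y _
    obtain ⟨y, rfl⟩ := Submodule.Quotient.mk_surjective _ y
    obtain ⟨c, hc⟩ := hs y y.2
    have e : (Submodule.Quotient.mk y : ↥I ⧸ J.submoduleOf I) =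
        ∑ i, c i • Submodule.Quotient.mk ⟨x i, hx i⟩ := by
      rw [mk_sum_eq, ← sub_eq_zero, ← Submodule.Quotient.mk_sub, mk_eq_zero_iff,
        AddSubgroupClass.coe_sub, coe_sum_smul]
      exact hc
    rw [e]
    exact Submodule.sum_mem _ fun i _ => Submodule.smul_mem _ _ (Submodule.subset_span ⟨i, rfl⟩)
  refine Fintype.linearIndependent_iff.1 hli c ?_ i
  rw [mk_sum_eq, mk_eq_zero_iff, coe_sum_smul]
  exact hc

theorem finrank_add_finrank_mod [Module.Finite k A] {I J : Ideal A} (hJ : J ≤ I) :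
    Module.finrank k (↥I ⧸ J.submoduleOf I) + Module.finrank k J = Module.finrank k I := by
  have h := Submodule.finrank_quotient_add_finrank ((J.submoduleOf I).restrictScalars k)
  rw [LinearEquiv.finrank_eq
    (Submodule.Quotient.restrictScalarsEquiv k (J.submoduleOf I))] at h
  rw [← h]
  congr 1
  exact (LinearEquiv.finrank_eq ((Submodule.submoduleOfEquivOfLe hJ).restrictScalars k)).symm

/-- The structure carried by the maximal ideal and a dualizing functional of a Gorenstein algebra
with Hilbert function `(1, 3, 3, 3, 1)`. -/
structure IsDualized13331 (m : Ideal A) (φ : A →ₗ[k] k) : Prop where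
  residue : ∀ x : A, ∃ s : k, x - algebraMap k A s ∈ m
  pow_five : m ^ 5 = ⊥
  pow_four : m ^ 4 ≠ ⊥
  nondeg : ∀ x, (∀ y, φ (x * y) = 0) → x = 0
  mem_sq : ∀ x, (∀ w ∈ m ^ 3, φ (x * w) = 0) → x ∈ m ^ 2
  mem_cube : ∀ x, (∀ w ∈ m ^ 2, φ (x * w) = 0) → x ∈ m ^ 3
  exists_frame : ∃ a b c, IsFrame k m a b c
  indep : ∀ a b c, IsFrame k m a b c → ∀ s t u : k, s • a + t • b + u • c ∈ m ^ 2 →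
    s = 0 ∧ t = 0 ∧ u = 0
  relation : ∀ p ∈ m ^ 2, ∀ q ∈ m ^ 2, ∀ r ∈ m ^ 2, ∀ w ∈ m ^ 2, ∃ s t u v : k,
    (s ≠ 0 ∨ t ≠ 0 ∨ u ≠ 0 ∨ v ≠ 0) ∧ s • p + t • q + u • r + v • w ∈ m ^ 3

/-- `I` is contained in the orthogonal complement of `J`, and for a nondegenerate form the
dimensions agree. -/
theorem mem_orthogonal_of_finrank [Module.Finite k A] {φ : A →ₗ[k] k}
    (hφ : ∀ x, (∀ y, φ (x * y) = 0) → x = 0) {I J : Ideal A}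
    (hIJ : ∀ x ∈ I, ∀ y ∈ J, x * y = 0)
    (hd : Module.finrank k I + Module.finrank k J = Module.finrank k A) (x : A)
    (hx : ∀ y ∈ J, φ (x * y) = 0) : x ∈ I := by
  let B : LinearMap.BilinForm k A := (LinearMap.mul k A).compr₂ φ
  have hB : B.Nondegenerate := by
    refine ⟨fun x hx => hφ x hx, fun y hy => hφ y fun z => ?_⟩
    rw [mul_comm]; exact hy z
  have hfin := LinearMap.BilinForm.finrank_orthogonal hB (J.restrictScalars k)
  have hle : I.restrictScalars k ≤ B.orthogonal (J.restrictScalars k) := by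
    intro x hx
    rw [LinearMap.BilinForm.mem_orthogonal_iff]
    intro y hy
    change φ (y * x) = 0
    rw [mul_comm, hIJ x hx y hy, map_zero]
  have e := Submodule.eq_of_le_of_finrank_eq hle (by
    rw [hfin, ← hd]
    exact (Nat.add_sub_cancel _ _).symm)
  have : x ∈ B.orthogonal (J.restrictScalars k) := by
    rw [LinearMap.BilinForm.mem_orthogonal_iff]
    intro y hy
    change φ (y * x) = 0
    rw [mul_comm]; exact hx y hy
  rw [← e] at this
  exact this

/-- The nonzero ideal `m⁴` is killed by `m`, so it equals the simple socle and is a line; any `φ`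
nonzero on it is nondegenerate. The dimensions of `A, m, m², m³, m⁴` are 11, 10, 7, 4, 1, and `7 + 4
= 11` makes `m²` and `m³` mutual orthogonal complements. -/
theorem exists_isDualized13331 [IsLocalRing A] (hG : IsArtinianGorenstein A)
    (hH : ∀ i, localHilbert k A i = [1, 3, 3, 3, 1].getD i 0) :
    ∃ φ : A →ₗ[k] k, IsDualized13331 (maximalIdeal A) φ := by
  have := hG.artinian
  have H0 : Module.finrank k (↥(maximalIdeal A ^ 0) ⧸
    (maximalIdeal A ^ 1).submoduleOf (maximalIdeal A ^ 0)) = 1 := hH 0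
  have H1 : Module.finrank k (↥(maximalIdeal A ^ 1) ⧸
    (maximalIdeal A ^ 2).submoduleOf (maximalIdeal A ^ 1)) = 3 := hH 1
  have H2 : Module.finrank k (↥(maximalIdeal A ^ 2) ⧸
    (maximalIdeal A ^ 3).submoduleOf (maximalIdeal A ^ 2)) = 3 := hH 2
  have H3 : Module.finrank k (↥(maximalIdeal A ^ 3) ⧸
    (maximalIdeal A ^ 4).submoduleOf (maximalIdeal A ^ 3)) = 3 := hH 3
  have H4 : Module.finrank k (↥(maximalIdeal A ^ 4) ⧸
    (maximalIdeal A ^ 5).submoduleOf (maximalIdeal A ^ 4)) = 1 := hH 4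
  have H5 : Module.finrank k (↥(maximalIdeal A ^ 5) ⧸
    (maximalIdeal A ^ 6).submoduleOf (maximalIdeal A ^ 5)) = 0 := hH 5
  have h1m : (1 : A) ∉ maximalIdeal A := fun h1 =>
    (maximalIdeal.isMaximal A).ne_top ((Ideal.eq_top_iff_one _).2 h1)
  obtain ⟨N, hN⟩ : IsNilpotent (maximalIdeal A) := by
    rw [← jacobson_eq_maximalIdeal (⊥ : Ideal A) bot_ne_top]
    exact IsArtinianRing.isNilpotent_jacobson_bot
  obtain ⟨S, hS, hSm⟩ : ∃ S : Ideal A, IsAtom S ∧ ∀ x, x ∈ S ↔ ∀ y ∈ maximalIdeal A, x * y = 0 :=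
    ⟨localSocle A, isSimpleModule_iff_isAtom.1 hG.socle_simple, fun _ => Submodule.mem_annihilator⟩
  generalize maximalIdeal A = m at *
  have hres : ∀ x : A, ∃ s : k, x - algebraMap k A s ∈ m := by
    obtain ⟨x, -, hs⟩ := exists_span_mod one_pos H0
    intro y
    obtain ⟨c, hc⟩ := hs y (by simp)
    obtain ⟨c₁, hc₁⟩ := hs 1 (by simp)
    rw [pow_one, Fin.sum_univ_one] at hc hc₁
    have h0 : c₁ 0 ≠ 0 := by
      intro h0
      rw [h0, zero_smul, sub_zero] at hc₁
      exact h1m hc₁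
    refine ⟨c 0 / c₁ 0, ?_⟩
    have := Ideal.sub_mem _ hc (smul_mem_ideal (c 0 / c₁ 0) hc₁)
    rw [smul_sub, smul_smul, div_mul_cancel₀ _ h0, Algebra.smul_def (c 0 / c₁ 0), mul_one] at this
    simpa using this
  obtain ⟨x, hxm, hxs⟩ := exists_span_mod (by norm_num) H1
  simp only [pow_one, Fin.sum_univ_three] at hxm hxs
  have hspan : ∀ y ∈ m, ∃ s t u : k, y - (s • x 0 + t • x 1 + u • x 2) ∈ m ^ 2 := fun y hy => by
    obtain ⟨c, hc⟩ := hxs y hy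
    exact ⟨c 0, c 1, c 2, hc⟩
  have htop : ∀ y : A, y ∈ Algebra.adjoin k ({x 0, x 1, x 2} : Set A) :=
    mem_of_nilpotent _ (Algebra.subset_adjoin (by simp)) (Algebra.subset_adjoin (by simp))
      (Algebra.subset_adjoin (by simp)) (hxm 0) (hxm 1) (hxm 2) hres hspan hN
  -- Finiteness must come before `m⁵ = 0`: `Module.finrank` is 0 by default on infinite-dimensional
  -- spaces, so the vanishing Hilbert value alone says nothing. The algebra is generated by three
  -- elements, and every element is a scalar plus a nilpotent, hence integral.
  have hfin : Module.Finite k A := by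
    classical
    have : Algebra.FiniteType k A :=
      ⟨⟨{x 0, x 1, x 2}, by rw [eq_top_iff]; intro y _; simpa using htop y⟩⟩
    have : Algebra.IsIntegral k A := ⟨fun y => by
      obtain ⟨s, hs⟩ := hres y
      have h1 : IsIntegral k (y - algebraMap k A s) := by
        refine IsIntegral.of_pow (n := N + 1) (Nat.succ_pos _) ?_
        have : (y - algebraMap k A s) ^ N = 0 := by
          have := Ideal.pow_mem_pow hs N
          rwa [hN, Ideal.zero_eq_bot, Ideal.mem_bot] at this
        rw [pow_succ, this, zero_mul]
        exact isIntegral_zero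
      simpa using h1.add (isIntegral_algebraMap (x := s))⟩
    exact Algebra.IsIntegral.finite
  -- From `m⁵ = m⁶` all higher powers coincide, and `m` is nilpotent.
  have h5 : m ^ 5 = ⊥ := by
    have hsub := Module.finrank_zero_iff.1 H5
    have hle : m ^ 5 ≤ m ^ 6 := fun y hy =>
      (mk_eq_zero_iff (⟨y, hy⟩ : ↥(m ^ 5))).1 (Subsingleton.elim _ _)
    have hle' : ∀ n, m ^ 5 ≤ m ^ (5 + n) := by
      intro n
      induction n with
      | zero => exact le_rfl
      | succ n ih =>
        calc m ^ 5 ≤ m ^ 6 := hle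
          _ = m ^ 5 * m := pow_succ _ _
          _ ≤ m ^ (5 + n) * m := Ideal.mul_mono_left ih
          _ = m ^ (5 + (n + 1)) := by rw [← pow_succ, add_assoc]
    refine le_bot_iff.1 ((hle' N).trans ?_)
    rw [pow_add, hN, mul_zero, Ideal.zero_eq_bot]
  have d5 : Module.finrank k ↥(m ^ 5) = 0 := by
    rw [h5]; exact finrank_bot k A
  have d4 := finrank_add_finrank_mod (k := k) (Ideal.pow_le_pow_right (I := m) (by norm_num : 4 ≤ 5))
  have d3 := finrank_add_finrank_mod (k := k) (Ideal.pow_le_pow_right (I := m) (by norm_num : 3 ≤ 4))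
  have d2 := finrank_add_finrank_mod (k := k) (Ideal.pow_le_pow_right (I := m) (by norm_num : 2 ≤ 3))
  have d1 := finrank_add_finrank_mod (k := k) (Ideal.pow_le_pow_right (I := m) (by norm_num : 1 ≤ 2))
  have d0 := finrank_add_finrank_mod (k := k) (Ideal.pow_le_pow_right (I := m) (by norm_num : 0 ≤ 1))
  have dA : Module.finrank k ↥(m ^ 0) = Module.finrank k A := by
    rw [pow_zero, Ideal.one_eq_top]
    exact finrank_top k A
  have h4 : m ^ 4 ≠ ⊥ := by
    intro e
    have : Module.finrank k ↥(m ^ 4) = 0 := by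
      rw [e]; exact finrank_bot k A
    omega
  have hS4 : m ^ 4 = S := by
    refine (hS.le_iff.1 fun y hy => (hSm y).2 fun z hz => ?_).resolve_left h4
    have := mul_mem_pow_succ hy hz
    rwa [h5, Ideal.mem_bot] at this
  obtain ⟨s₀, -, hs⟩ := exists_span_mod one_pos H4
  simp only [Fin.sum_univ_one, h5, Ideal.mem_bot, sub_eq_zero] at hs
  have hs₀ : s₀ 0 ≠ 0 := by
    intro e
    refine h4 ((Submodule.eq_bot_iff _).2 fun y hy => ?_)
    obtain ⟨c, hc⟩ := hs y hy
    rw [hc, e, smul_zero]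
  obtain ⟨φ, hφ⟩ : ∃ φ : A →ₗ[k] k, φ (s₀ 0) ≠ 0 := by
    by_contra! hcon
    exact hs₀ ((Module.forall_dual_apply_eq_zero_iff k _).1 hcon)
  have hnd : ∀ x, (∀ y, φ (x * y) = 0) → x = 0 := by
    intro x hx
    by_contra hx0
    -- For `x ≠ 0`, the last power of `m` not killed by `x` yields a nonzero multiple of `x` in the
    -- socle, where `φ` does not vanish.
    have hex : ∃ n, ∀ y ∈ m ^ n, x * y = 0 := ⟨5, fun y hy => by
      rw [h5, Ideal.mem_bot] at hy
      rw [hy, mul_zero]⟩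
    classical
    obtain ⟨n, hn⟩ : ∃ n, Nat.find hex = n + 1 := Nat.exists_eq_succ_of_ne_zero fun h0 => by
      have := Nat.find_spec hex
      rw [h0] at this
      exact hx0 (by simpa using this 1 (by simp))
    have h1 := Nat.find_spec hex
    rw [hn] at h1
    have h2 := Nat.find_min hex (m := n) (by omega)
    push Not at h2
    obtain ⟨y, hy, hxy⟩ := h2
    have hxyS : x * y ∈ m ^ 4 := by
      rw [hS4, hSm]
      intro z hz
      rw [mul_assoc]
      exact h1 _ (mul_mem_pow_succ hy hz)
    obtain ⟨c, hc⟩ := hs _ hxyS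
    have h3 := hx y
    rw [hc, map_smul, smul_eq_mul, mul_eq_zero] at h3
    rw [hc, h3.resolve_right hφ, zero_smul] at hxy
    exact hxy rfl
  have hz : ∀ {i j : ℕ}, i + j = 5 → ∀ x ∈ m ^ i, ∀ y ∈ m ^ j, x * y = 0 := by
    intro i j hij x hx y hy
    have := mul_mem_pow_add hx hy
    rwa [hij, h5, Ideal.mem_bot] at this
  refine ⟨φ, hres, h5, h4, hnd,
    mem_orthogonal_of_finrank hnd (hz (by norm_num)) (by omega),
    mem_orthogonal_of_finrank hnd (hz (by norm_num)) (by omega),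
    ⟨x 0, x 1, x 2, hxm 0, hxm 1, hxm 2, hres, hspan, h5⟩, ?_, ?_⟩
  · intro a b c h s t u hstu
    have key := eq_zero_of_span_mod (by norm_num) H1 ![a, b, c]
      (by intro i; rw [pow_one]; fin_cases i; exacts [h.mem_a, h.mem_b, h.mem_c])
      (fun y hy => by
        rw [pow_one] at hy
        obtain ⟨s, t, u, hy⟩ := h.span y hy
        exact ⟨![s, t, u], by simpa [Fin.sum_univ_three] using hy⟩) ![s, t, u]
      (by simpa [Fin.sum_univ_three] using hstu)
    exact ⟨key 0, key 1, key 2⟩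
  · intro p hp q hq r hr w hw
    obtain ⟨c, ⟨i, hi⟩, hc⟩ := exists_relation_mod (n := 4) (by norm_num) (by norm_num) H2
      ![p, q, r, w] (by intro i; fin_cases i; exacts [hp, hq, hr, hw])
    refine ⟨c 0, c 1, c 2, c 3, ?_, by simpa [Fin.sum_univ_four] using hc⟩
    fin_cases i
    exacts [Or.inl hi, Or.inr (Or.inl hi), Or.inr (Or.inr (Or.inl hi)), Or.inr (Or.inr (Or.inr hi))]

end Extraction

/-! ### Changing frames and finding a rank one direction -/

section FrameChange

variable {k A : Type*} [Field k] [CommRing A] [Algebra k A] {m : Ideal A}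

namespace IsFrame

variable {a b c a' b' c' : A}

theorem change (h : IsFrame k m a b c) (ha' : a' ∈ m) (hb' : b' ∈ m) (hc' : c' ∈ m)
    (ha : ∃ s t u : k, a - (s • a' + t • b' + u • c') ∈ m ^ 2)
    (hb : ∃ s t u : k, b - (s • a' + t • b' + u • c') ∈ m ^ 2)
    (hc : ∃ s t u : k, c - (s • a' + t • b' + u • c') ∈ m ^ 2) : IsFrame k m a' b' c' where
  mem_a := ha'
  mem_b := hb'
  mem_c := hc'
  residue := h.residue
  pow_five := h.pow_five
  span := fun x hx => by
    obtain ⟨s, t, u, hs⟩ := h.span x hx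
    obtain ⟨s₁, t₁, u₁, h₁⟩ := ha
    obtain ⟨s₂, t₂, u₂, h₂⟩ := hb
    obtain ⟨s₃, t₃, u₃, h₃⟩ := hc
    refine ⟨s * s₁ + t * s₂ + u * s₃, s * t₁ + t * t₂ + u * t₃, s * u₁ + t * u₂ + u * u₃, ?_⟩
    have := Ideal.add_mem _ hs (lin_mem (k := k) h₁ h₂ h₃ s t u)
    convert this using 1
    module

theorem change_of_eq (h : IsFrame k m a b c) (ha' : a' ∈ m) (hb' : b' ∈ m) (hc' : c' ∈ m)
    (ha : ∃ s t u : k, a = s • a' + t • b' + u • c')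
    (hb : ∃ s t u : k, b = s • a' + t • b' + u • c')
    (hc : ∃ s t u : k, c = s • a' + t • b' + u • c') : IsFrame k m a' b' c' := by
  refine h.change ha' hb' hc' ?_ ?_ ?_
  · obtain ⟨s, t, u, e⟩ := ha
    exact ⟨s, t, u, by rw [← e, sub_self]; exact Ideal.zero_mem _⟩
  · obtain ⟨s, t, u, e⟩ := hb
    exact ⟨s, t, u, by rw [← e, sub_self]; exact Ideal.zero_mem _⟩
  · obtain ⟨s, t, u, e⟩ := hc
    exact ⟨s, t, u, by rw [← e, sub_self]; exact Ideal.zero_mem _⟩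

theorem rotate (h : IsFrame k m a b c) : IsFrame k m b c a :=
  h.change_of_eq h.mem_b h.mem_c h.mem_a ⟨0, 0, 1, by module⟩ ⟨1, 0, 0, by module⟩
    ⟨0, 1, 0, by module⟩

theorem swap (h : IsFrame k m a b c) : IsFrame k m a c b :=
  h.change_of_eq h.mem_a h.mem_c h.mem_b ⟨1, 0, 0, by module⟩ ⟨0, 0, 1, by module⟩
    ⟨0, 1, 0, by module⟩

theorem smul (h : IsFrame k m a b c) {s t u : k} (hs : s ≠ 0) (ht : t ≠ 0) (hu : u ≠ 0) :
    IsFrame k m (s • a) (t • b) (u • c) :=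
  h.change_of_eq (smul_mem_ideal _ h.mem_a) (smul_mem_ideal _ h.mem_b) (smul_mem_ideal _ h.mem_c)
    ⟨s⁻¹, 0, 0, by rw [inv_smul_smul₀ hs]; module⟩
    ⟨0, t⁻¹, 0, by rw [inv_smul_smul₀ ht]; module⟩
    ⟨0, 0, u⁻¹, by rw [inv_smul_smul₀ hu]; module⟩

theorem replace_first (h : IsFrame k m a b c) {e : A} (he : e ∈ m) {s t u : k}
    (hs : s ≠ 0) (hl : e - (s • a + t • b + u • c) ∈ m ^ 2) : IsFrame k m e b c := by
  refine h.change he h.mem_b h.mem_c ⟨s⁻¹, -(s⁻¹ * t), -(s⁻¹ * u), ?_⟩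
    ⟨0, 1, 0, by simp⟩ ⟨0, 0, 1, by simp⟩
  have := smul_mem_ideal (-s⁻¹) hl
  convert this using 1
  have e1 : a = (s⁻¹ * s) • a := by rw [inv_mul_cancel₀ hs, one_smul]
  conv_lhs => rw [e1]
  module

/-- Steinitz exchange modulo `m²`. -/
theorem exists_extend (h : IsFrame k m a b c) {e : A} (he : e ∈ m) (he' : e ∉ m ^ 2) :
    ∃ p q, IsFrame k m e p q := by
  obtain ⟨s, t, u, hl⟩ := h.span e he
  by_cases hs : s = 0
  · by_cases ht : t = 0
    · by_cases hu : u = 0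
      · exact (he' (by simpa [hs, ht, hu] using hl)).elim
      · exact ⟨a, b, h.rotate.rotate.replace_first (s := u) (t := s) (u := t) he hu
          (by convert hl using 2; module)⟩
    · exact ⟨c, a, h.rotate.replace_first (s := t) (t := u) (u := s) he ht
        (by convert hl using 2; module)⟩
  · exact ⟨b, c, h.replace_first he hs hl⟩

theorem exists_extend₂ (h : IsFrame k m a b c) {e : A} (he : e ∈ m)
    (he' : ∀ s : k, e - s • a ∉ m ^ 2) : ∃ n, IsFrame k m a e n := by
  obtain ⟨s, t, u, hl⟩ := h.span e he
  by_cases ht : t = 0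
  · by_cases hu : u = 0
    · exact (he' s (by simpa [ht, hu] using hl)).elim
    · exact ⟨b, (h.rotate.rotate.replace_first (s := u) (t := s) (u := t) he hu
        (by convert hl using 2; module)).rotate.swap⟩
  · exact ⟨c, (h.rotate.replace_first (s := t) (t := u) (u := s) he ht
      (by convert hl using 2; module)).rotate.rotate⟩

end IsFrame

namespace IsDualized13331

variable {φ : A →ₗ[k] k}

theorem isDualFrame (D : IsDualized13331 m φ) {a b c : A} (h : IsFrame k m a b c) :
    IsDualFrame m a b c φ :=
  { h with nondeg := D.nondeg }

theorem mul_eq_zero (D : IsDualized13331 m φ) {x y z : A} (hx : x ∈ m ^ 3) (hy : y ∈ m)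
    (hz : z ∈ m) : x * y * z = 0 := by
  have := mul_mem_pow_succ (mul_mem_pow_succ hx hy) hz
  rwa [D.pow_five, Ideal.mem_bot] at this

theorem map_eq_zero (D : IsDualized13331 m φ) {x y z w : A} (hx : x ∈ m ^ 3) (hy : y ∈ m)
    (hz : z ∈ m) (hw : w = x * y * z) : φ w = 0 := by
  rw [hw, D.mul_eq_zero hx hy hz, map_zero]

theorem mem_cube_of_frame (D : IsDualized13331 m φ) {a b c q : A} (h : IsFrame k m a b c)
    (hq : q ∈ m ^ 2) (haa : φ (q * (a * a)) = 0) (hab : φ (q * (a * b)) = 0)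
    (hac : φ (q * (a * c)) = 0) (hbb : φ (q * (b * b)) = 0) (hbc : φ (q * (b * c)) = 0)
    (hcc : φ (q * (c * c)) = 0) : q ∈ m ^ 3 :=
  D.mem_cube q (h.functional_eq_zero_of_sq (ψ := φ ∘ₗ LinearMap.mulLeft k q)
    (fun w hw => by
      have := mul_mem_pow_add hq hw
      rw [D.pow_five, Ideal.mem_bot] at this
      simp [this]) haa hab hac hbb hbc hcc)

/-- If `e · m ⊆ m³`, then `e · m³ ⊆ m⁵ = 0`, and the orthogonal complement of `m³` is `m²`. -/
theorem mem_sq_of_mul_mem_cube (D : IsDualized13331 m φ) {a b c e : A} (h : IsFrame k m a b c)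
    (ha : e * a ∈ m ^ 3) (hb : e * b ∈ m ^ 3) (hc : e * c ∈ m ^ 3) (he : e ∈ m) : e ∈ m ^ 2 := by
  have hv : ∀ v ∈ m, e * v ∈ m ^ 3 := by
    intro v hv
    obtain ⟨s, t, u, hl⟩ := h.span v hv
    have h1 := mul_mem_pow_succ hl he
    have h2 := lin_mem (k := k) ha hb hc s t u
    convert Ideal.add_mem _ h1 h2 using 1
    simp only [Algebra.smul_def]
    ring
  refine D.mem_sq e fun w hw => ?_
  rw [pow_succ] at hw
  refine Submodule.mul_induction_on hw (fun x hx y hy => ?_) (fun x y hx hy => ?_)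
  · have := mul_mem_pow_add (hv y hy) hx
    rw [D.pow_five, Ideal.mem_bot] at this
    rw [show e * (x * y) = e * y * x by ring, this, map_zero]
  · rw [mul_add, map_add, hx, hy, add_zero]

theorem not_mem_sq (D : IsDualized13331 m φ) {a b c : A} (h : IsFrame k m a b c) : a ∉ m ^ 2 :=
  fun ha => one_ne_zero (D.indep a b c h 1 0 0 (by simpa using ha)).1

/-- Polarization: if all fourth powers vanished, then so would `24·wxyz` for all elements of `m`,
and `m⁴` would be zero. -/
theorem exists_pow_four_ne_zero (D : IsDualized13331 m φ) (h2 : (2 : k) ≠ 0) (h3 : (3 : k) ≠ 0) :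
    ∃ x ∈ m, x * x * x * x ≠ 0 := by
  by_contra! hcon
  refine D.pow_four (le_bot_iff.1 fun x hx => ?_)
  have key : ∀ w ∈ m, ∀ x ∈ m, ∀ y ∈ m, ∀ z ∈ m, w * x * y * z = 0 := by
    intro w hw x hx y hy z hz
    have e : (24 : k) • (w * x * y * z) = 0 := by
      rw [Algebra.smul_def, map_ofNat]
      linear_combination hcon _ (m.add_mem (m.add_mem (m.add_mem hw hx) hy) hz) -
        hcon _ (m.add_mem (m.add_mem hw hx) hy) - hcon _ (m.add_mem (m.add_mem hw hx) hz) -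
        hcon _ (m.add_mem (m.add_mem hw hy) hz) - hcon _ (m.add_mem (m.add_mem hx hy) hz) +
        hcon _ (m.add_mem hw hx) + hcon _ (m.add_mem hw hy) + hcon _ (m.add_mem hw hz) +
        hcon _ (m.add_mem hx hy) + hcon _ (m.add_mem hx hz) + hcon _ (m.add_mem hy hz) -
        hcon _ hw - hcon _ hx - hcon _ hy - hcon _ hz
    exact (smul_eq_zero.1 e).resolve_left (twentyFour_ne_zero_of h2 h3)
  have h3 : ∀ z ∈ m, ∀ r ∈ m * m * m, r * z = 0 := fun z hz r hr =>
    Submodule.mul_induction_on hr (fun r hr y hy =>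
      Submodule.mul_induction_on hr (fun w hw x hx => key w hw x hx y hy z hz)
        fun x x' hx hx' => by rw [add_mul, add_mul, hx, hx', add_zero])
      fun x x' hx hx' => by rw [add_mul, hx, hx', add_zero]
  rw [pow_succ, pow_succ, pow_two] at hx
  exact Submodule.mul_induction_on hx (fun r hr z hz => h3 z hz r hr)
    fun x y hx hy => Ideal.add_mem _ hx hy

/-- The element `e` spans, together with `m²`, a direction along which multiplication has rank
one modulo `m³`. -/
def IsRankOne (k : Type*) {A : Type*} [Field k] [CommRing A] [Algebra k A] (m : Ideal A)
    (e t : A) : Prop :=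
  e ∈ m ∧ e ∉ m ^ 2 ∧ t ∈ m ∧ ∀ v ∈ m, ∃ s : k, e * v - s • (e * t) ∈ m ^ 3

theorem isRankOne_of_frame {a b c e t : A} (h : IsFrame k m a b c) (he : e ∈ m) (he' : e ∉ m ^ 2)
    (ht : t ∈ m) (ha : ∃ s : k, e * a - s • (e * t) ∈ m ^ 3)
    (hb : ∃ s : k, e * b - s • (e * t) ∈ m ^ 3) (hc : ∃ s : k, e * c - s • (e * t) ∈ m ^ 3) :
    IsRankOne k m e t := by
  refine ⟨he, he', ht, fun v hv => ?_⟩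
  obtain ⟨x, y, z, hl⟩ := h.span v hv
  obtain ⟨s₁, h₁⟩ := ha
  obtain ⟨s₂, h₂⟩ := hb
  obtain ⟨s₃, h₃⟩ := hc
  refine ⟨x * s₁ + y * s₂ + z * s₃, ?_⟩
  convert Ideal.add_mem _ (mul_mem_pow_succ hl he) (lin_mem (k := k) h₁ h₂ h₃ x y z) using 1
  simp only [Algebra.smul_def, map_add, map_mul]
  ring

/-- Complete `l, v` to a frame by `n`. In the three-dimensional `m²/m³` there are relations among
`l², v², vn, ln` and among `l², v², vn, n²`. A relation among `l², v², vn` alone makes `v` the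
required direction; otherwise `ln` is proportional to `l²`, and `l` is. -/
theorem exists_isRankOne_of_mul_mem_cube (D : IsDualized13331 m φ) {l v : A} (hl : l ∈ m)
    (hl4 : l * l * l * l ≠ 0) (hv : v ∈ m) (hv' : v ∉ m ^ 2) (hlv : l * v ∈ m ^ 3) :
    ∃ e t, IsRankOne k m e t := by
  have hll : l * l ∉ m ^ 3 := fun hll => hl4 (D.mul_eq_zero hll hl hl)
  have hl' : l ∉ m ^ 2 := fun h => hll (mul_mem_pow_succ h hl)
  obtain ⟨a, b, c, h⟩ := D.exists_frame
  obtain ⟨p, q, h⟩ := h.exists_extend hl hl'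
  obtain ⟨n, h⟩ := h.exists_extend₂ hv (fun s hs => by
    have h1 := Ideal.sub_mem _ hlv (mul_mem_pow_succ hs hl)
    have e : l * v - (v - s • l) * l = s • (l * l) := by
      simp only [Algebra.smul_def]; ring
    rw [e] at h1
    by_cases h0 : s = 0
    · rw [h0, zero_smul, sub_zero] at hs
      exact hv' hs
    · have h2 := smul_mem_ideal s⁻¹ h1
      rw [inv_smul_smul₀ h0] at h2
      exact hll h2)
  have hn := h.mem_c
  -- a relation between `l²`, `v²`, `vn` makes `v` a rank one direction
  have step : ∀ s t u : k, (s ≠ 0 ∨ t ≠ 0 ∨ u ≠ 0) →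
      s • (l * l) + t • (v * v) + u • (v * n) ∈ m ^ 3 → ∃ e t, IsRankOne k m e t := by
    intro s t u h0 hm
    have hs : s = 0 := by
      have h1 := D.mul_eq_zero hm hl hl
      have h2 := D.mul_eq_zero hlv hv hl
      have h3 := D.mul_eq_zero hlv hn hl
      have h4 : s • (l * l * l * l) = 0 := by
        simp only [Algebra.smul_def] at h1 ⊢
        linear_combination h1 - algebraMap k A t * h2 - algebraMap k A u * h3
      exact (smul_eq_zero.1 h4).resolve_right hl4
    rw [hs, zero_smul, zero_add] at hm
    by_cases hu : u = 0
    · have ht : t ≠ 0 := by simpa [hs, hu] using h0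
      have hvv := smul_mem_ideal t⁻¹ hm
      rw [hu, zero_smul, add_zero, inv_smul_smul₀ ht] at hvv
      exact ⟨v, n, isRankOne_of_frame h hv hv' hn ⟨0, by simpa [mul_comm] using hlv⟩
        ⟨0, by simpa using hvv⟩ ⟨1, by simp⟩⟩
    · refine ⟨v, v, isRankOne_of_frame h hv hv' hv ⟨0, by simpa [mul_comm] using hlv⟩
        ⟨1, by simp⟩ ⟨-(u⁻¹ * t), ?_⟩⟩
      have h1 := smul_mem_ideal u⁻¹ hm
      rw [smul_add, inv_smul_smul₀ hu] at h1
      convert h1 using 1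
      module
  obtain ⟨s, t, u, w, h0, hm⟩ := D.relation _ (mul_mem_sq hl hl) _ (mul_mem_sq hv hv) _
    (mul_mem_sq hv hn) _ (mul_mem_sq hl hn)
  obtain ⟨s', t', u', w', h0', hm'⟩ := D.relation _ (mul_mem_sq hl hl) _ (mul_mem_sq hv hv) _
    (mul_mem_sq hv hn) _ (mul_mem_sq hn hn)
  by_cases hw : w = 0
  · exact step s t u (by simpa [hw] using h0) (by simpa [hw] using hm)
  by_cases hw' : w' = 0
  · exact step s' t' u' (by simpa [hw'] using h0') (by simpa [hw'] using hm')
  have hy : t • v + u • n ∈ m := m.add_mem (smul_mem_ideal _ hv) (smul_mem_ideal _ hn)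
  -- This product is orthogonal to `lm` because `lv ∈ m³`, to `vm` by the first relation, and then
  -- to `n²` by the second.
  have hvy : v * (t • v + u • n) ∈ m ^ 3 := by
    have zlv : ∀ x ∈ m, φ (v * (t • v + u • n) * (l * x)) = 0 := fun x hx =>
      D.map_eq_zero hlv hy hx (by ring)
    have zv : ∀ x ∈ m, φ (v * (t • v + u • n) * (v * x)) = 0 := by
      intro x hx
      have h1 := D.mul_eq_zero hm hv hx
      have h2 := D.mul_eq_zero hlv hl hx
      have h3 := D.mul_eq_zero hlv hn hx
      have : v * (t • v + u • n) * (v * x) = 0 := by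
        simp only [Algebra.smul_def] at h1 ⊢
        linear_combination h1 - algebraMap k A s * h2 - algebraMap k A w * h3
      rw [this, map_zero]
    refine D.mem_cube_of_frame h (mul_mem_sq hv hy) (zlv l hl) (zlv v hv) (zlv n hn)
      (zv v hv) (zv n hn) ?_
    have h1 := D.map_eq_zero hm' hv hy rfl
    have e : (s' • (l * l) + t' • (v * v) + u' • (v * n) + w' • (n * n)) * v * (t • v + u • n) =
        s' • (v * (t • v + u • n) * (l * l)) + t' • (v * (t • v + u • n) * (v * v)) +
        u' • (v * (t • v + u • n) * (v * n)) + w' • (v * (t • v + u • n) * (n * n)) := by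
      simp only [Algebra.smul_def]; ring
    rw [e] at h1
    simp only [map_add, map_smul, zlv l hl, zv v hv, zv n hn, smul_zero, zero_add] at h1
    exact (smul_eq_zero.1 h1).resolve_left hw'
  refine ⟨l, l, isRankOne_of_frame h hl hl' hl ⟨1, by simp⟩ ⟨0, by simpa using hlv⟩
    ⟨-(w⁻¹ * s), ?_⟩⟩
  have h1 := smul_mem_ideal w⁻¹ (Ideal.sub_mem _ hm hvy)
  convert h1 using 1
  have e1 : l * n = (w⁻¹ * w) • (l * n) := by rw [inv_mul_cancel₀ hw, one_smul]
  conv_lhs => rw [e1]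
  simp only [Algebra.smul_def, map_neg, map_mul]
  ring

/-- Multiplication by `l` identifies `m/m²` with `m²/m³`, so `l⁻¹p` is an endomorphism of `m/m²`. An
eigenvector `e₁` with eigenvalue `s` satisfies `(p - sl)e₁ ∈ m³`; either `e₁` or `p - sl` turns out
to have rank one. -/
theorem exists_isRankOne_of_injective [IsAlgClosed k] (D : IsDualized13331 m φ) {l : A}
    (hl : l ∈ m) (hl' : l ∉ m ^ 2) (hinj : ∀ v ∈ m, l * v ∈ m ^ 3 → v ∈ m ^ 2) :
    ∃ e t, IsRankOne k m e t := by
  obtain ⟨a, b, c, h⟩ := D.exists_frame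
  obtain ⟨p, q, h⟩ := h.exists_extend hl hl'
  have hp := h.mem_b
  have hq := h.mem_c
  have hsurj : ∀ x ∈ m ^ 2, ∃ s t u : k, x - (s • (l * l) + t • (l * p) + u • (l * q)) ∈ m ^ 3 := by
    intro x hx
    obtain ⟨s, t, u, w, h0, hm⟩ := D.relation _ (mul_mem_sq hl hl) _ (mul_mem_sq hl hp) _
      (mul_mem_sq hl hq) _ hx
    have hw : w ≠ 0 := by
      rintro rfl
      have h1 := hinj (s • l + t • p + u • q) (lin_mem hl hp hq s t u) (by
        convert hm using 1
        simp only [Algebra.smul_def, map_zero]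
        ring)
      obtain ⟨rfl, rfl, rfl⟩ := D.indep _ _ _ h s t u h1
      simp at h0
    refine ⟨-(w⁻¹ * s), -(w⁻¹ * t), -(w⁻¹ * u), ?_⟩
    have h1 := smul_mem_ideal w⁻¹ hm
    rw [smul_add, inv_smul_smul₀ hw] at h1
    convert h1 using 1
    module
  -- an eigenvector of `l⁻¹ p`
  obtain ⟨s, e₁, he₁, he₁', hse⟩ : ∃ (s : k) (e₁ : A), e₁ ∈ m ∧ e₁ ∉ m ^ 2 ∧
      (p - s • l) * e₁ ∈ m ^ 3 := by
    obtain ⟨s₁, t₁, u₁, h₁⟩ := hsurj _ (mul_mem_sq hp hl)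
    obtain ⟨s₂, t₂, u₂, h₂⟩ := hsurj _ (mul_mem_sq hp hp)
    obtain ⟨s₃, t₃, u₃, h₃⟩ := hsurj _ (mul_mem_sq hp hq)
    let M : Matrix (Fin 3) (Fin 3) k := !![s₁, s₂, s₃; t₁, t₂, t₃; u₁, u₂, u₃]
    obtain ⟨s, hs⟩ := Module.End.exists_eigenvalue (Matrix.toLin' M)
    obtain ⟨c, hc, hc0⟩ := hs.exists_hasEigenvector
    have hMc := Module.End.mem_eigenspace_iff.1 hc
    rw [Matrix.toLin'_apply] at hMc
    have e₀ : s₁ * c 0 + s₂ * c 1 + s₃ * c 2 = s * c 0 := by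
      simpa [M, Matrix.mulVec, dotProduct, Fin.sum_univ_three] using congrFun hMc 0
    have e₁ : t₁ * c 0 + t₂ * c 1 + t₃ * c 2 = s * c 1 := by
      simpa [M, Matrix.mulVec, dotProduct, Fin.sum_univ_three] using congrFun hMc 1
    have e₂ : u₁ * c 0 + u₂ * c 1 + u₃ * c 2 = s * c 2 := by
      simpa [M, Matrix.mulVec, dotProduct, Fin.sum_univ_three] using congrFun hMc 2
    refine ⟨s, c 0 • l + c 1 • p + c 2 • q, lin_mem hl hp hq _ _ _, fun hmem => hc0 ?_, ?_⟩
    · obtain ⟨z0, z1, z2⟩ := D.indep _ _ _ h _ _ _ hmem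
      ext i
      fin_cases i
      exacts [z0, z1, z2]
    · convert lin_mem (k := k) h₁ h₂ h₃ (c 0) (c 1) (c 2) using 1
      replace e₀ := congrArg (algebraMap k A) e₀
      replace e₁ := congrArg (algebraMap k A) e₁
      replace e₂ := congrArg (algebraMap k A) e₂
      simp only [Algebra.smul_def, map_add, map_mul] at e₀ e₁ e₂ ⊢
      linear_combination l * l * e₀ + l * p * e₁ + l * q * e₂
  set n := p - s • l with hn_def
  have hn : n ∈ m := m.sub_mem hp (smul_mem_ideal _ hl)
  have hn' : n ∉ m ^ 2 := fun hmem => one_ne_zero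
    (D.indep _ _ _ h (-s) 1 0 (by convert hmem using 1; rw [hn_def]; module)).2.1
  -- Suppose the kernel of `n` is the line of `e₁`. Writing `e₁v ≡ lx`, the product `nx` is
  -- orthogonal to `lm`, hence to `m²`, so `x` is a multiple of `e₁` and `e₁v` one of `e₁l`. If the
  -- kernel is larger, `n` itself has rank one.
  by_cases hU : ∀ x ∈ m, n * x ∈ m ^ 3 → ∃ r : k, x - r • e₁ ∈ m ^ 2
  · refine ⟨e₁, l, he₁, he₁', hl, fun v hv => ?_⟩
    obtain ⟨s₁, t₁, u₁, h₁⟩ := hsurj _ (mul_mem_sq he₁ hv)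
    set x := s₁ • l + t₁ • p + u₁ • q with hx_def
    have hx : x ∈ m := lin_mem hl hp hq _ _ _
    have hlx : e₁ * v - l * x ∈ m ^ 3 := by
      convert h₁ using 1
      rw [hx_def]
      simp only [Algebra.smul_def]
      ring
    have hnx : n * x ∈ m ^ 3 := by
      have zl : ∀ y ∈ m, φ (n * x * (l * y)) = 0 := by
        intro y hy
        have h1 := D.mul_eq_zero hlx hn hy
        have h2 := D.mul_eq_zero hse hv hy
        rw [show n * x * (l * y) = 0 by linear_combination h2 - h1, map_zero]
      refine D.mem_cube _ fun w hw => ?_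
      obtain ⟨s₂, t₂, u₂, h₂⟩ := hsurj w hw
      have h3 := mul_mem_pow_add (mul_mem_sq hn hx) h₂
      rw [D.pow_five, Ideal.mem_bot, mul_sub, sub_eq_zero] at h3
      rw [h3, mul_add, mul_add]
      simp only [mul_smul_comm, map_add, map_smul, zl l hl, zl p hp, zl q hq, smul_zero, add_zero]
    obtain ⟨r, hr⟩ := hU x hx hnx
    refine ⟨r, ?_⟩
    convert Ideal.add_mem _ hlx (mul_mem_pow_succ hr hl) using 1
    simp only [Algebra.smul_def]
    ring
  · push Not at hU
    obtain ⟨x, hx, hnx, hxe⟩ := hU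
    obtain ⟨p', q', h'⟩ := h.exists_extend he₁ he₁'
    obtain ⟨y, h'⟩ := h'.exists_extend₂ hx hxe
    obtain ⟨s₁, t₁, u₁, h₁⟩ := h'.span l hl
    have hny : n * l - u₁ • (n * y) ∈ m ^ 3 := by
      convert Ideal.add_mem _ (mul_mem_pow_succ h₁ hn) (Ideal.add_mem _ (smul_mem_ideal s₁ hse)
        (smul_mem_ideal t₁ hnx)) using 1
      simp only [Algebra.smul_def]
      ring
    have hu₁ : u₁ ≠ 0 := by
      rintro rfl
      rw [zero_smul, sub_zero, mul_comm] at hny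
      exact hn' (hinj n hn hny)
    refine ⟨n, l, isRankOne_of_frame h' hn hn' hl ⟨0, by simpa using hse⟩ ⟨0, by simpa using hnx⟩
      ⟨u₁⁻¹, ?_⟩⟩
    have h2 := smul_mem_ideal (-u₁⁻¹) hny
    convert h2 using 1
    have e1 : n * y = (u₁⁻¹ * u₁) • (n * y) := by rw [inv_mul_cancel₀ hu₁, one_smul]
    conv_lhs => rw [e1]
    module

theorem exists_isRankOne [IsAlgClosed k] (D : IsDualized13331 m φ) (h2 : (2 : k) ≠ 0)
    (h3 : (3 : k) ≠ 0) : ∃ e t, IsRankOne k m e t := by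
  obtain ⟨l, hl, hl4⟩ := D.exists_pow_four_ne_zero h2 h3
  by_cases hinj : ∀ v ∈ m, l * v ∈ m ^ 3 → v ∈ m ^ 2
  · exact D.exists_isRankOne_of_injective hl
      (fun h => hl4 (D.mul_eq_zero (mul_mem_pow_succ h hl) hl hl)) hinj
  · push Not at hinj
    obtain ⟨v, hv, hlv, hv'⟩ := hinj
    exact D.exists_isRankOne_of_mul_mem_cube hl hl4 hv hv' hlv

end IsDualized13331

end FrameChange

/-! ### Normal forms of the quartic -/

section QuarticNormalForms

variable {k A : Type*} [Field k] [CommRing A] [Algebra k A] {m : Ideal A} {φ : A →ₗ[k] k}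

namespace IsDualized13331

/-- If `φ(x⁴) = 0`, then `x²` is orthogonal to `m²`, so `x` multiplies `m` into `m³` and lies in
`m²`. -/
theorem map_pow_four_ne_zero (D : IsDualized13331 m φ) {x y z : A} (h : IsFrame k m x y z)
    (hxy : x * y ∈ m ^ 3) (hxz : x * z ∈ m ^ 3) : φ (x * x * x * x) ≠ 0 := by
  intro h0
  have hx := h.mem_a
  have hy := h.mem_b
  have hz := h.mem_c
  have hxx : x * x ∈ m ^ 3 := D.mem_cube_of_frame h (mul_mem_sq hx hx)
    (by rw [← h0]; congr 1; ring) (D.map_eq_zero hxy hx hx (by ring))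
    (D.map_eq_zero hxz hx hx (by ring)) (D.map_eq_zero hxy hx hy (by ring))
    (D.map_eq_zero hxy hx hz (by ring)) (D.map_eq_zero hxz hx hz (by ring))
  exact D.not_mem_sq h (D.mem_sq_of_mul_mem_cube h hxx hxy hxz hx)

/-- Otherwise `uw` would be orthogonal to `m²`, and `u` would multiply `m` into `m³`. -/
theorem map_mul_cube_ne_zero (D : IsDualized13331 m φ) {u v w : A} (h : IsFrame k m u v w)
    (huu : u * u ∈ m ^ 3) (huv : u * v ∈ m ^ 3) : φ (w * w * w * u) ≠ 0 := by
  intro h0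
  have hu := h.mem_a
  have hv := h.mem_b
  have hw := h.mem_c
  have huw : u * w ∈ m ^ 3 := D.mem_cube_of_frame h (mul_mem_sq hu hw)
    (D.map_eq_zero huu hu hw (by ring)) (D.map_eq_zero huu hv hw (by ring))
    (D.map_eq_zero huu hw hw (by ring)) (D.map_eq_zero huv hv hw (by ring))
    (D.map_eq_zero huv hw hw (by ring)) (by rw [← h0]; congr 1; ring)
  exact D.not_mem_sq h (D.mem_sq_of_mul_mem_cube h huu huv huw hu)

theorem exists_quartic₁ [IsAlgClosed k] (D : IsDualized13331 m φ) (h2 : (2 : k) ≠ 0)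
    (h3 : (3 : k) ≠ 0) {x y z : A} (h : IsFrame k m x y z) (hxy : x * y ∈ m ^ 3)
    (hxz : x * z ∈ m ^ 3) (hyz : y * z ∈ m ^ 3) :
    ∃ a b c, IsFrame k m a b c ∧ IsQuartic₁ φ a b c := by
  have h24 := twentyFour_ne_zero_of h2 h3
  have scale : ∀ {v : A}, φ (v * v * v * v) ≠ 0 → ∃ s : k, s ≠ 0 ∧ φ ((s • v) ^ 4) = 24 := by
    intro v hv
    obtain ⟨s, hs⟩ := IsAlgClosed.exists_pow_nat_eq (24 / φ (v * v * v * v)) (n := 4) (by norm_num)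
    refine ⟨s, ?_, ?_⟩
    · rintro rfl
      rw [zero_pow (by norm_num)] at hs
      exact div_ne_zero h24 hv hs.symm
    · rw [smul_pow, map_smul, hs, show v ^ 4 = v * v * v * v by ring, smul_eq_mul,
        div_mul_cancel₀ _ hv]
  obtain ⟨s, hs, es⟩ := scale (D.map_pow_four_ne_zero h hxy hxz)
  obtain ⟨t, ht, et⟩ := scale (D.map_pow_four_ne_zero h.rotate hyz (by rwa [mul_comm]))
  obtain ⟨u, hu, eu⟩ := scale (D.map_pow_four_ne_zero h.rotate.rotate (by rwa [mul_comm])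
    (by rwa [mul_comm]))
  have h' := h.smul hs ht hu
  refine ⟨s • x, t • y, u • z, h', ?_⟩
  have H : ∀ (s t : k) {v w : A}, v * w ∈ m ^ 3 → (s • v) * (t • w) ∈ m ^ 3 := by
    intro s t v w hvw
    rw [smul_mul_smul_comm]; exact smul_mem_ideal _ hvw
  have hab := H s t hxy
  have hac := H s u hxz
  have hbc := H t u hyz
  have ha := h'.mem_a
  have hb := h'.mem_b
  have hc := h'.mem_c
  generalize s • x = a at *
  generalize t • y = b at *
  generalize u • z = c at *
  exact .of_moments es (D.map_eq_zero hab ha ha (by ring)) (D.map_eq_zero hac ha ha (by ring))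
    (D.map_eq_zero hab ha hb (by ring)) (D.map_eq_zero hab ha hc (by ring))
    (D.map_eq_zero hac ha hc (by ring)) (D.map_eq_zero hab hb hb (by ring))
    (D.map_eq_zero hab hb hc (by ring)) (D.map_eq_zero hab hc hc (by ring))
    (D.map_eq_zero hac hc hc (by ring)) et (D.map_eq_zero hbc hb hb (by ring))
    (D.map_eq_zero hbc hb hc (by ring)) (D.map_eq_zero hbc hc hc (by ring)) eu

/-- The direction `e` splits off as the fourth power `z⁴`. Among forms in `u, w` only `w⁴` and `w³u`
can have nonzero moments; adding a multiple of `u` to `w` removes `w⁴`. So `w, u, e` become `a, b,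
c`. -/
theorem exists_quartic₂ [IsAlgClosed k] (D : IsDualized13331 m φ) (h2 : (2 : k) ≠ 0)
    (h3 : (3 : k) ≠ 0) {e u w : A} (h : IsFrame k m e u w) (heu : e * u ∈ m ^ 3)
    (hew : e * w ∈ m ^ 3) (huu : u * u ∈ m ^ 3) :
    ∃ a b c, IsFrame k m a b c ∧ IsQuartic₂ φ a b c := by
  have h24 := twentyFour_ne_zero_of h2 h3
  have h6 := six_ne_zero_of h2 h3
  have h4 := four_ne_zero_of h2
  have he := h.mem_a
  have hu := h.mem_b
  have hw := h.mem_c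
  have e4 := D.map_pow_four_ne_zero h heu hew
  have u4 : φ (w * w * w * u) ≠ 0 :=
    D.map_mul_cube_ne_zero h.rotate.swap huu (by rwa [mul_comm])
  obtain ⟨s, hs⟩ := IsAlgClosed.exists_pow_nat_eq (24 / φ (e * e * e * e)) (n := 4) (by norm_num)
  have hs0 : s ≠ 0 := by
    rintro rfl
    rw [zero_pow (by norm_num)] at hs
    exact div_ne_zero h24 e4 hs.symm
  set t : k := 6 / φ (w * w * w * u)
  have ht0 : t ≠ 0 := div_ne_zero h6 u4
  -- Solves `φ((w + ru)⁴) = φ(w⁴) + 4r φ(w³u) = 0`.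
  set r : k := -φ (w * w * w * w) / (4 * φ (w * w * w * u))
  have ha : w + r • u ∈ m := m.add_mem hw (smul_mem_ideal _ hu)
  have hb : t • u ∈ m := smul_mem_ideal _ hu
  have hc : s • e ∈ m := smul_mem_ideal _ he
  have h' : IsFrame k m (w + r • u) (t • u) (s • e) :=
    h.change_of_eq ha hb hc ⟨0, 0, s⁻¹, by rw [inv_smul_smul₀ hs0]; module⟩
      ⟨0, t⁻¹, 0, by rw [inv_smul_smul₀ ht0]; module⟩
      ⟨1, -(r * t⁻¹), 0, by
        rw [neg_smul, mul_smul, inv_smul_smul₀ ht0]; module⟩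
  refine ⟨w + r • u, t • u, s • e, h', ?_⟩
  have z₁ := D.mul_eq_zero huu hw hw
  have z₂ := D.mul_eq_zero huu hu hw
  have z₃ := D.mul_eq_zero huu hu hu
  have m400 : φ ((w + r • u) ^ 4) = 0 := by
    have e1 : (w + r • u) ^ 4 = w * w * w * w + (4 * r) • (w * w * w * u) := by
      simp only [Algebra.smul_def, map_mul, map_ofNat]
      linear_combination (6 * algebraMap k A r ^ 2) * z₁ + (4 * algebraMap k A r ^ 3) * z₂ +
        algebraMap k A r ^ 4 * z₃
    rw [e1, map_add, map_smul, smul_eq_mul]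
    simp only [r]
    field_simp
    ring
  have m310 : φ ((w + r • u) ^ 3 * (t • u)) = 6 := by
    have e1 : (w + r • u) ^ 3 * (t • u) = t • (w * w * w * u) := by
      simp only [Algebra.smul_def]
      linear_combination (3 * algebraMap k A r * algebraMap k A t) * z₁ +
        (3 * algebraMap k A r ^ 2 * algebraMap k A t) * z₂ +
        (algebraMap k A r ^ 3 * algebraMap k A t) * z₃
    rw [e1, map_smul, smul_eq_mul, div_mul_cancel₀ _ u4]
  have m004 : φ ((s • e) ^ 4) = 24 := by
    rw [smul_pow, map_smul, hs, show e ^ 4 = e * e * e * e by ring, smul_eq_mul,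
      div_mul_cancel₀ _ e4]
  have hbb : (t • u) * (t • u) ∈ m ^ 3 := by
    rw [smul_mul_smul_comm]; exact smul_mem_ideal _ huu
  have hbc : (t • u) * (s • e) ∈ m ^ 3 := by
    rw [smul_mul_smul_comm, mul_comm u]; exact smul_mem_ideal _ heu
  have hac : (w + r • u) * (s • e) ∈ m ^ 3 := by
    convert Ideal.add_mem _ (smul_mem_ideal s hew) (smul_mem_ideal (r * s) heu) using 1
    simp only [Algebra.smul_def, map_mul]
    ring
  generalize w + r • u = a at *
  generalize t • u = b at *
  generalize s • e = c at *
  exact .of_moments m400 m310 (D.map_eq_zero hac ha ha (by ring))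
    (D.map_eq_zero hbb ha ha (by ring)) (D.map_eq_zero hac ha hb (by ring))
    (D.map_eq_zero hac ha hc (by ring)) (D.map_eq_zero hbb ha hb (by ring))
    (D.map_eq_zero hbb ha hc (by ring)) (D.map_eq_zero hac hb hc (by ring))
    (D.map_eq_zero hac hc hc (by ring)) (D.map_eq_zero hbb hb hb (by ring))
    (D.map_eq_zero hbb hb hc (by ring)) (D.map_eq_zero hbb hc hc (by ring))
    (D.map_eq_zero hbc hc hc (by ring)) m004

/-- Here `t, e, n` become `a, b, c`. The apolar quadrics `e²`, `en` and `n² - κet` leave only `t⁴,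
t³e, t³n, t²n²` as possible independent moments; shifts by multiples of `e` clear `t⁴` and `t³n`,
and scalings fix the other two. -/
theorem exists_quartic₃ [IsAlgClosed k] (D : IsDualized13331 m φ) (h2 : (2 : k) ≠ 0)
    (h3 : (3 : k) ≠ 0) {e t n : A} (h : IsFrame k m e t n) (hee : e * e ∈ m ^ 3)
    (hen : e * n ∈ m ^ 3) {κ : k} (hnn : n * n - κ • (e * t) ∈ m ^ 3) :
    ∃ a b c, IsFrame k m a b c ∧ IsQuartic₃ φ a b c := by
  have h4 := four_ne_zero_of h2
  have h6 := six_ne_zero_of h2 h3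
  have he := h.mem_a
  have ht := h.mem_b
  have hn := h.mem_c
  have y0 : φ (t * t * t * e) ≠ 0 := D.map_mul_cube_ne_zero h.swap hee hen
  set y := φ (t * t * t * e)
  set r : k := -φ (t * t * t * n) / y with hr
  set r' : k := -φ (t * t * t * t) / (4 * y) with hr'
  have zee := fun {v w : A} (hv : v ∈ m) (hw : w ∈ m) => D.mul_eq_zero hee hv hw
  have zen := fun {v w : A} (hv : v ∈ m) (hw : w ∈ m) => D.mul_eq_zero hen hv hw
  have znn := fun {v w : A} (hv : v ∈ m) (hw : w ∈ m) => D.mul_eq_zero hnn hv hw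
  have tn0 : φ (t * t * t * (n + r • e)) = 0 := by
    rw [mul_add, map_add, mul_smul_comm, map_smul, smul_eq_mul, hr, div_mul_cancel₀ _ y0]
    ring
  have ttnn : φ (t * t * n * n) = κ * y := by
    have e1 : t * t * n * n = κ • (t * t * t * e) := by
      have := znn ht ht
      simp only [Algebra.smul_def] at this ⊢
      linear_combination this
    rw [e1, map_smul, smul_eq_mul]
  -- If `κ = 0`, the vector `n + re`, with `r` chosen to kill `φ(t³(n + re))`, multiplies `m` into
  -- `m³`, which is impossible in a frame.
  have κ0 : κ ≠ 0 := by
    intro hκ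
    rw [hκ, zero_smul, sub_zero] at hnn
    have hz : n + r • e ∈ m := m.add_mem hn (smul_mem_ideal _ he)
    have hze : (n + r • e) * e ∈ m ^ 3 := by
      convert Ideal.add_mem _ hen (smul_mem_ideal r hee) using 1
      simp only [Algebra.smul_def]; ring
    have hzn : (n + r • e) * n ∈ m ^ 3 := by
      convert Ideal.add_mem _ hnn (smul_mem_ideal r hen) using 1
      simp only [Algebra.smul_def]; ring
    have hzt : (n + r • e) * t ∈ m ^ 3 := D.mem_cube_of_frame h (mul_mem_sq hz ht)
      (D.map_eq_zero hze he ht (by ring)) (D.map_eq_zero hze ht ht (by ring))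
      (D.map_eq_zero hze hn ht (by ring)) (by rw [← tn0]; congr 1; ring)
      (D.map_eq_zero hzn ht ht (by ring)) (D.map_eq_zero hzn hn ht (by ring))
    have := D.mem_sq_of_mul_mem_cube h hze hzt hzn hz
    exact one_ne_zero (D.indep _ _ _ h r 0 1 (by convert this using 1; module)).2.2
  obtain ⟨s, hs⟩ := IsAlgClosed.exists_pow_nat_eq (4 / (κ * y)) (n := 2) (by norm_num)
  have hs0 : s ≠ 0 := by
    rintro rfl
    rw [zero_pow (by norm_num)] at hs
    exact div_ne_zero h4 (mul_ne_zero κ0 y0) hs.symm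
  set u : k := 6 / y with hu
  have hu0 : u ≠ 0 := div_ne_zero h6 y0
  have ha : t + r' • e ∈ m := m.add_mem ht (smul_mem_ideal _ he)
  have hb : u • e ∈ m := smul_mem_ideal _ he
  have hc : s • (n + r • e) ∈ m := smul_mem_ideal _ (m.add_mem hn (smul_mem_ideal _ he))
  have h' : IsFrame k m (t + r' • e) (u • e) (s • (n + r • e)) :=
    h.change_of_eq ha hb hc ⟨0, u⁻¹, 0, by rw [inv_smul_smul₀ hu0]; module⟩
      ⟨1, -(r' * u⁻¹), 0, by rw [neg_smul, mul_smul, inv_smul_smul₀ hu0]; module⟩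
      ⟨0, -(r * u⁻¹), s⁻¹, by
        rw [neg_smul, mul_smul, inv_smul_smul₀ hu0, inv_smul_smul₀ hs0]; module⟩
  refine ⟨_, _, _, h', ?_⟩
  have m400 : φ ((t + r' • e) ^ 4) = 0 := by
    have e1 : (t + r' • e) ^ 4 = t * t * t * t + (4 * r') • (t * t * t * e) := by
      simp only [Algebra.smul_def, map_mul, map_ofNat]
      linear_combination (6 * algebraMap k A r' ^ 2) * zee ht ht +
        (4 * algebraMap k A r' ^ 3) * zee he ht + algebraMap k A r' ^ 4 * zee he he
    rw [e1, map_add, map_smul, smul_eq_mul]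
    change _ + 4 * r' * y = 0
    rw [hr']
    field_simp
    ring
  have m310 : φ ((t + r' • e) ^ 3 * (u • e)) = 6 := by
    have e1 : (t + r' • e) ^ 3 * (u • e) = u • (t * t * t * e) := by
      simp only [Algebra.smul_def]
      linear_combination (3 * algebraMap k A r' * algebraMap k A u) * zee ht ht +
        (3 * algebraMap k A r' ^ 2 * algebraMap k A u) * zee he ht +
        (algebraMap k A r' ^ 3 * algebraMap k A u) * zee he he
    rw [e1, map_smul, smul_eq_mul]
    exact div_mul_cancel₀ _ y0
  have m301 : φ ((t + r' • e) ^ 3 * (s • (n + r • e))) = 0 := by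
    have e1 : (t + r' • e) ^ 3 * (s • (n + r • e)) = s • (t * t * t * (n + r • e)) := by
      simp only [Algebra.smul_def]
      generalize algebraMap k A = f at *
      linear_combination (3 * f r' * f s * f r) * zee ht ht + (3 * f r' ^ 2 * f s * f r) * zee he ht +
        (f r' ^ 3 * f s * f r) * zee he he + (3 * f r' * f s) * zen ht ht +
        (3 * f r' ^ 2 * f s) * zen he ht + (f r' ^ 3 * f s) * zen he he
    rw [e1, map_smul, tn0, smul_zero]
  have m202 : φ ((t + r' • e) ^ 2 * (s • (n + r • e)) ^ 2) = 4 := by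
    have e1 : (t + r' • e) ^ 2 * (s • (n + r • e)) ^ 2 = (s ^ 2) • (t * t * n * n) := by
      simp only [Algebra.smul_def, map_pow]
      generalize algebraMap k A = f at *
      linear_combination (f s ^ 2 * (2 * f r)) * zen ht ht + (f s ^ 2 * f r ^ 2) * zee ht ht +
        (f s ^ 2 * 2 * f r') * zen ht hn + (f s ^ 2 * 2 * f r' * 2 * f r) * zen ht he +
        (f s ^ 2 * 2 * f r' * f r ^ 2) * zee ht he + (f s ^ 2 * f r' ^ 2) * zen he hn +
        (f s ^ 2 * f r' ^ 2 * 2 * f r) * zen he he + (f s ^ 2 * f r' ^ 2 * f r ^ 2) * zee he he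
    rw [e1, map_smul, ttnn, hs, smul_eq_mul, div_mul_cancel₀ _ (mul_ne_zero κ0 y0)]
  have hbb : (u • e) * (u • e) ∈ m ^ 3 := by
    rw [smul_mul_smul_comm]; exact smul_mem_ideal _ hee
  have hbc : (u • e) * (s • (n + r • e)) ∈ m ^ 3 := by
    rw [smul_mul_smul_comm, mul_add, mul_smul_comm]
    exact smul_mem_ideal _ (Ideal.add_mem _ hen (smul_mem_ideal _ hee))
  have hcc : (s • (n + r • e)) * (s • (n + r • e)) - (s ^ 2 * κ * u⁻¹) • ((t + r' • e) * (u • e)) ∈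
      m ^ 3 := by
    have h1 := Ideal.add_mem _ (smul_mem_ideal (s ^ 2) hnn) (Ideal.add_mem _
      (smul_mem_ideal (s ^ 2 * 2 * r) hen)
      (smul_mem_ideal (s ^ 2 * r ^ 2 - s ^ 2 * κ * r') hee))
    convert h1 using 1
    have hu1 : algebraMap k A u⁻¹ * algebraMap k A u = 1 := by
      rw [← map_mul, inv_mul_cancel₀ hu0, map_one]
    simp only [Algebra.smul_def, map_mul, map_sub, map_pow, map_ofNat]
    generalize algebraMap k A = f at *
    linear_combination (-f s ^ 2 * f κ * (t + f r' * e) * e) * hu1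
  generalize t + r' • e = a at *
  generalize u • e = b at *
  generalize s • (n + r • e) = c at *
  generalize s ^ 2 * κ * u⁻¹ = τ at *
  have zbc := fun {v w : A} (hv : v ∈ m) (hw : w ∈ m) => D.mul_eq_zero hbc hv hw
  have zcc := fun {v w : A} (hv : v ∈ m) (hw : w ∈ m) => D.mul_eq_zero hcc hv hw
  have m103 : φ (a * c ^ 3) = 0 := by
    have : a * c ^ 3 = 0 := by
      have h1 := zcc hc ha
      simp only [Algebra.smul_def] at h1
      linear_combination h1 + algebraMap k A τ * zbc ha ha
    rw [this, map_zero]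
  have m004 : φ (c ^ 4) = 0 := by
    have : c ^ 4 = 0 := by
      have h1 := zcc hc hc
      simp only [Algebra.smul_def] at h1
      linear_combination h1 + algebraMap k A τ * zbc ha hc
    rw [this, map_zero]
  exact .of_moments m400 m310 m301
    (D.map_eq_zero hbb ha ha (by ring)) (D.map_eq_zero hbc ha ha (by ring)) m202
    (D.map_eq_zero hbb ha hb (by ring))
    (D.map_eq_zero hbb ha hc (by ring)) (D.map_eq_zero hbc ha hc (by ring)) m103
    (D.map_eq_zero hbb hb hb (by ring))
    (D.map_eq_zero hbb hb hc (by ring)) (D.map_eq_zero hbb hc hc (by ring))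
    (D.map_eq_zero hbc hc hc (by ring)) m004

/-- The fourth moments of a Gorenstein algebra with Hilbert function `(1, 3, 3, 3, 1)` can be
brought into one of three normal forms. -/
theorem exists_quartic [IsAlgClosed k] (D : IsDualized13331 m φ) (h2 : (2 : k) ≠ 0)
    (h3 : (3 : k) ≠ 0) : ∃ a b c, IsFrame k m a b c ∧
      (IsQuartic₁ φ a b c ∨ IsQuartic₂ φ a b c ∨ IsQuartic₃ φ a b c) := by
  suffices H : (∃ a b c, IsFrame k m a b c ∧ IsQuartic₁ φ a b c) ∨
      (∃ a b c, IsFrame k m a b c ∧ IsQuartic₂ φ a b c) ∨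
      (∃ a b c, IsFrame k m a b c ∧ IsQuartic₃ φ a b c) by
    rcases H with ⟨a, b, c, h, H⟩ | ⟨a, b, c, h, H⟩ | ⟨a, b, c, h, H⟩
    exacts [⟨a, b, c, h, Or.inl H⟩, ⟨a, b, c, h, Or.inr (Or.inl H)⟩,
      ⟨a, b, c, h, Or.inr (Or.inr H)⟩]
  obtain ⟨e, t, he, he', ht, hrk⟩ := D.exists_isRankOne h2 h3
  obtain ⟨a, b, c, h⟩ := D.exists_frame
  obtain ⟨p, q, h⟩ := h.exists_extend he he'
  -- If `e² ∈ m³`, the vector `e` becomes `b` of the second or third type. Otherwise `e` splits off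
  -- as a fourth power, leaving a binary problem.
  by_cases hee : e * e ∈ m ^ 3
  · have het : e * t ∉ m ^ 3 := by
      intro het
      have : ∀ v ∈ m, e * v ∈ m ^ 3 := fun v hv => by
        obtain ⟨s, hs⟩ := hrk v hv
        simpa using Ideal.add_mem _ hs (smul_mem_ideal s het)
      exact he' (D.mem_sq_of_mul_mem_cube h (this _ h.mem_a) (this _ h.mem_b) (this _ h.mem_c) he)
    obtain ⟨n₀, h⟩ := h.exists_extend₂ ht (fun s hs => het (by
      convert Ideal.add_mem _ (mul_mem_pow_succ hs he) (smul_mem_ideal s hee) using 1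
      simp only [Algebra.smul_def]; ring))
    obtain ⟨σ, hσ⟩ := hrk n₀ h.mem_c
    obtain ⟨n, hn, h, hen⟩ : ∃ n ∈ m, IsFrame k m e t n ∧ e * n ∈ m ^ 3 :=
      ⟨n₀ - σ • t, m.sub_mem h.mem_c (smul_mem_ideal _ ht),
        h.change_of_eq he ht (m.sub_mem h.mem_c (smul_mem_ideal _ ht)) ⟨1, 0, 0, by module⟩
          ⟨0, 1, 0, by module⟩ ⟨0, σ, 1, by module⟩, by rwa [mul_sub, mul_smul_comm]⟩
    have y0 : φ (t * t * t * e) ≠ 0 := D.map_mul_cube_ne_zero h.swap hee hen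
    obtain ⟨c₁, c₂, c₃, c₄, h0, hm⟩ := D.relation _ (mul_mem_sq ht ht) _ (mul_mem_sq he ht) _
      (mul_mem_sq ht hn) _ (mul_mem_sq hn hn)
    have hc₁ : c₁ = 0 := by
      have z := D.mul_eq_zero hm he ht
      have e1 : c₁ • (t * t * t * e) = 0 := by
        simp only [Algebra.smul_def] at z ⊢
        linear_combination z - algebraMap k A c₂ * D.mul_eq_zero hee ht ht -
          algebraMap k A c₃ * D.mul_eq_zero hen ht ht - algebraMap k A c₄ * D.mul_eq_zero hen hn ht
      have := congrArg φ e1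
      rw [map_smul, map_zero, smul_eq_mul] at this
      exact (_root_.mul_eq_zero.1 this).resolve_right y0
    rw [hc₁, zero_smul, zero_add] at hm
    -- A relation without `n²` reads `t(c₃n + c₂e) ∈ m³`, so `c₃n + c₂e` splits off as the fourth
    -- power of the second type.
    by_cases hc₄ : c₄ = 0
    · rw [hc₄, zero_smul, add_zero] at hm
      have hc₃ : c₃ ≠ 0 := by
        rintro rfl
        rw [zero_smul, add_zero] at hm
        have hc₂ : c₂ ≠ 0 := by simpa [hc₁, hc₄] using h0
        exact het (by simpa [inv_smul_smul₀ hc₂] using smul_mem_ideal c₂⁻¹ hm)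
      have hn' : c₃ • n + c₂ • e ∈ m := m.add_mem (smul_mem_ideal _ hn) (smul_mem_ideal _ he)
      refine Or.inr (Or.inl (D.exists_quartic₂ h2 h3 (e := c₃ • n + c₂ • e) (u := e) (w := t)
        (h.change_of_eq hn' he ht ⟨0, 1, 0, by module⟩ ⟨0, 0, 1, by module⟩
          ⟨c₃⁻¹, -(c₃⁻¹ * c₂), 0, by
            rw [smul_add, inv_smul_smul₀ hc₃]; module⟩) ?_ ?_ hee))
      · convert Ideal.add_mem _ (smul_mem_ideal c₃ hen) (smul_mem_ideal c₂ hee) using 1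
        simp only [Algebra.smul_def]; ring
      · convert hm using 1
        simp only [Algebra.smul_def]; ring
    · have hm' : n * n + (c₄⁻¹ * c₃) • (t * n) + (c₄⁻¹ * c₂) • (e * t) ∈ m ^ 3 := by
        have h1 := smul_mem_ideal c₄⁻¹ hm
        rw [smul_add, inv_smul_smul₀ hc₄] at h1
        convert h1 using 1
        module
      generalize c₄⁻¹ * c₃ = d₃ at *
      generalize c₄⁻¹ * c₂ = d₂ at *
      -- Without a `tn` term the relation is the one of the third type. With it, modulo `m³`, it
      -- factors as `(n + (d₂/d₃)e)(n + d₃t)` since `en ∈ m³`, and the first factor splits off.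
      by_cases hd₃ : d₃ = 0
      · refine Or.inr (Or.inr (D.exists_quartic₃ h2 h3 h hee hen (κ := -d₂) ?_))
        convert hm' using 1
        rw [hd₃]
        module
      · have ht' : n + d₃ • t ∈ m := m.add_mem hn (smul_mem_ideal _ ht)
        have hn' : n + (d₂ / d₃) • e ∈ m := m.add_mem hn (smul_mem_ideal _ he)
        have hd : algebraMap k A (d₂ / d₃) * algebraMap k A d₃ = algebraMap k A d₂ := by
          rw [← map_mul, div_mul_cancel₀ _ hd₃]
        refine Or.inr (Or.inl (D.exists_quartic₂ h2 h3 (e := n + (d₂ / d₃) • e) (u := e)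
          (w := n + d₃ • t) (h.change_of_eq hn' he ht' ⟨0, 1, 0, by module⟩
            ⟨-d₃⁻¹, d₃⁻¹ * (d₂ / d₃), d₃⁻¹, by
              rw [smul_add d₃⁻¹, inv_smul_smul₀ hd₃]; module⟩
            ⟨1, -(d₂ / d₃), 0, by module⟩) ?_ ?_ hee))
        · convert Ideal.add_mem _ hen (smul_mem_ideal (d₂ / d₃) hee) using 1
          simp only [Algebra.smul_def]; ring
        · convert Ideal.add_mem _ hm' (smul_mem_ideal (d₂ / d₃) hen) using 1
          simp only [Algebra.smul_def]
          linear_combination e * t * hd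
  · have hrk' : ∀ v ∈ m, ∃ σ : k, e * v - σ • (e * e) ∈ m ^ 3 := by
      obtain ⟨s, hs⟩ := hrk e he
      have hs0 : s ≠ 0 := by
        rintro rfl
        rw [zero_smul, sub_zero] at hs
        exact hee hs
      intro v hv
      obtain ⟨r, hr⟩ := hrk v hv
      refine ⟨r / s, ?_⟩
      convert Ideal.sub_mem _ hr (smul_mem_ideal (r / s) hs) using 1
      rw [smul_sub, smul_smul, div_mul_cancel₀ _ hs0]
      abel
    obtain ⟨σ₁, hσ₁⟩ := hrk' p h.mem_b
    obtain ⟨σ₂, hσ₂⟩ := hrk' q h.mem_c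
    have hu : p - σ₁ • e ∈ m := m.sub_mem h.mem_b (smul_mem_ideal _ he)
    have hw : q - σ₂ • e ∈ m := m.sub_mem h.mem_c (smul_mem_ideal _ he)
    have h' : IsFrame k m e (p - σ₁ • e) (q - σ₂ • e) :=
      h.change_of_eq he hu hw ⟨1, 0, 0, by module⟩ ⟨σ₁, 1, 0, by module⟩ ⟨σ₂, 0, 1, by module⟩
    have heu : e * (p - σ₁ • e) ∈ m ^ 3 := by rwa [mul_sub, mul_smul_comm]
    have hew : e * (q - σ₂ • e) ∈ m ^ 3 := by rwa [mul_sub, mul_smul_comm]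
    clear hσ₁ hσ₂ h
    generalize p - σ₁ • e = u at *
    generalize q - σ₂ • e = w at *
    have e4 := D.map_pow_four_ne_zero h' heu hew
    obtain ⟨s, α, β, γ, h0, hm⟩ := D.relation _ (mul_mem_sq he he) _ (mul_mem_sq hu hu) _
      (mul_mem_sq hu hw) _ (mul_mem_sq hw hw)
    have hs : s = 0 := by
      have z := D.mul_eq_zero hm he he
      have e1 : s • (e * e * e * e) = 0 := by
        simp only [Algebra.smul_def] at z ⊢
        linear_combination z - algebraMap k A α * D.mul_eq_zero heu he hu -
          algebraMap k A β * D.mul_eq_zero heu he hw - algebraMap k A γ * D.mul_eq_zero hew he hw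
      have := congrArg φ e1
      rw [map_smul, map_zero, smul_eq_mul] at this
      exact (_root_.mul_eq_zero.1 this).resolve_right e4
    rw [hs, zero_smul, zero_add] at hm
    have hlin : ∀ r : k, w - r • u ∈ m := fun r => m.sub_mem hw (smul_mem_ideal _ hu)
    have helin : ∀ r : k, e * (w - r • u) ∈ m ^ 3 := fun r => by
      rw [mul_sub, mul_smul_comm]; exact Ideal.sub_mem _ hew (smul_mem_ideal _ heu)
    by_cases hγ : γ = 0
    · rw [hγ, zero_smul, add_zero] at hm
      by_cases hβ : β = 0
      · have hα : α ≠ 0 := by simpa [hs, hβ, hγ] using h0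
        rw [hβ, zero_smul, add_zero] at hm
        exact Or.inr (Or.inl (D.exists_quartic₂ h2 h3 h' heu hew
          (by simpa [inv_smul_smul₀ hα] using smul_mem_ideal α⁻¹ hm)))
      · have hm' : u * (w - (-(β⁻¹ * α)) • u) ∈ m ^ 3 := by
          have h1 := smul_mem_ideal β⁻¹ hm
          rw [smul_add, inv_smul_smul₀ hβ] at h1
          convert h1 using 1
          simp only [Algebra.smul_def, map_neg, map_mul]
          ring
        exact Or.inl (D.exists_quartic₁ h2 h3 (h'.change_of_eq he hu (hlin (-(β⁻¹ * α)))
          ⟨1, 0, 0, by module⟩ ⟨0, 1, 0, by module⟩ ⟨0, -(β⁻¹ * α), 1, by module⟩) heu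
          (helin _) hm')
    · have hm' : w * w + (γ⁻¹ * β) • (u * w) + (γ⁻¹ * α) • (u * u) ∈ m ^ 3 := by
        have h1 := smul_mem_ideal γ⁻¹ hm
        rw [smul_add, inv_smul_smul₀ hγ] at h1
        convert h1 using 1
        module
      generalize γ⁻¹ * β = β' at *
      generalize γ⁻¹ * α = α' at *
      -- The binary quadratic relation in `u, w` is factored by the quadratic formula: distinct
      -- roots give the first quartic, a double root the second.
      obtain ⟨z, hz⟩ := IsAlgClosed.exists_eq_mul_self (β' ^ 2 - 4 * α')
      set r₁ := (-β' + z) / 2 with hr₁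
      set r₂ := (-β' - z) / 2 with hr₂
      have hsum : r₁ + r₂ = -β' := by rw [hr₁, hr₂]; field_simp; ring
      have hprod : r₁ * r₂ = α' := by
        rw [hr₁, hr₂]; field_simp; linear_combination hz
      clear_value r₁ r₂
      have hfac : (w - r₁ • u) * (w - r₂ • u) ∈ m ^ 3 := by
        convert hm' using 1
        replace hsum := congrArg (algebraMap k A) hsum
        replace hprod := congrArg (algebraMap k A) hprod
        simp only [Algebra.smul_def, map_add, map_mul, map_neg] at hsum hprod ⊢
        linear_combination (-u * w) * hsum + u * u * hprod
      by_cases hr : r₁ = r₂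
      · rw [← hr] at hfac
        exact Or.inr (Or.inl (D.exists_quartic₂ h2 h3 (h'.change_of_eq he (hlin r₁) hu
          ⟨1, 0, 0, by module⟩ ⟨0, 0, 1, by module⟩ ⟨0, 1, r₁, by module⟩) (helin _) heu hfac))
      · have hd := sub_ne_zero.2 hr
        have hu' : u = (r₁ - r₂)⁻¹ • ((w - r₂ • u) - (w - r₁ • u)) := by
          rw [show (w - r₂ • u) - (w - r₁ • u) = (r₁ - r₂) • u by module, inv_smul_smul₀ hd]
        have hframe : IsFrame k m e (w - r₁ • u) (w - r₂ • u) :=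
          h'.change_of_eq he (hlin r₁) (hlin r₂) ⟨1, 0, 0, by module⟩
            ⟨0, -(r₁ - r₂)⁻¹, (r₁ - r₂)⁻¹, by conv_lhs => rw [hu']
                                              module⟩
            ⟨0, 1 - r₁ * (r₁ - r₂)⁻¹, r₁ * (r₁ - r₂)⁻¹, by
              rw [show (0 : k) • e + (1 - r₁ * (r₁ - r₂)⁻¹) • (w - r₁ • u) +
                (r₁ * (r₁ - r₂)⁻¹) • (w - r₂ • u) =
                w - r₁ • u + (r₁ * ((r₁ - r₂)⁻¹ * (r₁ - r₂))) • u by module,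
                inv_mul_cancel₀ hd, mul_one, sub_add_cancel]⟩
        exact Or.inl (D.exists_quartic₁ h2 h3 hframe (helin _) (helin _) hfac)

end IsDualized13331

end QuarticNormalForms

/-! ### Removing low moments by perturbing the frame and the functional -/

section CubicNormalForms

open DPRing

variable {k A : Type*} [Field k] [CommRing A] [Algebra k A] {m : Ideal A}

theorem mul_sub_mul_mem {i j e : ℕ} {x x' y y' : A} (hx : x ∈ m ^ i) (hy' : y' ∈ m ^ j)
    (h₁ : x - x' ∈ m ^ (i + e)) (h₂ : y - y' ∈ m ^ (j + e)) : x * y - x' * y' ∈ m ^ (i + j + e) := by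
  rw [show x * y - x' * y' = x * (y - y') + (x - x') * y' by ring]
  refine Ideal.add_mem _ ?_ ?_
  · rw [add_assoc]; exact mul_mem_pow_add hx h₂
  · rw [add_right_comm]; exact mul_mem_pow_add h₁ hy'

theorem pow_sub_pow_mem {e : ℕ} {x x' : A} (hx : x ∈ m) (hx' : x' ∈ m) (h : x - x' ∈ m ^ (1 + e))
    (n : ℕ) : x ^ n - x' ^ n ∈ m ^ (n + e) := by
  induction n with
  | zero => simp
  | succ n ih =>
    rw [pow_succ, pow_succ]
    exact mul_sub_mul_mem (j := 1) (Ideal.pow_mem_pow hx n) (by simpa using hx') ih h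

/-- Moving the generators by `m ^ (1 + e)` moves a monomial of degree `d` by `m ^ (d + e)`. As `m⁵ =
0`, the case `e = 1` preserves fourth moments and `e = 2` also third moments. -/
theorem monomial_sub_monomial_mem {e : ℕ} {a b c a' b' c' : A} (ha : a ∈ m) (hb : b ∈ m)
    (hc : c ∈ m) (ha' : a' ∈ m) (hb' : b' ∈ m) (hc' : c' ∈ m) (h₁ : a - a' ∈ m ^ (1 + e))
    (h₂ : b - b' ∈ m ^ (1 + e)) (h₃ : c - c' ∈ m ^ (1 + e)) (i j l : ℕ) :
    a ^ i * b ^ j * c ^ l - a' ^ i * b' ^ j * c' ^ l ∈ m ^ (i + j + l + e) :=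
  mul_sub_mul_mem (mul_mem_pow_add (Ideal.pow_mem_pow ha i) (Ideal.pow_mem_pow hb j))
    (Ideal.pow_mem_pow hc' l)
    (mul_sub_mul_mem (Ideal.pow_mem_pow ha i) (Ideal.pow_mem_pow hb' j)
      (pow_sub_pow_mem ha ha' h₁ i) (pow_sub_pow_mem hb hb' h₂ j)) (pow_sub_pow_mem hc hc' h₃ l)

theorem monomial_mem_pow {a b c : A} (ha : a ∈ m) (hb : b ∈ m) (hc : c ∈ m) (i j l : ℕ) :
    a ^ i * b ^ j * c ^ l ∈ m ^ (i + j + l) :=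
  mul_mem_pow_add (mul_mem_pow_add (Ideal.pow_mem_pow ha i) (Ideal.pow_mem_pow hb j))
    (Ideal.pow_mem_pow hc l)

theorem map_monomial_three {φ : A →ₗ[k] k} {a b c : A} {g : ℕ → ℕ → ℕ → k}
    (h300 : φ (a * a * a) = g 3 0 0)
    (h210 : φ (a * a * b) = g 2 1 0)
    (h201 : φ (a * a * c) = g 2 0 1)
    (h120 : φ (a * b * b) = g 1 2 0)
    (h111 : φ (a * b * c) = g 1 1 1)
    (h102 : φ (a * c * c) = g 1 0 2)
    (h030 : φ (b * b * b) = g 0 3 0)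
    (h021 : φ (b * b * c) = g 0 2 1)
    (h012 : φ (b * c * c) = g 0 1 2)
    (h003 : φ (c * c * c) = g 0 0 3) :
    ∀ i j l, i + j + l = 3 → φ (a ^ i * b ^ j * c ^ l) = g i j l := by
  intro i j l h
  have hi : i ≤ 3 := by omega
  have hj : j ≤ 3 := by omega
  obtain rfl : l = 3 - i - j := by omega
  interval_cases i <;> interval_cases j <;> first | omega | skip
  · rw [← h003]; congr 1; ring
  · rw [← h012]; congr 1; ring
  · rw [← h021]; congr 1; ring
  · rw [← h030]; congr 1; ring
  · rw [← h102]; congr 1; ring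
  · rw [← h111]; congr 1; ring
  · rw [← h120]; congr 1; ring
  · rw [← h201]; congr 1; ring
  · rw [← h210]; congr 1; ring
  · rw [← h300]; congr 1; ring

theorem map_monomial_four {φ : A →ₗ[k] k} {a b c : A} {g : ℕ → ℕ → ℕ → k}
    (h400 : φ (a * a * a * a) = g 4 0 0)
    (h310 : φ (a * a * a * b) = g 3 1 0)
    (h301 : φ (a * a * a * c) = g 3 0 1)
    (h220 : φ (a * a * b * b) = g 2 2 0)
    (h211 : φ (a * a * b * c) = g 2 1 1)
    (h202 : φ (a * a * c * c) = g 2 0 2)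
    (h130 : φ (a * b * b * b) = g 1 3 0)
    (h121 : φ (a * b * b * c) = g 1 2 1)
    (h112 : φ (a * b * c * c) = g 1 1 2)
    (h103 : φ (a * c * c * c) = g 1 0 3)
    (h040 : φ (b * b * b * b) = g 0 4 0)
    (h031 : φ (b * b * b * c) = g 0 3 1)
    (h022 : φ (b * b * c * c) = g 0 2 2)
    (h013 : φ (b * c * c * c) = g 0 1 3)
    (h004 : φ (c * c * c * c) = g 0 0 4) :
    ∀ i j l, i + j + l = 4 → φ (a ^ i * b ^ j * c ^ l) = g i j l := by
  intro i j l h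
  have hi : i ≤ 4 := by omega
  have hj : j ≤ 4 := by omega
  obtain rfl : l = 4 - i - j := by omega
  interval_cases i <;> interval_cases j <;> first | omega | skip
  · rw [← h004]; congr 1; ring
  · rw [← h013]; congr 1; ring
  · rw [← h022]; congr 1; ring
  · rw [← h031]; congr 1; ring
  · rw [← h040]; congr 1; ring
  · rw [← h103]; congr 1; ring
  · rw [← h112]; congr 1; ring
  · rw [← h121]; congr 1; ring
  · rw [← h130]; congr 1; ring
  · rw [← h202]; congr 1; ring
  · rw [← h211]; congr 1; ring
  · rw [← h220]; congr 1; ring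
  · rw [← h301]; congr 1; ring
  · rw [← h310]; congr 1; ring
  · rw [← h400]; congr 1; ring

theorem IsQuartic₁.map_monomial {φ : A →ₗ[k] k} {a b c : A} (H : IsQuartic₁ φ a b c) (e : k) :
    ∀ i j l, i + j + l = 4 →
      φ (a ^ i * b ^ j * c ^ l) = coeff (index i j l) (normalForm₁ k e) :=
  map_monomial_four
    (by simpa [coeff_normalForm₁] using H 1 0 0 1 0 0 1 0 0 1 0 0)
    (by simpa [coeff_normalForm₁] using H 1 0 0 1 0 0 1 0 0 0 1 0)
    (by simpa [coeff_normalForm₁] using H 1 0 0 1 0 0 1 0 0 0 0 1)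
    (by simpa [coeff_normalForm₁] using H 1 0 0 1 0 0 0 1 0 0 1 0)
    (by simpa [coeff_normalForm₁] using H 1 0 0 1 0 0 0 1 0 0 0 1)
    (by simpa [coeff_normalForm₁] using H 1 0 0 1 0 0 0 0 1 0 0 1)
    (by simpa [coeff_normalForm₁] using H 1 0 0 0 1 0 0 1 0 0 1 0)
    (by simpa [coeff_normalForm₁] using H 1 0 0 0 1 0 0 1 0 0 0 1)
    (by simpa [coeff_normalForm₁] using H 1 0 0 0 1 0 0 0 1 0 0 1)
    (by simpa [coeff_normalForm₁] using H 1 0 0 0 0 1 0 0 1 0 0 1)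
    (by simpa [coeff_normalForm₁] using H 0 1 0 0 1 0 0 1 0 0 1 0)
    (by simpa [coeff_normalForm₁] using H 0 1 0 0 1 0 0 1 0 0 0 1)
    (by simpa [coeff_normalForm₁] using H 0 1 0 0 1 0 0 0 1 0 0 1)
    (by simpa [coeff_normalForm₁] using H 0 1 0 0 0 1 0 0 1 0 0 1)
    (by simpa [coeff_normalForm₁] using H 0 0 1 0 0 1 0 0 1 0 0 1)

theorem IsQuartic₂.map_monomial {φ : A →ₗ[k] k} {a b c : A} (H : IsQuartic₂ φ a b c) (p q : k) :
    ∀ i j l, i + j + l = 4 →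
      φ (a ^ i * b ^ j * c ^ l) = coeff (index i j l) (normalForm₂ k p q) :=
  map_monomial_four
    (by simpa [coeff_normalForm₂] using H 1 0 0 1 0 0 1 0 0 1 0 0)
    (by simpa [coeff_normalForm₂] using H 1 0 0 1 0 0 1 0 0 0 1 0)
    (by simpa [coeff_normalForm₂] using H 1 0 0 1 0 0 1 0 0 0 0 1)
    (by simpa [coeff_normalForm₂] using H 1 0 0 1 0 0 0 1 0 0 1 0)
    (by simpa [coeff_normalForm₂] using H 1 0 0 1 0 0 0 1 0 0 0 1)
    (by simpa [coeff_normalForm₂] using H 1 0 0 1 0 0 0 0 1 0 0 1)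
    (by simpa [coeff_normalForm₂] using H 1 0 0 0 1 0 0 1 0 0 1 0)
    (by simpa [coeff_normalForm₂] using H 1 0 0 0 1 0 0 1 0 0 0 1)
    (by simpa [coeff_normalForm₂] using H 1 0 0 0 1 0 0 0 1 0 0 1)
    (by simpa [coeff_normalForm₂] using H 1 0 0 0 0 1 0 0 1 0 0 1)
    (by simpa [coeff_normalForm₂] using H 0 1 0 0 1 0 0 1 0 0 1 0)
    (by simpa [coeff_normalForm₂] using H 0 1 0 0 1 0 0 1 0 0 0 1)
    (by simpa [coeff_normalForm₂] using H 0 1 0 0 1 0 0 0 1 0 0 1)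
    (by simpa [coeff_normalForm₂] using H 0 1 0 0 0 1 0 0 1 0 0 1)
    (by simpa [coeff_normalForm₂] using H 0 0 1 0 0 1 0 0 1 0 0 1)

theorem IsQuartic₃.map_monomial {φ : A →ₗ[k] k} {a b c : A} (H : IsQuartic₃ φ a b c) (p q r : k) :
    ∀ i j l, i + j + l = 4 →
      φ (a ^ i * b ^ j * c ^ l) = coeff (index i j l) (normalForm₃ k p q r) :=
  map_monomial_four
    (by simpa [coeff_normalForm₃] using H 1 0 0 1 0 0 1 0 0 1 0 0)
    (by simpa [coeff_normalForm₃] using H 1 0 0 1 0 0 1 0 0 0 1 0)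
    (by simpa [coeff_normalForm₃] using H 1 0 0 1 0 0 1 0 0 0 0 1)
    (by simpa [coeff_normalForm₃] using H 1 0 0 1 0 0 0 1 0 0 1 0)
    (by simpa [coeff_normalForm₃] using H 1 0 0 1 0 0 0 1 0 0 0 1)
    (by simpa [coeff_normalForm₃] using H 1 0 0 1 0 0 0 0 1 0 0 1)
    (by simpa [coeff_normalForm₃] using H 1 0 0 0 1 0 0 1 0 0 1 0)
    (by simpa [coeff_normalForm₃] using H 1 0 0 0 1 0 0 1 0 0 0 1)
    (by simpa [coeff_normalForm₃] using H 1 0 0 0 1 0 0 0 1 0 0 1)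
    (by simpa [coeff_normalForm₃] using H 1 0 0 0 0 1 0 0 1 0 0 1)
    (by simpa [coeff_normalForm₃] using H 0 1 0 0 1 0 0 1 0 0 1 0)
    (by simpa [coeff_normalForm₃] using H 0 1 0 0 1 0 0 1 0 0 0 1)
    (by simpa [coeff_normalForm₃] using H 0 1 0 0 1 0 0 0 1 0 0 1)
    (by simpa [coeff_normalForm₃] using H 0 1 0 0 0 1 0 0 1 0 0 1)
    (by simpa [coeff_normalForm₃] using H 0 0 1 0 0 1 0 0 1 0 0 1)

namespace IsDualFrame

variable {a b c α β γ : A} {φ : A →ₗ[k] k}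

/-- Moments of degree at most two can be removed by a change of the frame and the functional. -/
theorem exists_algEquiv_apolar (h : IsDualFrame m a b c φ) (hd : IsDualCubics m a b c φ α β γ)
    (h2 : (2 : k) ≠ 0) {f : DPRing 3 k} (hf : f ≠ 0)
    (hf5 : ∀ i j l, 5 ≤ i + j + l → coeff (index i j l) f = 0)
    (hf2 : ∀ i j l, i + j + l ≤ 2 → coeff (index i j l) f = 0)
    (H₃ : ∀ i j l, i + j + l = 3 → φ (a ^ i * b ^ j * c ^ l) = coeff (index i j l) f)
    (H₄ : ∀ i j l, i + j + l = 4 → φ (a ^ i * b ^ j * c ^ l) = coeff (index i j l) f) :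
    Nonempty (A ≃ₐ[k] Apolar f) := by
  have := apolar_isLocalRing hf
  have hF := apolar_isDualFrame (f := f) fun d h5 => by
    rw [← index_eq d, degree_index] at h5
    rw [← index_eq d]
    exact hf5 _ _ _ h5
  -- The second moment of `xy` changes by one pairing from each factor; giving each half of `-φ(xy)`
  -- clears it symmetrically.
  obtain ⟨r₁, hr₁, e₁₁, e₁₂, e₁₃⟩ := hd.exists_cubic (-(φ (a * a) / 2)) (-(φ (a * b) / 2))
    (-(φ (a * c) / 2))
  obtain ⟨r₂, hr₂, e₂₁, e₂₂, e₂₃⟩ := hd.exists_cubic (-(φ (a * b) / 2)) (-(φ (b * b) / 2))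
    (-(φ (b * c) / 2))
  obtain ⟨r₃, hr₃, e₃₁, e₃₂, e₃₃⟩ := hd.exists_cubic (-(φ (a * c) / 2)) (-(φ (b * c) / 2))
    (-(φ (c * c) / 2))
  have hm : ∀ {x : A}, x ∈ m ^ 3 → x ∈ m := fun hx => Ideal.pow_le_self (by norm_num) hx
  have hsq : ∀ {x : A}, x ∈ m ^ 3 → x ∈ m ^ 2 := fun hx => Ideal.pow_le_pow_right (by norm_num) hx
  have h' : IsFrame k m (a + r₁) (b + r₂) (c + r₃) :=
    h.change (m.add_mem h.mem_a (hm hr₁)) (m.add_mem h.mem_b (hm hr₂))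
      (m.add_mem h.mem_c (hm hr₃)) ⟨1, 0, 0, by simpa using hsq hr₁⟩
      ⟨0, 1, 0, by simpa using hsq hr₂⟩ ⟨0, 0, 1, by simpa using hsq hr₃⟩
  have hquad : ∀ {x y r s : A}, r ∈ m ^ 3 → s ∈ m ^ 3 →
      φ ((x + r) * (y + s)) = φ (x * y) + φ (y * r) + φ (x * s) := by
    intro x y r s hr hs
    rw [show (x + r) * (y + s) = x * y + y * r + x * s + r * s by ring, map_add, map_add, map_add,
      h.map_mul_eq_zero (by norm_num) hr hs, add_zero]
  have hhigh : ∀ i j l, 3 ≤ i + j + l → φ ((a + r₁) ^ i * (b + r₂) ^ j * (c + r₃) ^ l) =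
      φ (a ^ i * b ^ j * c ^ l) := by
    intro i j l hi
    have := monomial_sub_monomial_mem (e := 2) h'.mem_a h'.mem_b h'.mem_c h.mem_a h.mem_b h.mem_c
      (by simpa using hr₁) (by simpa using hr₂) (by simpa using hr₃) i j l
    rw [← sub_eq_zero, ← map_sub, h.eq_zero_of_mem (by omega) this, map_zero]
  -- The new functional is `φ((1 - u - s) ·)`: `u ∈ m³` cancels the linear moments, `s ∈ m⁴` then
  -- the constant one. Moments of degree at least two are untouched, and `1 - u - s` is a unit.
  obtain ⟨u, hu, u₁, u₂, u₃⟩ := hd.exists_cubic (φ (a + r₁)) (φ (b + r₂)) (φ (c + r₃))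
  have hs : (φ 1 - φ u) • (a * α) ∈ m ^ 4 := by
    rw [mul_comm]; exact smul_mem_ideal _ (mul_mem_pow_succ hd.mem_α h.mem_a)
  have φs : φ ((φ 1 - φ u) • (a * α)) = φ 1 - φ u := by rw [map_smul, hd.aα, smul_eq_mul, mul_one]
  generalize (φ 1 - φ u) • (a * α) = s at hs φs
  have hus : u + s ∈ m ^ 3 := Ideal.add_mem _ hu (Ideal.pow_le_pow_right (by norm_num) hs)
  have hw : IsUnit (1 - (u + s)) := IsNilpotent.isUnit_one_sub
    ⟨2, by rw [pow_two]; exact h.mul_eq_zero (by norm_num) hus hus⟩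
  have hφ2 : ∀ x ∈ m ^ 2, φ ((1 - (u + s)) * x) = φ x := fun x hx => by
    rw [sub_mul, one_mul, map_sub, h.map_mul_eq_zero (i := 3) (j := 2) le_rfl hus hx, sub_zero]
  have hφ1 : ∀ {x r : A}, x ∈ m → r ∈ m ^ 3 → φ (x * u) = φ (x + r) →
      φ ((1 - (u + s)) * (x + r)) = 0 := by
    intro x r hx hr hxu
    rw [show (1 - (u + s)) * (x + r) = (x + r) - x * u - s * x - (u + s) * r by ring, map_sub,
      map_sub, map_sub, hxu, h.map_mul_eq_zero (i := 4) (j := 1) le_rfl hs (by simpa using hx),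
      h.map_mul_eq_zero (by norm_num) hus hr]
    ring
  have h'' : IsDualFrame m (a + r₁) (b + r₂) (c + r₃) (φ ∘ₗ LinearMap.mulLeft k (1 - (u + s))) :=
    { h' with
      nondeg := fun x hx => by
        refine (hw.mul_right_eq_zero).1 (h.nondeg _ fun y => ?_)
        simpa [mul_assoc] using hx y }
  refine algEquiv_of_moments h'' hF fun i j l => ?_
  rw [apolarFunctional_moment, LinearMap.comp_apply, LinearMap.mulLeft_apply]
  have hmem := monomial_mem_pow h'.mem_a h'.mem_b h'.mem_c i j l
  rcases le_or_gt 5 (i + j + l) with h5 | h5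
  · rw [hf5 _ _ _ h5, h.eq_zero_of_mem h5 hmem, mul_zero, map_zero]
  rcases le_or_gt 3 (i + j + l) with hi3 | hi3
  · rw [hφ2 _ (Ideal.pow_le_pow_right (by omega) hmem), hhigh _ _ _ hi3]
    obtain h3 | h4 : i + j + l = 3 ∨ i + j + l = 4 := by omega
    · exact H₃ _ _ _ h3
    · exact H₄ _ _ _ h4
  rw [hf2 _ _ _ (by omega)]
  have hi : i ≤ 2 := by omega
  have hj : j ≤ 2 := by omega
  have hl : l ≤ 2 := by omega
  interval_cases i <;> interval_cases j <;> interval_cases l <;> first | omega | skip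
  · simp [φs]
  · simpa using hφ1 h.mem_c hr₃ u₃
  · rw [hφ2 _ hmem, pow_zero, pow_zero, one_mul, one_mul, pow_two, hquad hr₃ hr₃, e₃₃]
    field_simp; ring
  · simpa using hφ1 h.mem_b hr₂ u₂
  · rw [hφ2 _ hmem, pow_zero, one_mul, pow_one, pow_one, hquad hr₂ hr₃, e₂₃, e₃₂]
    field_simp; ring
  · rw [hφ2 _ hmem, pow_zero, pow_zero, one_mul, mul_one, pow_two, hquad hr₂ hr₂, e₂₂]
    field_simp; ring
  · simpa using hφ1 h.mem_a hr₁ u₁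
  · rw [hφ2 _ hmem, pow_zero, mul_one, pow_one, pow_one, hquad hr₁ hr₃, e₁₃, e₃₁]
    field_simp; ring
  · rw [hφ2 _ hmem, pow_zero, mul_one, pow_one, pow_one, hquad hr₁ hr₂, e₁₂, e₂₁]
    field_simp; ring
  · rw [hφ2 _ hmem, pow_zero, pow_zero, mul_one, mul_one, pow_two, hquad hr₁ hr₁, e₁₁]
    field_simp; ring

/-- Moments of degree at most two are irrelevant, and those of degree three may be computed after
a perturbation of the frame in `m²`. -/
theorem exists_algEquiv_apolar_of_perturb (h : IsDualFrame m a b c φ)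
    (hd : IsDualCubics m a b c φ α β γ) (h2 : (2 : k) ≠ 0) {f : DPRing 3 k} (hf : f ≠ 0)
    (hf5 : ∀ i j l, 5 ≤ i + j + l → coeff (index i j l) f = 0)
    (hf2 : ∀ i j l, i + j + l ≤ 2 → coeff (index i j l) f = 0)
    (H₄ : ∀ i j l, i + j + l = 4 → φ (a ^ i * b ^ j * c ^ l) = coeff (index i j l) f)
    {p q r : A} (hp : p ∈ m ^ 2) (hq : q ∈ m ^ 2) (hr : r ∈ m ^ 2)
    (h300 : φ (a * a * a) + φ (p * a * a) + φ (p * a * a) + φ (p * a * a) =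
      coeff (index 3 0 0) f)
    (h210 : φ (a * a * b) + φ (p * a * b) + φ (p * a * b) + φ (q * a * a) =
      coeff (index 2 1 0) f)
    (h201 : φ (a * a * c) + φ (p * a * c) + φ (p * a * c) + φ (r * a * a) =
      coeff (index 2 0 1) f)
    (h120 : φ (a * b * b) + φ (p * b * b) + φ (q * a * b) + φ (q * a * b) =
      coeff (index 1 2 0) f)
    (h111 : φ (a * b * c) + φ (p * b * c) + φ (q * a * c) + φ (r * a * b) =
      coeff (index 1 1 1) f)
    (h102 : φ (a * c * c) + φ (p * c * c) + φ (r * a * c) + φ (r * a * c) =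
      coeff (index 1 0 2) f)
    (h030 : φ (b * b * b) + φ (q * b * b) + φ (q * b * b) + φ (q * b * b) =
      coeff (index 0 3 0) f)
    (h021 : φ (b * b * c) + φ (q * b * c) + φ (q * b * c) + φ (r * b * b) =
      coeff (index 0 2 1) f)
    (h012 : φ (b * c * c) + φ (q * c * c) + φ (r * b * c) + φ (r * b * c) =
      coeff (index 0 1 2) f)
    (h003 : φ (c * c * c) + φ (r * c * c) + φ (r * c * c) + φ (r * c * c) =
      coeff (index 0 0 3) f) :
    Nonempty (A ≃ₐ[k] Apolar f) := by
  have hm : ∀ {x : A}, x ∈ m ^ 2 → x ∈ m := fun hx => Ideal.pow_le_self (by norm_num) hx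
  have h' : IsFrame k m (a + p) (b + q) (c + r) :=
    h.change (m.add_mem h.mem_a (hm hp)) (m.add_mem h.mem_b (hm hq))
      (m.add_mem h.mem_c (hm hr)) ⟨1, 0, 0, by simpa using hp⟩
      ⟨0, 1, 0, by simpa using hq⟩ ⟨0, 0, 1, by simpa using hr⟩
  have hcub : ∀ {x y z p q r : A}, x ∈ m → y ∈ m → z ∈ m → p ∈ m ^ 2 → q ∈ m ^ 2 → r ∈ m ^ 2 →
      φ ((x + p) * (y + q) * (z + r)) =
        φ (x * y * z) + φ (p * y * z) + φ (q * x * z) + φ (r * x * y) := by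
    intro x y z p q r hx hy hz hp hq hr
    have e₁ := h.mul_eq_zero (i := 4) (j := 1) le_rfl (mul_mem_pow_add hp hq) (by simpa using hz)
    have e₂ := h.mul_eq_zero (i := 4) (j := 1) le_rfl (mul_mem_pow_add hp hr) (by simpa using hy)
    have e₃ := h.mul_eq_zero (i := 4) (j := 1) le_rfl (mul_mem_pow_add hq hr) (by simpa using hx)
    have e₄ := h.mul_eq_zero (i := 4) (j := 2) (by norm_num) (mul_mem_pow_add hp hq) hr
    rw [← map_add, ← map_add, ← map_add]
    congr 1
    linear_combination e₁ + e₂ + e₃ + e₄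
  have hlin : ∀ {x r : A}, x ∈ m → r ∈ m ^ 2 → ∀ y ∈ m ^ 3, φ ((x + r) * y) = φ (x * y) := by
    intro x r _ hr y hy
    rw [add_mul, map_add, h.map_mul_eq_zero (i := 2) (j := 3) le_rfl hr hy, add_zero]
  have hd' : IsDualCubics m (a + p) (b + q) (c + r) φ α β γ :=
    { mem_α := hd.mem_α
      mem_β := hd.mem_β
      mem_γ := hd.mem_γ
      aα := by rw [hlin h.mem_a hp _ hd.mem_α, hd.aα]
      aβ := by rw [hlin h.mem_a hp _ hd.mem_β, hd.aβ]
      aγ := by rw [hlin h.mem_a hp _ hd.mem_γ, hd.aγ]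
      bα := by rw [hlin h.mem_b hq _ hd.mem_α, hd.bα]
      bβ := by rw [hlin h.mem_b hq _ hd.mem_β, hd.bβ]
      bγ := by rw [hlin h.mem_b hq _ hd.mem_γ, hd.bγ]
      cα := by rw [hlin h.mem_c hr _ hd.mem_α, hd.cα]
      cβ := by rw [hlin h.mem_c hr _ hd.mem_β, hd.cβ]
      cγ := by rw [hlin h.mem_c hr _ hd.mem_γ, hd.cγ] }
  refine (show IsDualFrame m (a + p) (b + q) (c + r) φ from ⟨h', h.nondeg⟩).exists_algEquiv_apolar
    hd' h2 hf hf5 hf2 (map_monomial_three (g := fun i j l => coeff (index i j l) f)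
      (by rw [hcub h.mem_a h.mem_a h.mem_a hp hp hp]; exact h300)
      (by rw [hcub h.mem_a h.mem_a h.mem_b hp hp hq]; exact h210)
      (by rw [hcub h.mem_a h.mem_a h.mem_c hp hp hr]; exact h201)
      (by rw [hcub h.mem_a h.mem_b h.mem_b hp hq hq]; exact h120)
      (by rw [hcub h.mem_a h.mem_b h.mem_c hp hq hr]; exact h111)
      (by rw [hcub h.mem_a h.mem_c h.mem_c hp hr hr]; exact h102)
      (by rw [hcub h.mem_b h.mem_b h.mem_b hq hq hq]; exact h030)
      (by rw [hcub h.mem_b h.mem_b h.mem_c hq hq hr]; exact h021)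
      (by rw [hcub h.mem_b h.mem_c h.mem_c hq hr hr]; exact h012)
      (by rw [hcub h.mem_c h.mem_c h.mem_c hr hr hr]; exact h003)) fun i j l hi => ?_
  have := monomial_sub_monomial_mem (e := 1) h'.mem_a h'.mem_b h'.mem_c h.mem_a h.mem_b h.mem_c
    (by simpa using hp) (by simpa using hq) (by simpa using hr) i j l
  rw [← H₄ i j l hi, ← sub_eq_zero, ← map_sub, h.eq_zero_of_mem (by omega) this, map_zero]

end IsDualFrame

end CubicNormalForms

/-! ### Normal forms of the cubic moments -/

section NormalForms

open DPRing

variable {k A : Type*} [Field k] [CommRing A] [Algebra k A] {m : Ideal A}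

theorem normalForm₁_ne_zero (h2 : (2 : k) ≠ 0) (h3 : (3 : k) ≠ 0) (e : k) :
    normalForm₁ k e ≠ 0 := fun h => by
  have h1 := coeff_normalForm₁ e 4 0 0
  rw [h, show coeff (index 4 0 0) (0 : DPRing 3 k) = 0 from rfl] at h1
  exact twentyFour_ne_zero_of h2 h3 (by simpa using h1.symm)

theorem normalForm₂_ne_zero (h2 : (2 : k) ≠ 0) (h3 : (3 : k) ≠ 0) (p q : k) :
    normalForm₂ k p q ≠ 0 := fun h => by
  have h1 := coeff_normalForm₂ p q 3 1 0
  rw [h, show coeff (index 3 1 0) (0 : DPRing 3 k) = 0 from rfl] at h1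
  exact six_ne_zero_of h2 h3 (by simpa using h1.symm)

theorem normalForm₃_ne_zero (h2 : (2 : k) ≠ 0) (h3 : (3 : k) ≠ 0) (p q r : k) :
    normalForm₃ k p q r ≠ 0 := fun h => by
  have h1 := coeff_normalForm₃ p q r 3 1 0
  rw [h, show coeff (index 3 1 0) (0 : DPRing 3 k) = 0 from rfl] at h1
  exact six_ne_zero_of h2 h3 (by simpa using h1.symm)

theorem coeff_normalForm₁_eq_zero (e : k) {i j l : ℕ} (h3 : i + j + l ≠ 3) (h4 : i + j + l ≠ 4) :
    coeff (index i j l) (normalForm₁ k e) = 0 := by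
  rw [coeff_normalForm₁, if_neg (by omega), if_neg (by omega), if_neg (by omega),
    if_neg (by omega)]
  simp

theorem coeff_normalForm₂_eq_zero (p q : k) {i j l : ℕ} (h3 : i + j + l ≠ 3)
    (h4 : i + j + l ≠ 4) : coeff (index i j l) (normalForm₂ k p q) = 0 := by
  rw [coeff_normalForm₂, if_neg (by omega), if_neg (by omega), if_neg (by omega),
    if_neg (by omega)]
  simp

theorem coeff_normalForm₃_eq_zero (p q r : k) {i j l : ℕ} (h3 : i + j + l ≠ 3)
    (h4 : i + j + l ≠ 4) : coeff (index i j l) (normalForm₃ k p q r) = 0 := by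
  rw [coeff_normalForm₃, if_neg (by omega), if_neg (by omega), if_neg (by omega),
    if_neg (by omega), if_neg (by omega)]
  simp

namespace IsDualFrame

variable {a b c : A} {φ : A →ₗ[k] k}

/-- An element of `m²` can have arbitrary pairings with products of two generators, subject to the
relations forced by the apolar quadrics; here these kill the mixed products. -/
theorem exists_quadric₁ (h : IsDualFrame m a b c φ) (H : IsQuartic₁ φ a b c) (h2 : (2 : k) ≠ 0)
    (h3 : (3 : k) ≠ 0) (s t u : k) : ∃ q ∈ m ^ 2, φ (q * a * a) = s ∧ φ (q * a * b) = 0 ∧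
      φ (q * a * c) = 0 ∧ φ (q * b * b) = t ∧ φ (q * b * c) = 0 ∧ φ (q * c * c) = u := by
  have h24 := twentyFour_ne_zero_of h2 h3
  have key : ∀ x₁ y₁ z₁ x₂ y₂ z₂ : k, φ (((s / 24) • (a * a) + (t / 24) • (b * b) +
      (u / 24) • (c * c)) * (x₁ • a + y₁ • b + z₁ • c) * (x₂ • a + y₂ • b + z₂ • c)) =
      s * (x₁ * x₂) + t * (y₁ * y₂) + u * (z₁ * z₂) := by
    intro x₁ y₁ z₁ x₂ y₂ z₂
    have e₁ := H 1 0 0 1 0 0 x₁ y₁ z₁ x₂ y₂ z₂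
    have e₂ := H 0 1 0 0 1 0 x₁ y₁ z₁ x₂ y₂ z₂
    have e₃ := H 0 0 1 0 0 1 x₁ y₁ z₁ x₂ y₂ z₂
    generalize x₁ • a + y₁ • b + z₁ • c = v at *
    generalize x₂ • a + y₂ • b + z₂ • c = w at *
    simp only [one_smul, zero_smul, add_zero, zero_add] at e₁ e₂ e₃
    simp only [add_mul, smul_mul_assoc, map_add, map_smul, smul_eq_mul, e₁, e₂, e₃]
    field_simp
    ring
  refine ⟨_, lin_mem (mul_mem_sq h.mem_a h.mem_a) (mul_mem_sq h.mem_b h.mem_b)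
    (mul_mem_sq h.mem_c h.mem_c) (s / 24) (t / 24) (u / 24), ?_, ?_, ?_, ?_, ?_, ?_⟩
  · simpa using key 1 0 0 1 0 0
  · simpa using key 1 0 0 0 1 0
  · simpa using key 1 0 0 0 0 1
  · simpa using key 0 1 0 0 1 0
  · simpa using key 0 1 0 0 0 1
  · simpa using key 0 0 1 0 0 1

theorem exists_quadric₂ (h : IsDualFrame m a b c φ) (H : IsQuartic₂ φ a b c) (h2 : (2 : k) ≠ 0)
    (h3 : (3 : k) ≠ 0) (s t u : k) : ∃ q ∈ m ^ 2, φ (q * a * a) = s ∧ φ (q * a * b) = t ∧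
      φ (q * a * c) = 0 ∧ φ (q * b * b) = 0 ∧ φ (q * b * c) = 0 ∧ φ (q * c * c) = u := by
  have h24 := twentyFour_ne_zero_of h2 h3
  have h6 := six_ne_zero_of h2 h3
  have key : ∀ x₁ y₁ z₁ x₂ y₂ z₂ : k, φ (((t / 6) • (a * a) + (s / 6) • (a * b) +
      (u / 24) • (c * c)) * (x₁ • a + y₁ • b + z₁ • c) * (x₂ • a + y₂ • b + z₂ • c)) =
      s * (x₁ * x₂) + t * (x₁ * y₂ + y₁ * x₂) + u * (z₁ * z₂) := by
    intro x₁ y₁ z₁ x₂ y₂ z₂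
    have e₁ := H 1 0 0 1 0 0 x₁ y₁ z₁ x₂ y₂ z₂
    have e₂ := H 1 0 0 0 1 0 x₁ y₁ z₁ x₂ y₂ z₂
    have e₃ := H 0 0 1 0 0 1 x₁ y₁ z₁ x₂ y₂ z₂
    generalize x₁ • a + y₁ • b + z₁ • c = v at *
    generalize x₂ • a + y₂ • b + z₂ • c = w at *
    simp only [one_smul, zero_smul, add_zero, zero_add] at e₁ e₂ e₃
    simp only [add_mul, smul_mul_assoc, map_add, map_smul, smul_eq_mul, e₁, e₂, e₃]
    field_simp
    ring
  refine ⟨_, lin_mem (mul_mem_sq h.mem_a h.mem_a) (mul_mem_sq h.mem_a h.mem_b)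
    (mul_mem_sq h.mem_c h.mem_c) (t / 6) (s / 6) (u / 24), ?_, ?_, ?_, ?_, ?_, ?_⟩
  · simpa using key 1 0 0 1 0 0
  · simpa using key 1 0 0 0 1 0
  · simpa using key 1 0 0 0 0 1
  · simpa using key 0 1 0 0 1 0
  · simpa using key 0 1 0 0 0 1
  · simpa using key 0 0 1 0 0 1

/-- The value `2t/3` on `c²` is forced by the apolar quadric `3c² - 2ab`. -/
theorem exists_quadric₃ (h : IsDualFrame m a b c φ) (H : IsQuartic₃ φ a b c) (h2 : (2 : k) ≠ 0)
    (h3 : (3 : k) ≠ 0) (s t u : k) : ∃ q ∈ m ^ 2, φ (q * a * a) = s ∧ φ (q * a * b) = t ∧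
      φ (q * a * c) = u ∧ φ (q * b * b) = 0 ∧ φ (q * b * c) = 0 ∧ φ (q * c * c) = 2 / 3 * t := by
  have h4 := four_ne_zero_of h2
  have h6 := six_ne_zero_of h2 h3
  have key : ∀ x₁ y₁ z₁ x₂ y₂ z₂ : k, φ (((t / 6) • (a * a) + (s / 6) • (a * b) +
      (u / 4) • (a * c)) * (x₁ • a + y₁ • b + z₁ • c) * (x₂ • a + y₂ • b + z₂ • c)) =
      s * (x₁ * x₂) + t * (x₁ * y₂ + y₁ * x₂) + u * (x₁ * z₂ + z₁ * x₂) + 2 / 3 * t * (z₁ * z₂) := by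
    intro x₁ y₁ z₁ x₂ y₂ z₂
    have e₁ := H 1 0 0 1 0 0 x₁ y₁ z₁ x₂ y₂ z₂
    have e₂ := H 1 0 0 0 1 0 x₁ y₁ z₁ x₂ y₂ z₂
    have e₃ := H 1 0 0 0 0 1 x₁ y₁ z₁ x₂ y₂ z₂
    generalize x₁ • a + y₁ • b + z₁ • c = v at *
    generalize x₂ • a + y₂ • b + z₂ • c = w at *
    simp only [one_smul, zero_smul, add_zero, zero_add] at e₁ e₂ e₃
    simp only [add_mul, smul_mul_assoc, map_add, map_smul, smul_eq_mul, e₁, e₂, e₃]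
    field_simp
    ring
  refine ⟨_, lin_mem (mul_mem_sq h.mem_a h.mem_a) (mul_mem_sq h.mem_a h.mem_b)
    (mul_mem_sq h.mem_a h.mem_c) (t / 6) (s / 6) (u / 4), ?_, ?_, ?_, ?_, ?_, ?_⟩
  · simpa using key 1 0 0 1 0 0
  · simpa using key 1 0 0 0 1 0
  · simpa using key 1 0 0 0 0 1
  · simpa using key 0 1 0 0 1 0
  · simpa using key 0 1 0 0 0 1
  · simpa using key 0 0 1 0 0 1

theorem algEquiv_normalForm₁ (h : IsDualFrame m a b c φ) (H : IsQuartic₁ φ a b c)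
    (h2 : (2 : k) ≠ 0) (h3 : (3 : k) ≠ 0) {e : k} (he : φ (a * b * c) = e) :
    Nonempty (A ≃ₐ[k] Apolar (normalForm₁ k e)) := by
  obtain ⟨p, hp, p₁, p₂, p₃, p₄, p₅, p₆⟩ := h.exists_quadric₁ H h2 h3 (-(φ (a * a * a) / 3))
    (-φ (a * b * b)) (-φ (a * c * c))
  obtain ⟨q, hq, q₁, q₂, q₃, q₄, q₅, q₆⟩ := h.exists_quadric₁ H h2 h3 (-φ (a * a * b))
    (-(φ (b * b * b) / 3)) (-φ (b * c * c))
  obtain ⟨r, hr, r₁, r₂, r₃, r₄, r₅, r₆⟩ := h.exists_quadric₁ H h2 h3 (-φ (a * a * c))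
    (-φ (b * b * c)) (-(φ (c * c * c) / 3))
  refine h.exists_algEquiv_apolar_of_perturb (h.dualCubics₁ H h2 h3) h2
    (normalForm₁_ne_zero h2 h3 e)
    (fun _ _ _ _ => coeff_normalForm₁_eq_zero e (by omega) (by omega))
    (fun _ _ _ _ => coeff_normalForm₁_eq_zero e (by omega) (by omega)) (H.map_monomial e)
    hp hq hr ?_ ?_ ?_ ?_ ?_ ?_ ?_ ?_ ?_ ?_ <;>
  · simp only [coeff_normalForm₁, p₁, p₂, p₃, p₄, p₅, p₆, q₁, q₂, q₃, q₄, q₅, q₆, r₁, r₂, r₃, r₄,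
      r₅, r₆, he]
    norm_num
    try field_simp
    try ring

theorem algEquiv_normalForm₂ (h : IsDualFrame m a b c φ) (H : IsQuartic₂ φ a b c)
    (h2 : (2 : k) ≠ 0) (h3 : (3 : k) ≠ 0) {s t : k} (hs : φ (b * b * b) = s * 6)
    (ht : φ (b * b * c) = t * 2) : Nonempty (A ≃ₐ[k] Apolar (normalForm₂ k s t)) := by
  -- The pairing of `p` with `ab` could only help with `a²b`, which `q` already clears; hence the 0.
  obtain ⟨p, hp, p₁, p₂, p₃, p₄, p₅, p₆⟩ := h.exists_quadric₂ H h2 h3 (-(φ (a * a * a) / 3))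
    0 (-φ (a * c * c))
  obtain ⟨q, hq, q₁, q₂, q₃, q₄, q₅, q₆⟩ := h.exists_quadric₂ H h2 h3 (-φ (a * a * b))
    (-(φ (a * b * b) / 2)) (-φ (b * c * c))
  obtain ⟨r, hr, r₁, r₂, r₃, r₄, r₅, r₆⟩ := h.exists_quadric₂ H h2 h3 (-φ (a * a * c))
    (-φ (a * b * c)) (-(φ (c * c * c) / 3))
  refine h.exists_algEquiv_apolar_of_perturb (h.dualCubics₂ H h2 h3) h2
    (normalForm₂_ne_zero h2 h3 s t)
    (fun _ _ _ _ => coeff_normalForm₂_eq_zero s t (by omega) (by omega))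
    (fun _ _ _ _ => coeff_normalForm₂_eq_zero s t (by omega) (by omega)) (H.map_monomial s t)
    hp hq hr ?_ ?_ ?_ ?_ ?_ ?_ ?_ ?_ ?_ ?_ <;>
  · simp only [coeff_normalForm₂, p₁, p₂, p₃, p₄, p₅, p₆, q₁, q₂, q₃, q₄, q₅, q₆, r₁, r₂, r₃, r₄,
      r₅, r₆, hs, ht]
    norm_num
    try field_simp
    try ring

/-- Clearing `ab²` requires `φ(qab) = -φ(ab²)/2`, which forces `φ(qc²) = -φ(ab²)/3`. So `yz²` keeps
the coefficient `φ(bc²) - φ(ab²)/3 = 2u`, and only this combination is meaningful. -/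
theorem algEquiv_normalForm₃ (h : IsDualFrame m a b c φ) (H : IsQuartic₃ φ a b c)
    (h2 : (2 : k) ≠ 0) (h3 : (3 : k) ≠ 0) {s t u : k} (hs : φ (b * b * b) = s * 6)
    (ht : φ (b * b * c) = t * 2) (hu : φ (a * b * b) = 3 * φ (b * c * c) - 6 * u) :
    Nonempty (A ≃ₐ[k] Apolar (normalForm₃ k s t u)) := by
  obtain ⟨p, hp, p₁, p₂, p₃, p₄, p₅, p₆⟩ := h.exists_quadric₃ H h2 h3 (-(φ (a * a * a) / 3)) 0 0
  -- Clearing `c³` through `φ(rc²)` forces `φ(rab) = -φ(c³)/2`, which disturbs `abc`; the summand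
  -- `φ(c³)/2` in `q` compensates.
  obtain ⟨q, hq, q₁, q₂, q₃, q₄, q₅, q₆⟩ := h.exists_quadric₃ H h2 h3 (-φ (a * a * b))
    (-(φ (a * b * b) / 2)) (-φ (a * b * c) + φ (c * c * c) / 2)
  obtain ⟨r, hr, r₁, r₂, r₃, r₄, r₅, r₆⟩ := h.exists_quadric₃ H h2 h3 (-φ (a * a * c))
    (-(φ (c * c * c) / 2)) (-(φ (a * c * c) / 2))
  refine h.exists_algEquiv_apolar_of_perturb (h.dualCubics₃ H h2 h3) h2
    (normalForm₃_ne_zero h2 h3 s t u)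
    (fun _ _ _ _ => coeff_normalForm₃_eq_zero s t u (by omega) (by omega))
    (fun _ _ _ _ => coeff_normalForm₃_eq_zero s t u (by omega) (by omega)) (H.map_monomial s t u)
    hp hq hr ?_ ?_ ?_ ?_ ?_ ?_ ?_ ?_ ?_ ?_ <;>
  · simp only [coeff_normalForm₃, p₁, p₂, p₃, p₄, p₅, p₆, q₁, q₂, q₃, q₄, q₅, q₆, r₁, r₂, r₃, r₄,
      r₅, r₆, hs, ht, hu]
    norm_num
    try field_simp
    try ring

end IsDualFrame

end NormalForms

/-! ### Scalings and the shear -/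

section Scaling

open DPRing

variable {k A : Type*} [Field k] [CommRing A] [Algebra k A] {m : Ideal A} {a b c : A}
  {φ : A →ₗ[k] k}

theorem IsQuartic₁.smul (H : IsQuartic₁ φ a b c) {s : k} (hs : s ≠ 0) :
    IsQuartic₁ ((s ^ 4)⁻¹ • φ) (s • a) (s • b) (s • c) := by
  unfold IsQuartic₁ at H
  intro x₁ y₁ z₁ x₂ y₂ z₂ x₃ y₃ z₃ x₄ y₄ z₄
  simp only [smul_smul, LinearMap.smul_apply, H, smul_eq_mul]
  rw [inv_mul_eq_iff_eq_mul₀ (pow_ne_zero 4 hs)]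
  ring

theorem IsQuartic₂.smul (H : IsQuartic₂ φ a b c) {s t u d : k} (hd : d ≠ 0)
    (h₁ : s ^ 3 * t = d) (h₂ : u ^ 4 = d) : IsQuartic₂ (d⁻¹ • φ) (s • a) (t • b) (u • c) := by
  unfold IsQuartic₂ at H
  intro x₁ y₁ z₁ x₂ y₂ z₂ x₃ y₃ z₃ x₄ y₄ z₄
  simp only [smul_smul, LinearMap.smul_apply, H, smul_eq_mul]
  rw [inv_mul_eq_iff_eq_mul₀ hd]
  linear_combination
    6 * (x₁ * x₂ * x₃ * y₄ + x₁ * x₂ * y₃ * x₄ + x₁ * y₂ * x₃ * x₄ + y₁ * x₂ * x₃ * x₄) * h₁ +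
      24 * (z₁ * z₂ * z₃ * z₄) * h₂

theorem IsQuartic₃.smul (H : IsQuartic₃ φ a b c) {s t u d : k} (hd : d ≠ 0)
    (h₁ : s ^ 3 * t = d) (h₂ : s ^ 2 * u ^ 2 = d) :
    IsQuartic₃ (d⁻¹ • φ) (s • a) (t • b) (u • c) := by
  unfold IsQuartic₃ at H
  intro x₁ y₁ z₁ x₂ y₂ z₂ x₃ y₃ z₃ x₄ y₄ z₄
  simp only [smul_smul, LinearMap.smul_apply, H, smul_eq_mul]
  rw [inv_mul_eq_iff_eq_mul₀ hd]
  linear_combination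
    6 * (x₁ * x₂ * x₃ * y₄ + x₁ * x₂ * y₃ * x₄ + x₁ * y₂ * x₃ * x₄ + y₁ * x₂ * x₃ * x₄) * h₁ +
      4 * (x₁ * x₂ * z₃ * z₄ + x₁ * z₂ * x₃ * z₄ + x₁ * z₂ * z₃ * x₄ + z₁ * x₂ * x₃ * z₄ +
        z₁ * x₂ * z₃ * x₄ + z₁ * z₂ * x₃ * x₄) * h₂

/-- The quartic `x³y + x²z²` is invariant under `y ↦ y - 2τz - τ²x`, `z ↦ z + τx`. -/
theorem IsQuartic₃.shear (H : IsQuartic₃ φ a b c) (τ : k) :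
    IsQuartic₃ φ (a - τ ^ 2 • b + τ • c) b (c - (2 * τ) • b) := by
  unfold IsQuartic₃ at H
  intro x₁ y₁ z₁ x₂ y₂ z₂ x₃ y₃ z₃ x₄ y₄ z₄
  have e : ∀ x y z : k, x • (a - τ ^ 2 • b + τ • c) + y • b + z • (c - (2 * τ) • b) =
      x • a + (y - 2 * τ * z - τ ^ 2 * x) • b + (z + τ * x) • c := fun x y z => by module
  simp only [e, H]
  ring

namespace IsDualFrame

theorem smul (h : IsDualFrame m a b c φ) {s t u d : k} (hs : s ≠ 0) (ht : t ≠ 0) (hu : u ≠ 0)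
    (hd : d ≠ 0) : IsDualFrame m (s • a) (t • b) (u • c) (d⁻¹ • φ) :=
  { h.toIsFrame.smul hs ht hu with
    nondeg := fun x hx => h.nondeg x fun y => by
      simpa [hd] using hx y }

theorem shear (h : IsDualFrame m a b c φ) (τ : k) :
    IsDualFrame m (a - τ ^ 2 • b + τ • c) b (c - (2 * τ) • b) φ :=
  { h.toIsFrame.change_of_eq (m.add_mem (m.sub_mem h.mem_a (smul_mem_ideal _ h.mem_b))
      (smul_mem_ideal _ h.mem_c)) h.mem_b (m.sub_mem h.mem_c (smul_mem_ideal _ h.mem_b))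
      ⟨1, -τ ^ 2, -τ, by module⟩ ⟨0, 1, 0, by module⟩ ⟨0, 2 * τ, 1, by module⟩ with
    nondeg := h.nondeg }

theorem exists_algEquiv_normalForm₁ (h : IsDualFrame m a b c φ) (H : IsQuartic₁ φ a b c)
    (h2 : (2 : k) ≠ 0) (h3 : (3 : k) ≠ 0) :
    ∃ e : k, (e = 0 ∨ e = 1) ∧ Nonempty (A ≃ₐ[k] Apolar (normalForm₁ k e)) := by
  by_cases he : φ (a * b * c) = 0
  · exact ⟨0, Or.inl rfl, h.algEquiv_normalForm₁ H h2 h3 he⟩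
  -- Scaling the frame by `s` and `φ` by `s⁻⁴` divides the moment of `abc` by `s`, so `s` is taken
  -- to be that moment.
  · refine ⟨1, Or.inr rfl, (h.smul he he he (pow_ne_zero 4 he)).algEquiv_normalForm₁
      (H.smul he) h2 h3 ?_⟩
    simp only [smul_mul_assoc, mul_smul_comm, map_smul, smul_eq_mul, LinearMap.smul_apply]
    field_simp

theorem exists_algEquiv_normalForm₂ [IsAlgClosed k] (h : IsDualFrame m a b c φ)
    (H : IsQuartic₂ φ a b c) (h2 : (2 : k) ≠ 0) (h3 : (3 : k) ≠ 0) :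
    ∃ p q : k, (p = 0 ∨ p = 1) ∧ (q = 0 ∨ q = 1) ∧
      Nonempty (A ≃ₐ[k] Apolar (normalForm₂ k p q)) := by
  have key : ∀ x : k, ∃ e w : k, (e = 0 ∨ e = 1) ∧ w ≠ 0 ∧ x = e * w := fun x => by
    by_cases hx : x = 0
    · exact ⟨0, 1, Or.inl rfl, one_ne_zero, by rw [hx, zero_mul]⟩
    · exact ⟨1, x, Or.inr rfl, hx, (one_mul x).symm⟩
  obtain ⟨p, v, hp, hv, ep⟩ := key (φ (b * b * b) / 6)
  obtain ⟨q, w, hq, hw, eq⟩ := key (φ (b * b * c) / 2)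
  rw [div_eq_iff (six_ne_zero_of h2 h3)] at ep
  rw [div_eq_iff h2] at eq
  -- With weights `t` for `b` and `u` for `c`, and `φ` divided by `u⁴`, one needs `t³v = u⁴` and
  -- `t²uw = u⁴`. These are solved by `t = w⁴/v³` and `u = w³/v²`; then `s` is a root of `s³t = u⁴`.
  have ht : w ^ 4 / v ^ 3 ≠ 0 := div_ne_zero (pow_ne_zero _ hw) (pow_ne_zero _ hv)
  have hu : w ^ 3 / v ^ 2 ≠ 0 := div_ne_zero (pow_ne_zero _ hw) (pow_ne_zero _ hv)
  obtain ⟨s, hs⟩ := IsAlgClosed.exists_pow_nat_eq ((w ^ 3 / v ^ 2) ^ 4 / (w ^ 4 / v ^ 3))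
    (by norm_num : 0 < 3)
  have hs0 : s ≠ 0 := by
    rintro rfl
    exact div_ne_zero (pow_ne_zero 4 hu) ht (by rw [← hs]; simp)
  refine ⟨p, q, hp, hq, (h.smul hs0 ht hu (pow_ne_zero 4 hu)).algEquiv_normalForm₂
    (H.smul (pow_ne_zero 4 hu) (by rw [hs, div_mul_cancel₀ _ ht]) rfl) h2 h3 ?_ ?_⟩
  · simp only [smul_mul_assoc, mul_smul_comm, map_smul, smul_eq_mul, LinearMap.smul_apply, ep]
    field_simp
  · simp only [smul_mul_assoc, mul_smul_comm, map_smul, smul_eq_mul, LinearMap.smul_apply, eq]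
    field_simp

/-- Preserving `x³y + x²z²` up to a common factor requires `s³t = s²u²`, so the weight of `b` must
be `u²/s` and two parameters remain. -/
theorem algEquiv_normalForm₃_of_scaling (h : IsDualFrame m a b c φ) (H : IsQuartic₃ φ a b c)
    (h2 : (2 : k) ≠ 0) (h3 : (3 : k) ≠ 0) {p q r s u : k} (hs : s ≠ 0) (hu : u ≠ 0)
    (hp : φ (b * b * b) * u ^ 4 = p * 6 * s ^ 5) (hq : φ (b * b * c) * u ^ 3 = q * 2 * s ^ 4)
    (hr : (φ (a * b * b) - 3 * φ (b * c * c)) * u ^ 2 = -6 * r * s ^ 3) :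
    Nonempty (A ≃ₐ[k] Apolar (normalForm₃ k p q r)) := by
  have hd : s ^ 2 * u ^ 2 ≠ 0 := mul_ne_zero (pow_ne_zero _ hs) (pow_ne_zero _ hu)
  refine (h.smul hs (div_ne_zero (pow_ne_zero 2 hu) hs) hu hd).algEquiv_normalForm₃
    (H.smul hd (by field_simp) rfl) h2 h3 ?_ ?_ ?_
  · simp only [smul_mul_assoc, mul_smul_comm, map_smul, smul_eq_mul, LinearMap.smul_apply]
    field_simp
    linear_combination hp
  · simp only [smul_mul_assoc, mul_smul_comm, map_smul, smul_eq_mul, LinearMap.smul_apply]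
    field_simp
    linear_combination hq
  · simp only [smul_mul_assoc, mul_smul_comm, map_smul, smul_eq_mul, LinearMap.smul_apply]
    field_simp
    linear_combination hr

theorem exists_algEquiv_normalForm₃ [IsAlgClosed k] (h : IsDualFrame m a b c φ)
    (H : IsQuartic₃ φ a b c) (h2 : (2 : k) ≠ 0) (h3 : (3 : k) ≠ 0) (h13 : (13 : k) ≠ 0) :
    ∃ p q r : k, ((p = 1 ∧ q = 0 ∧ r = 0) ∨ (p = 1 ∧ q = 0 ∧ r = 1) ∨ (p = 0 ∧ q = 1 ∧ r = 0) ∨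
      (p = 0 ∧ q = 0 ∧ r = 1) ∨ (p = 0 ∧ q = 0 ∧ r = 0)) ∧
      Nonempty (A ≃ₐ[k] Apolar (normalForm₃ k p q r)) := by
  have h6 := six_ne_zero_of h2 h3
  by_cases hp : φ (b * b * b) = 0
  · by_cases hq : φ (b * b * c) = 0
    · by_cases hr : φ (a * b * b) - 3 * φ (b * c * c) = 0
      · exact ⟨0, 0, 0, by simp, h.algEquiv_normalForm₃_of_scaling H h2 h3 (s := 1) (u := 1)
          one_ne_zero one_ne_zero (by rw [hp]; ring) (by rw [hq]; ring) (by rw [hr]; ring)⟩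
      · obtain ⟨x, hx⟩ : ∃ x, φ (a * b * b) - 3 * φ (b * c * c) = -6 * x :=
          ⟨(φ (a * b * b) - 3 * φ (b * c * c)) / -6, by field_simp⟩
        have hx0 : x ≠ 0 := by rintro rfl; exact hr (by rw [hx, mul_zero])
        exact ⟨0, 0, 1, by simp, h.algEquiv_normalForm₃_of_scaling H h2 h3 hx0 hx0
          (by rw [hp]; ring) (by rw [hq]; ring) (by rw [hx]; ring)⟩
    · obtain ⟨x, hx⟩ : ∃ x, φ (b * b * c) = x * 2 := ⟨_, (div_mul_cancel₀ _ h2).symm⟩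
      have hx0 : x ≠ 0 := by rintro rfl; exact hq (by rw [hx, zero_mul])
      -- The shear adds `τ b²c` to `ab²` and, as `b³` has moment 0, `12τ b²c` through `-3bc²`. The
      -- total is `13τφ(b²c) = 26τx`, so 13 has to be invertible.
      obtain ⟨τ, hτ⟩ : ∃ τ, φ (a * b * b) - 3 * φ (b * c * c) + 26 * τ * x = 0 :=
        ⟨-(φ (a * b * b) - 3 * φ (b * c * c)) / (13 * (x * 2)), by field_simp; ring⟩
      refine ⟨0, 1, 0, by simp, (h.shear τ).algEquiv_normalForm₃_of_scaling (H.shear τ) h2 h3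
        hx0 hx0 (by rw [hp]; ring) ?_ ?_⟩
      · rw [mul_sub, mul_smul_comm, map_sub, map_smul, hp, hx, smul_zero]; ring
      · have e₁ : (a - τ ^ 2 • b + τ • c) * b * b =
            a * b * b - τ ^ 2 • (b * b * b) + τ • (b * b * c) := by
          simp only [Algebra.smul_def]; ring
        have e₂ : b * (c - (2 * τ) • b) * (c - (2 * τ) • b) =
            b * c * c - (4 * τ) • (b * b * c) + (4 * τ ^ 2) • (b * b * b) := by
          simp only [Algebra.smul_def, map_mul, map_pow, map_ofNat]; ring
        rw [e₁, e₂]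
        simp only [map_add, map_sub, map_smul, hp, hx, smul_eq_mul]
        linear_combination x ^ 2 * hτ
  · obtain ⟨x, hx⟩ : ∃ x, φ (b * b * b) = x * 6 := ⟨_, (div_mul_cancel₀ _ h6).symm⟩
    have hx0 : x ≠ 0 := by rintro rfl; exact hp (by rw [hx, zero_mul])
    obtain ⟨τ, hτ⟩ : ∃ τ, φ (b * b * c) - 2 * τ * (x * 6) = 0 :=
      ⟨φ (b * b * c) / (2 * (x * 6)), by field_simp; ring⟩
    have h' := h.shear τ
    have H' := H.shear τ
    have hq' : φ (b * b * (c - (2 * τ) • b)) = 0 := by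
      rw [mul_sub, mul_smul_comm, map_sub, map_smul, hx, smul_eq_mul]; exact hτ
    generalize a - τ ^ 2 • b + τ • c = a' at *
    generalize c - (2 * τ) • b = c' at *
    obtain ⟨y, hy⟩ : ∃ y, φ (a' * b * b) - 3 * φ (b * c' * c') = -6 * y :=
      ⟨(φ (a' * b * b) - 3 * φ (b * c' * c')) / -6, by field_simp⟩
    by_cases hy0 : y = 0
    · exact ⟨1, 0, 0, by simp, h'.algEquiv_normalForm₃_of_scaling H' h2 h3 hx0 hx0
        (by rw [hx]; ring) (by rw [hq']; ring) (by rw [hy, hy0]; ring)⟩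
    -- The conditions are `x u⁴ = s⁵` and `y u² = s³`. Putting `u = sv` turns them into `s = x v⁴`
    -- and `s = y v²`, which agree when `v² = y/x`.
    · obtain ⟨v, hv⟩ := IsAlgClosed.exists_pow_nat_eq (y / x) (by norm_num : 0 < 2)
      rw [eq_div_iff hx0] at hv
      have hv0 : v ≠ 0 := by
        rintro rfl
        exact hy0 (by rw [← hv]; ring)
      have hs : y * v ^ 2 ≠ 0 := mul_ne_zero hy0 (pow_ne_zero 2 hv0)
      refine ⟨1, 0, 1, by simp, h'.algEquiv_normalForm₃_of_scaling H' h2 h3 hs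
        (mul_ne_zero hs hv0) ?_ (by rw [hq']; ring) ?_⟩
      · rw [hx]; linear_combination 6 * (y * v ^ 2) ^ 4 * v ^ 2 * hv
      · rw [hy]; ring

end IsDualFrame

end Scaling

/-! ### The eleven types and their separation -/

section Realizations

open DPRing

variable {k A A' : Type*} [Field k] [CommRing A] [Algebra k A] [CommRing A'] [Algebra k A']

theorem IsQuartic₁.of_normalForm {φ : A →ₗ[k] k} {a b c : A} {e : k}
    (M : ∀ i j l, φ (a ^ i * b ^ j * c ^ l) = coeff (index i j l) (normalForm₁ k e)) :
    IsQuartic₁ φ a b c :=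
  .of_moments
    (by simpa [coeff_normalForm₁] using M 4 0 0)
    (by simpa [coeff_normalForm₁] using M 3 1 0)
    (by simpa [coeff_normalForm₁] using M 3 0 1)
    (by simpa [coeff_normalForm₁] using M 2 2 0)
    (by simpa [coeff_normalForm₁] using M 2 1 1)
    (by simpa [coeff_normalForm₁] using M 2 0 2)
    (by simpa [coeff_normalForm₁] using M 1 3 0)
    (by simpa [coeff_normalForm₁] using M 1 2 1)
    (by simpa [coeff_normalForm₁] using M 1 1 2)
    (by simpa [coeff_normalForm₁] using M 1 0 3)
    (by simpa [coeff_normalForm₁] using M 0 4 0)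
    (by simpa [coeff_normalForm₁] using M 0 3 1)
    (by simpa [coeff_normalForm₁] using M 0 2 2)
    (by simpa [coeff_normalForm₁] using M 0 1 3)
    (by simpa [coeff_normalForm₁] using M 0 0 4)

theorem IsQuartic₁.map {φ : A →ₗ[k] k} {a b c : A} (H : IsQuartic₁ φ a b c) (e : A ≃ₐ[k] A') :
    IsQuartic₁ (φ ∘ₗ e.symm.toLinearMap) (e a) (e b) (e c) := by
  unfold IsQuartic₁ at H
  intro x₁ y₁ z₁ x₂ y₂ z₂ x₃ y₃ z₃ x₄ y₄ z₄
  simp only [LinearMap.comp_apply, AlgEquiv.toLinearMap_apply, map_mul, map_add, map_smul,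
    AlgEquiv.symm_apply_apply, H]

theorem IsQuartic₂.of_normalForm {φ : A →ₗ[k] k} {a b c : A} {p q : k}
    (M : ∀ i j l, φ (a ^ i * b ^ j * c ^ l) = coeff (index i j l) (normalForm₂ k p q)) :
    IsQuartic₂ φ a b c :=
  .of_moments
    (by simpa [coeff_normalForm₂] using M 4 0 0)
    (by simpa [coeff_normalForm₂] using M 3 1 0)
    (by simpa [coeff_normalForm₂] using M 3 0 1)
    (by simpa [coeff_normalForm₂] using M 2 2 0)
    (by simpa [coeff_normalForm₂] using M 2 1 1)
    (by simpa [coeff_normalForm₂] using M 2 0 2)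
    (by simpa [coeff_normalForm₂] using M 1 3 0)
    (by simpa [coeff_normalForm₂] using M 1 2 1)
    (by simpa [coeff_normalForm₂] using M 1 1 2)
    (by simpa [coeff_normalForm₂] using M 1 0 3)
    (by simpa [coeff_normalForm₂] using M 0 4 0)
    (by simpa [coeff_normalForm₂] using M 0 3 1)
    (by simpa [coeff_normalForm₂] using M 0 2 2)
    (by simpa [coeff_normalForm₂] using M 0 1 3)
    (by simpa [coeff_normalForm₂] using M 0 0 4)

theorem IsQuartic₂.map {φ : A →ₗ[k] k} {a b c : A} (H : IsQuartic₂ φ a b c) (e : A ≃ₐ[k] A') :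
    IsQuartic₂ (φ ∘ₗ e.symm.toLinearMap) (e a) (e b) (e c) := by
  unfold IsQuartic₂ at H
  intro x₁ y₁ z₁ x₂ y₂ z₂ x₃ y₃ z₃ x₄ y₄ z₄
  simp only [LinearMap.comp_apply, AlgEquiv.toLinearMap_apply, map_mul, map_add, map_smul,
    AlgEquiv.symm_apply_apply, H]

theorem IsQuartic₃.of_normalForm {φ : A →ₗ[k] k} {a b c : A} {p q r : k}
    (M : ∀ i j l, φ (a ^ i * b ^ j * c ^ l) = coeff (index i j l) (normalForm₃ k p q r)) :
    IsQuartic₃ φ a b c :=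
  .of_moments
    (by simpa [coeff_normalForm₃] using M 4 0 0)
    (by simpa [coeff_normalForm₃] using M 3 1 0)
    (by simpa [coeff_normalForm₃] using M 3 0 1)
    (by simpa [coeff_normalForm₃] using M 2 2 0)
    (by simpa [coeff_normalForm₃] using M 2 1 1)
    (by simpa [coeff_normalForm₃] using M 2 0 2)
    (by simpa [coeff_normalForm₃] using M 1 3 0)
    (by simpa [coeff_normalForm₃] using M 1 2 1)
    (by simpa [coeff_normalForm₃] using M 1 1 2)
    (by simpa [coeff_normalForm₃] using M 1 0 3)
    (by simpa [coeff_normalForm₃] using M 0 4 0)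
    (by simpa [coeff_normalForm₃] using M 0 3 1)
    (by simpa [coeff_normalForm₃] using M 0 2 2)
    (by simpa [coeff_normalForm₃] using M 0 1 3)
    (by simpa [coeff_normalForm₃] using M 0 0 4)

theorem IsQuartic₃.map {φ : A →ₗ[k] k} {a b c : A} (H : IsQuartic₃ φ a b c) (e : A ≃ₐ[k] A') :
    IsQuartic₃ (φ ∘ₗ e.symm.toLinearMap) (e a) (e b) (e c) := by
  unfold IsQuartic₃ at H
  intro x₁ y₁ z₁ x₂ y₂ z₂ x₃ y₃ z₃ x₄ y₄ z₄
  simp only [LinearMap.comp_apply, AlgEquiv.toLinearMap_apply, map_mul, map_add, map_smul,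
    AlgEquiv.symm_apply_apply, H]

/-- `m` carries a dual frame whose relevant moments are those of `x⁴ + y⁴ + z⁴ + e xyz`. -/
structure Realizes₁ (m : Ideal A) (e : k) : Prop where
  exists_frame : ∃ (a b c : A) (φ : A →ₗ[k] k), IsDualFrame m a b c φ ∧ IsQuartic₁ φ a b c ∧
    φ (a * b * c) = e

theorem Realizes₁.map {m : Ideal A} {e : k} (h : Realizes₁ m e) (e' : A ≃ₐ[k] A') :
    Realizes₁ (m.map e') e := by
  obtain ⟨a, b, c, φ, h, H, h₁⟩ := h
  exact ⟨_, _, _, _, h.map e', H.map e', by simpa using h₁⟩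

theorem apolar_normalForm₁ (h2 : (2 : k) ≠ 0) (h3 : (3 : k) ≠ 0) (e : k) :
    ∃ _ : IsLocalRing (Apolar (normalForm₁ k e)),
      Realizes₁ (IsLocalRing.maximalIdeal (Apolar (normalForm₁ k e))) e ∧
      IsGorenstein13331 k (Apolar (normalForm₁ k e)) := by
  have := apolar_isLocalRing (normalForm₁_ne_zero h2 h3 e)
  have hF := apolar_isDualFrame (f := normalForm₁ k e) fun d h5 => by
    rw [← index_eq d, degree_index] at h5
    rw [← index_eq d]
    exact coeff_normalForm₁_eq_zero e (by omega) (by omega)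
  have M := apolarFunctional_moment (normalForm₁ k e)
  have H := IsQuartic₁.of_normalForm M
  refine ⟨this, ⟨_, _, _, _, hF, H, ?_⟩, hF.isGorenstein₁ H h2 h3⟩
  · simpa [pow_succ, coeff_normalForm₁] using M 1 1 1

/-- `m` carries a dual frame whose relevant moments are those of `x³y + z⁴ + p y³ + q y²z`. -/
structure Realizes₂ (m : Ideal A) (p q : k) : Prop where
  exists_frame : ∃ (a b c : A) (φ : A →ₗ[k] k), IsDualFrame m a b c φ ∧ IsQuartic₂ φ a b c ∧
    φ (b * b * b) = p * 6 ∧ φ (b * b * c) = q * 2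

theorem Realizes₂.map {m : Ideal A} {p q : k} (h : Realizes₂ m p q) (e' : A ≃ₐ[k] A') :
    Realizes₂ (m.map e') p q := by
  obtain ⟨a, b, c, φ, h, H, h₁, h₂⟩ := h
  exact ⟨_, _, _, _, h.map e', H.map e', by simpa using h₁, by simpa using h₂⟩

theorem apolar_normalForm₂ (h2 : (2 : k) ≠ 0) (h3 : (3 : k) ≠ 0) (p q : k) :
    ∃ _ : IsLocalRing (Apolar (normalForm₂ k p q)),
      Realizes₂ (IsLocalRing.maximalIdeal (Apolar (normalForm₂ k p q))) p q ∧
      IsGorenstein13331 k (Apolar (normalForm₂ k p q)) := by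
  have := apolar_isLocalRing (normalForm₂_ne_zero h2 h3 p q)
  have hF := apolar_isDualFrame (f := normalForm₂ k p q) fun d h5 => by
    rw [← index_eq d, degree_index] at h5
    rw [← index_eq d]
    exact coeff_normalForm₂_eq_zero p q (by omega) (by omega)
  have M := apolarFunctional_moment (normalForm₂ k p q)
  have H := IsQuartic₂.of_normalForm M
  refine ⟨this, ⟨_, _, _, _, hF, H, ?_, ?_⟩, hF.isGorenstein₂ H h2 h3⟩
  · simpa [pow_succ, coeff_normalForm₂] using M 0 3 0
  · simpa [pow_succ, coeff_normalForm₂] using M 0 2 1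

/-- `m` carries a dual frame whose relevant moments are those of `x³y + x²z² + p y³ + q y²z + r yz²`. -/
structure Realizes₃ (m : Ideal A) (p q r : k) : Prop where
  exists_frame : ∃ (a b c : A) (φ : A →ₗ[k] k), IsDualFrame m a b c φ ∧ IsQuartic₃ φ a b c ∧
    φ (b * b * b) = p * 6 ∧ φ (b * b * c) = q * 2 ∧ φ (a * b * b) - 3 * φ (b * c * c) = -6 * r

theorem Realizes₃.map {m : Ideal A} {p q r : k} (h : Realizes₃ m p q r) (e' : A ≃ₐ[k] A') :
    Realizes₃ (m.map e') p q r := by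
  obtain ⟨a, b, c, φ, h, H, h₁, h₂, h₃⟩ := h
  exact ⟨_, _, _, _, h.map e', H.map e', by simpa using h₁, by simpa using h₂, by simpa using h₃⟩

theorem apolar_normalForm₃ (h2 : (2 : k) ≠ 0) (h3 : (3 : k) ≠ 0) (p q r : k) :
    ∃ _ : IsLocalRing (Apolar (normalForm₃ k p q r)),
      Realizes₃ (IsLocalRing.maximalIdeal (Apolar (normalForm₃ k p q r))) p q r ∧
      IsGorenstein13331 k (Apolar (normalForm₃ k p q r)) := by
  have := apolar_isLocalRing (normalForm₃_ne_zero h2 h3 p q r)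
  have hF := apolar_isDualFrame (f := normalForm₃ k p q r) fun d h5 => by
    rw [← index_eq d, degree_index] at h5
    rw [← index_eq d]
    exact coeff_normalForm₃_eq_zero p q r (by omega) (by omega)
  have M := apolarFunctional_moment (normalForm₃ k p q r)
  have H := IsQuartic₃.of_normalForm M
  refine ⟨this, ⟨_, _, _, _, hF, H, ?_, ?_, ?_⟩, hF.isGorenstein₃ H h2 h3⟩
  · simpa [pow_succ, coeff_normalForm₃] using M 0 3 0
  · simpa [pow_succ, coeff_normalForm₃] using M 0 2 1
  · have e₁ := M 1 2 0
    have e₂ := M 0 1 2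
    simp only [pow_succ, pow_zero, one_mul, mul_one, coeff_normalForm₃, ← mul_assoc] at e₁ e₂
    rw [e₁, e₂]
    norm_num
    ring

section

variable {m : Ideal A} {e e' p q r p' q' r' : k}

theorem Realizes₁.not_realizes₂ (h2 : (2 : k) ≠ 0) (h3 : (3 : k) ≠ 0) (h : Realizes₁ m e)
    (h' : Realizes₂ m p q) : False := by
  obtain ⟨a, b, c, φ, h, H, -⟩ := h
  obtain ⟨a', b', c', φ', h', H', -⟩ := h'
  exact h.not_quartic₁_quartic₂ H h' H' h2 h3

theorem Realizes₁.not_realizes₃ (h2 : (2 : k) ≠ 0) (h3 : (3 : k) ≠ 0) (h : Realizes₁ m e)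
    (h' : Realizes₃ m p q r) : False := by
  obtain ⟨a, b, c, φ, h, H, -⟩ := h
  obtain ⟨a', b', c', φ', h', H', -⟩ := h'
  exact h.not_quartic₁_quartic₃ H h' H' h2 h3

theorem Realizes₂.not_realizes₃ (h2 : (2 : k) ≠ 0) (h3 : (3 : k) ≠ 0) (h : Realizes₂ m p q)
    (h' : Realizes₃ m p' q' r') : False := by
  obtain ⟨a, b, c, φ, h, H, -⟩ := h
  obtain ⟨a', b', c', φ', h', H', -⟩ := h'
  exact h.not_quartic₂_quartic₃ H h' H' h2 h3

theorem Realizes₁.eq_zero (h2 : (2 : k) ≠ 0) (h3 : (3 : k) ≠ 0) (h : Realizes₁ m e)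
    (h' : Realizes₁ m e') (he : e = 0) : e' = 0 := by
  obtain ⟨a, b, c, φ, h, H, h₁⟩ := h
  obtain ⟨a', b', c', φ', h', H', h₁'⟩ := h'
  have h0 := (h.eq_zero_iff_of_mem_pow_four (mul_mem_pow_succ (h.mul_ab_mem_cube₁ H h2 h3)
    h.mem_c)).2 (h₁.trans he)
  rw [← h₁', h.mul_eq_zero_of_quartic₁ H h' H' h2 h3 h0, map_zero]

theorem Realizes₂.eq_zero (h2 : (2 : k) ≠ 0) (h3 : (3 : k) ≠ 0) (h : Realizes₂ m p q)
    (h' : Realizes₂ m p' q') : (p = 0 → p' = 0) ∧ (q = 0 → q' = 0) := by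
  obtain ⟨a, b, c, φ, h, H, h₁, h₂⟩ := h
  obtain ⟨a', b', c', φ', h', H', h₁', h₂'⟩ := h'
  have hbb := h.mul_bb_mem_cube₂ H h2 h3
  constructor
  · rintro rfl
    have h0 := (h.eq_zero_iff_of_mem_pow_four (mul_mem_pow_succ hbb h.mem_b)).2
      (h₁.trans (zero_mul _))
    rw [h.cube_eq_zero_of_quartic₂ H h' H' h2 h3 h0, map_zero] at h₁'
    exact (mul_eq_zero.1 h₁'.symm).resolve_right (six_ne_zero_of h2 h3)
  · rintro rfl
    have h0 := (h.eq_zero_iff_of_mem_pow_four (mul_mem_pow_succ hbb h.mem_c)).2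
      (h₂.trans (zero_mul _))
    rw [h.sq_mul_eq_zero_of_quartic₂ H h' H' h2 h3 h0, map_zero] at h₂'
    exact (mul_eq_zero.1 h₂'.symm).resolve_right h2

/-- The invariants are hierarchical: the vanishing of `p` is unconditional, that of `q` is compared
when `p = 0`, and that of `r` when `q = q' = 0`. This suffices to separate the five normal forms of
the third type. -/
theorem Realizes₃.eq_zero (h2 : (2 : k) ≠ 0) (h3 : (3 : k) ≠ 0) (h : Realizes₃ m p q r)
    (h' : Realizes₃ m p' q' r') : (p = 0 → p' = 0) ∧ (p = 0 → q = 0 → q' = 0) ∧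
      (q = 0 → q' = 0 → r = 0 → r' = 0) := by
  obtain ⟨a, b, c, φ, h, H, h₁, h₂, h₃⟩ := h
  obtain ⟨a', b', c', φ', h', H', h₁', h₂', h₃'⟩ := h'
  have hbb := h.mul_bb_mem_cube₃ H h2 h3
  have hbc := h.mul_bc_mem_cube₃ H h2 h3
  have hbb' := h'.mul_bb_mem_cube₃ H' h2 h3
  have hb : p = 0 → b * b * b = 0 := fun hp =>
    (h.eq_zero_iff_of_mem_pow_four (mul_mem_pow_succ hbb h.mem_b)).2 (by rw [h₁, hp, zero_mul])
  have hc : q = 0 → b * b * c = 0 := fun hq =>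
    (h.eq_zero_iff_of_mem_pow_four (mul_mem_pow_succ hbb h.mem_c)).2 (by rw [h₂, hq, zero_mul])
  have hc' : q' = 0 → b' * b' * c' = 0 := fun hq =>
    (h'.eq_zero_iff_of_mem_pow_four (mul_mem_pow_succ hbb' h'.mem_c)).2 (by rw [h₂', hq, zero_mul])
  refine ⟨fun hp => ?_, fun hp hq => ?_, fun hq hq' hr => ?_⟩
  · rw [h.cube_eq_zero_of_quartic₃ H h' H' h2 h3 (hb hp), map_zero] at h₁'
    exact (mul_eq_zero.1 h₁'.symm).resolve_right (six_ne_zero_of h2 h3)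
  · rw [h.sq_mul_eq_zero_of_quartic₃ H h' H' h2 h3 (hb hp) (hc hq), map_zero] at h₂'
    exact (mul_eq_zero.1 h₂'.symm).resolve_right h2
  · have h0 : a * b * b - (3 : k) • (b * c * c) = 0 := by
      refine (h.eq_zero_iff_of_mem_pow_four (Ideal.sub_mem _ ?_ (smul_mem_ideal _
        (mul_mem_pow_succ hbc h.mem_c)))).2 ?_
      · rw [show a * b * b = b * b * a by ring]
        exact mul_mem_pow_succ hbb h.mem_a
      · rw [map_sub, map_smul, smul_eq_mul, h₃, hr, mul_zero]
    have h0' := congrArg φ' (h.invariant_eq_zero_of_quartic₃ H h' H' h2 h3 (hc hq) (hc' hq') h0)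
    rw [map_sub, map_smul, smul_eq_mul, h₃', map_zero] at h0'
    exact (mul_eq_zero.1 h0').resolve_left (neg_ne_zero.2 (six_ne_zero_of h2 h3))

/-- `m` carries a dual frame of the same type as the apolar algebra of the `i`-th generator. -/
def HasType (k : Type*) {A : Type*} [Field k] [CommRing A] [Algebra k A] (m : Ideal A) :
    Fin 11 → Prop :=
  ![Realizes₁ m (0 : k), Realizes₁ m (1 : k),
    Realizes₂ m (0 : k) 0, Realizes₂ m (1 : k) 0, Realizes₂ m (0 : k) 1, Realizes₂ m (1 : k) 1,
    Realizes₃ m (1 : k) 0 0, Realizes₃ m (1 : k) 0 1, Realizes₃ m (0 : k) 1 0,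
    Realizes₃ m (0 : k) 0 1, Realizes₃ m (0 : k) 0 0]

theorem HasType.unique (h2 : (2 : k) ≠ 0) (h3 : (3 : k) ≠ 0) {i j : Fin 11}
    (hi : HasType k m i) (hj : HasType k m j) : i = j := by
  fin_cases i <;> fin_cases j <;> first
    | rfl
    | exact (Realizes₁.not_realizes₂ h2 h3 hi hj).elim
    | exact (Realizes₁.not_realizes₂ h2 h3 hj hi).elim
    | exact (Realizes₁.not_realizes₃ h2 h3 hi hj).elim
    | exact (Realizes₁.not_realizes₃ h2 h3 hj hi).elim
    | exact (Realizes₂.not_realizes₃ h2 h3 hi hj).elim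
    | exact (Realizes₂.not_realizes₃ h2 h3 hj hi).elim
    | exact (one_ne_zero (Realizes₁.eq_zero h2 h3 hi hj rfl)).elim
    | exact (one_ne_zero (Realizes₁.eq_zero h2 h3 hj hi rfl)).elim
    | exact (one_ne_zero ((Realizes₂.eq_zero h2 h3 hi hj).1 rfl)).elim
    | exact (one_ne_zero ((Realizes₂.eq_zero h2 h3 hj hi).1 rfl)).elim
    | exact (one_ne_zero ((Realizes₂.eq_zero h2 h3 hi hj).2 rfl)).elim
    | exact (one_ne_zero ((Realizes₂.eq_zero h2 h3 hj hi).2 rfl)).elim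
    | exact (one_ne_zero ((Realizes₃.eq_zero h2 h3 hi hj).1 rfl)).elim
    | exact (one_ne_zero ((Realizes₃.eq_zero h2 h3 hj hi).1 rfl)).elim
    | exact (one_ne_zero ((Realizes₃.eq_zero h2 h3 hi hj).2.1 rfl rfl)).elim
    | exact (one_ne_zero ((Realizes₃.eq_zero h2 h3 hj hi).2.1 rfl rfl)).elim
    | exact (one_ne_zero ((Realizes₃.eq_zero h2 h3 hi hj).2.2 rfl rfl rfl)).elim
    | exact (one_ne_zero ((Realizes₃.eq_zero h2 h3 hj hi).2.2 rfl rfl rfl)).elim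

theorem HasType.map {i : Fin 11} (h : HasType k m i) (e : A ≃ₐ[k] A') : HasType k (m.map e) i := by
  fin_cases i <;> first
    | exact Realizes₁.map h e
    | exact Realizes₂.map h e
    | exact Realizes₃.map h e

end

variable (k) in
theorem generators13331_eq : generators13331 k =
    ![normalForm₁ k 0, normalForm₁ k 1,
      normalForm₂ k 0 0, normalForm₂ k 1 0, normalForm₂ k 0 1, normalForm₂ k 1 1,
      normalForm₃ k 1 0 0, normalForm₃ k 1 0 1, normalForm₃ k 0 1 0,
      normalForm₃ k 0 0 1, normalForm₃ k 0 0 0] := by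
  simp [generators13331, normalForm₁, normalForm₂, normalForm₃]

theorem apolar_generators13331 (h2 : (2 : k) ≠ 0) (h3 : (3 : k) ≠ 0) (i : Fin 11) :
    ∃ _ : IsLocalRing (Apolar (generators13331 k i)),
      HasType k (IsLocalRing.maximalIdeal (Apolar (generators13331 k i))) i ∧
      IsGorenstein13331 k (Apolar (generators13331 k i)) := by
  rw [generators13331_eq]
  fin_cases i
  · exact apolar_normalForm₁ h2 h3 0
  · exact apolar_normalForm₁ h2 h3 1
  · exact apolar_normalForm₂ h2 h3 0 0
  · exact apolar_normalForm₂ h2 h3 1 0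
  · exact apolar_normalForm₂ h2 h3 0 1
  · exact apolar_normalForm₂ h2 h3 1 1
  · exact apolar_normalForm₃ h2 h3 1 0 0
  · exact apolar_normalForm₃ h2 h3 1 0 1
  · exact apolar_normalForm₃ h2 h3 0 1 0
  · exact apolar_normalForm₃ h2 h3 0 0 1
  · exact apolar_normalForm₃ h2 h3 0 0 0

theorem map_maximalIdeal_algEquiv [IsLocalRing A] [IsLocalRing A'] (e : A ≃ₐ[k] A') :
    (IsLocalRing.maximalIdeal A).map e = IsLocalRing.maximalIdeal A' :=
  IsLocalRing.eq_maximalIdeal (Ideal.map_isMaximal_of_equiv e)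

/-- An isomorphism carries maximal ideal to maximal ideal, so both types would be realized on the
same ideal. -/
theorem eq_of_apolar_algEquiv (h2 : (2 : k) ≠ 0) (h3 : (3 : k) ≠ 0) {i j : Fin 11}
    (e : Apolar (generators13331 k i) ≃ₐ[k] Apolar (generators13331 k j)) : i = j := by
  obtain ⟨_, hi, -⟩ := apolar_generators13331 h2 h3 i
  obtain ⟨_, hj, -⟩ := apolar_generators13331 h2 h3 j
  have hi' := hi.map e
  rw [map_maximalIdeal_algEquiv] at hi'
  exact hi'.unique h2 h3 hj

theorem exists_algEquiv_apolar_generators13331 [IsAlgClosed k] (h2 : (2 : k) ≠ 0)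
    (h3 : (3 : k) ≠ 0) (h13 : (13 : k) ≠ 0) (hA : IsGorenstein13331 k A) :
    ∃ i, Nonempty (A ≃ₐ[k] Apolar (generators13331 k i)) := by
  obtain ⟨_, hG, hH⟩ := hA
  obtain ⟨φ, D⟩ := exists_isDualized13331 hG hH
  obtain ⟨a, b, c, hf, H | H | H⟩ := D.exists_quartic h2 h3
  all_goals have h := D.isDualFrame hf
  all_goals rw [generators13331_eq]
  · obtain ⟨e, rfl | rfl, he⟩ := h.exists_algEquiv_normalForm₁ H h2 h3
    · exact ⟨0, he⟩
    · exact ⟨1, he⟩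
  · obtain ⟨p, q, rfl | rfl, rfl | rfl, he⟩ := h.exists_algEquiv_normalForm₂ H h2 h3
    · exact ⟨2, he⟩
    · exact ⟨4, he⟩
    · exact ⟨3, he⟩
    · exact ⟨5, he⟩
  · obtain ⟨p, q, r, hpqr, he⟩ := h.exists_algEquiv_normalForm₃ H h2 h3 h13
    obtain ⟨rfl, rfl, rfl⟩ | ⟨rfl, rfl, rfl⟩ | ⟨rfl, rfl, rfl⟩ | ⟨rfl, rfl, rfl⟩ |
      ⟨rfl, rfl, rfl⟩ := hpqr
    · exact ⟨6, he⟩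
    · exact ⟨7, he⟩
    · exact ⟨8, he⟩
    · exact ⟨9, he⟩
    · exact ⟨10, he⟩

end Realizations

/-! ### The classification theorem -/

theorem mainTheorem6 {k : Type*} [Field k] [IsAlgClosed k] (p : ℕ) [CharP k p]
    (hp : p = 0 ∨ 4 < p) :
    (∀ i, IsGorenstein13331 k (Apolar (generators13331 k i))) ∧
    (∀ i j, i ≠ j →
      IsEmpty (Apolar (generators13331 k i) ≃ₐ[k] Apolar (generators13331 k j))) ∧
    (p ≠ 13 → ∀ (A : Type*) [CommRing A] [Algebra k A], IsGorenstein13331 k A →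
      ∃! i, Nonempty (A ≃ₐ[k] Apolar (generators13331 k i))) := by
  have hne : ∀ n : ℕ, 0 < n → n ≤ 4 → (n : k) ≠ 0 := fun n h0 h4 h => by
    have hd := (CharP.cast_eq_zero_iff k p n).1 h
    have := Nat.le_of_dvd h0 hd
    rcases hp with rfl | hp
    · exact h0.ne' (Nat.zero_dvd.1 hd)
    · omega
  have h2 : (2 : k) ≠ 0 := by exact_mod_cast hne 2 (by norm_num) (by norm_num)
  have h3 : (3 : k) ≠ 0 := by exact_mod_cast hne 3 (by norm_num) (by norm_num)
  refine ⟨fun i => ?_, fun i j hij => ⟨fun e => hij (eq_of_apolar_algEquiv h2 h3 e)⟩,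
    fun hp13 A _ _ hA => ?_⟩
  · obtain ⟨_, -, h⟩ := apolar_generators13331 h2 h3 i
    exact h
  · have h13 : (13 : k) ≠ 0 := fun h => by
      have hd := (CharP.cast_eq_zero_iff k p 13).1 (by exact_mod_cast h)
      rcases (Nat.dvd_prime (by norm_num)).1 hd with h1 | h1 <;> omega
    obtain ⟨i, ⟨e⟩⟩ := exists_algEquiv_apolar_generators13331 h2 h3 h13 hA
    exact ⟨i, ⟨e⟩, fun j ⟨e'⟩ => eq_of_apolar_algEquiv h2 h3 (e'.symm.trans e)⟩
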